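/- Let $K$ be a field of characteristic $0$, let $U$ be a pro-unipotent group over $K$ with coordinate ring $\mathcal O(U)$, and let $\Pi$ be a unipotent algebraic group over $K$ with an algebraic action of $U$ by group automorphisms. For a commutative $K$-algebra $R$, let $Z^1(U;\Pi)(R)$ be the set of morphisms of $R$-schemes $c\colon U_R\to\Pi_R$, $g\mapsto c_g$, such that $c_{gh}=c_g\cdot g(c_h)$ for all points $g,h$ of $U$ with values in any commutative $R$-algebra. Equip $\operatorname{Lie}U$ with its natural topology as a pro-finite-dimensional vector space: a basis of neighbourhoods of $0$ is given by the subspaces of tangent vectors at the identity (point derivations $\mathcal O(U)\to K$) vanishing on a finite subset of $\mathcal O(U)$. Let $Z^1(\operatorname{Lie}U;\operatorname{Lie}\Pi)(R)$ be the set of $K$-linear maps $$c\colon \operatorname{Lie}U\to R\otimes_K\operatorname{Lie}\Pi$$ that are continuous (the target being discrete) and satisfy, for all $g,h\in\operatorname{Lie}U$, $$c([g,h])=[c(g),c(h)]+g(c(h))-h(c(g)),$$ where $\operatorname{Lie}U$ acts on $R\otimes_K\operatorname{Lie}\Pi$ by the ($R$-linear) derivations induced by the action of $U$ on $\Pi$.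 Then for every commutative $K$-algebra $R$, taking the differential at the identity of $U$, i.e. sending $c$ to the map $dc$ with $c_{1+\varepsilon\delta}=1+\varepsilon\, dc(\delta)$ in $\Pi(R[\varepsilon]/\varepsilon^2)$ for $\delta\in\operatorname{Lie}U$, defines a bijection $$Z^1(U;\Pi)(R)\;\longrightarrow\; Z^1(\operatorname{Lie}U;\operatorname{Lie}\Pi)(R).$$ In particular (for $R=K$), group cocycles $U\to\Pi$ correspond bijectively to continuous Lie algebra cocycles $\operatorname{Lie}U\to\operatorname{Lie}\Pi$. -/

import Mathlib

open scoped TensorProduct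

universe u

/-! Affine group schemes over a field `K` are represented by commutative Hopf algebras over `K`:
`A = O(U)` and `B = O(Π)`. -/

/-- `G(S)`, the group of `S`-valued points of the affine group scheme `G` with coordinate ring `H`.
The group law is convolution: `g * h = (g ⊗ h) ∘ Δ`. -/
abbrev GroupPoints (K H S : Type u) [Field K] [CommRing H] [HopfAlgebra K H]
    [CommRing S] [Algebra K S] : Type u :=
  WithConv (H →ₐ[K] S)

/-- `ρ : V → V ⊗ H` is a (right) comodule structure, that is, a linear representation on `V` of
the affine group scheme with coordinate ring `H`. -/
structure IsGroupRep {K H V : Type u} [Field K] [CommRing H] [HopfAlgebra K H]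
    [AddCommGroup V] [Module K V] (ρ : V →ₗ[K] V ⊗[K] H) : Prop where
  coassoc : (TensorProduct.assoc K V H H).toLinearMap ∘ₗ ρ.rTensor H ∘ₗ ρ =
    (Coalgebra.comul (R := K) (A := H)).lTensor V ∘ₗ ρ
  counit : (TensorProduct.rid K V).toLinearMap ∘ₗ
    (Coalgebra.counit (R := K) (A := H)).lTensor V ∘ₗ ρ = LinearMap.id

/-- The affine group scheme with coordinate ring `H` is pro-unipotent: every nonzero linear
representation has a nonzero fixed vector. If `H` is moreover a finitely generated algebra, then
this says that the group is a unipotent algebraic group. -/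
def IsProUnipotent (K H : Type u) [Field K] [CommRing H] [HopfAlgebra K H] : Prop :=
  ∀ (V : Type u) [AddCommGroup V] [Module K V] [Nontrivial V] (ρ : V →ₗ[K] V ⊗[K] H),
    IsGroupRep ρ → ∃ v : V, v ≠ 0 ∧ ρ v = v ⊗ₜ[K] (1 : H)

/-- The affine group scheme with coordinate ring `H` is a unipotent algebraic group. -/
def IsUnipotentGroup (K H : Type u) [Field K] [CommRing H] [HopfAlgebra K H] : Prop :=
  Algebra.FiniteType K H ∧ IsProUnipotent K H

/-- The product formula for `f ⊗ f'` when `f`, `f'` are derivations relative to `e`, `e'`. -/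
theorem map_mul_of_derivations {K A B R : Type u} [Field K] [CommRing A] [Algebra K A]
    [CommRing B] [Algebra K B] [CommRing R] [Algebra K R]
    (e f : A →ₗ[K] R) (e' f' : B →ₗ[K] R)
    (hf : ∀ a b, f (a * b) = e a * f b + e b * f a)
    (hf' : ∀ a b, f' (a * b) = e' a * f' b + e' b * f' a) (s t : A ⊗[K] B) :
    LinearMap.mul' K R (TensorProduct.map f f' (s * t)) =
      LinearMap.mul' K R (TensorProduct.map e e' s) * LinearMap.mul' K R (TensorProduct.map f f' t)
      + LinearMap.mul' K R (TensorProduct.map e e' t) * LinearMap.mul' K R (TensorProduct.map f f' s)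
      + LinearMap.mul' K R (TensorProduct.map e f' s) * LinearMap.mul' K R (TensorProduct.map f e' t)
      + LinearMap.mul' K R (TensorProduct.map f e' s) *
        LinearMap.mul' K R (TensorProduct.map e f' t) := by
  induction s with
  | zero => simp
  | add s₁ s₂ h₁ h₂ => simp only [add_mul, map_add, h₁, h₂]; ring
  | tmul a b =>
    induction t with
    | zero => simp
    | add t₁ t₂ h₁ h₂ => simp only [mul_add, map_add, h₁, h₂]; ring
    | tmul c d =>
      simp only [Algebra.TensorProduct.tmul_mul_tmul, TensorProduct.map_tmul,
        LinearMap.mul'_apply, hf, hf']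
      ring

/-- The dual of a Hopf algebra, with values in `R`, as a Lie ring: the commutator bracket for the
convolution product. -/
noncomputable instance convDualLieRing (K H R : Type u) [Field K] [CommRing H] [HopfAlgebra K H]
    [CommRing R] [Algebra K R] : LieRing (WithConv (H →ₗ[K] R)) :=
  LieRing.ofAssociativeRing

/-- The Lie algebra `Lie(G)(R)` of the affine group scheme `G` with coordinate ring `H`, with values
in a commutative `K`-algebra `R`: the `K`-linear maps `δ : H → R` that are derivations at the
identity (tangent vectors `1 + εδ ∈ G(R[ε])`), with the commutator bracket for the convolution
product on the dual of `H`. For `R = K` this is `Lie G`; if `Lie G` is finite-dimensional it is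
`R ⊗ Lie G`. -/
noncomputable def groupLie (K H R : Type u) [Field K] [CommRing H] [HopfAlgebra K H]
    [CommRing R] [Algebra K R] : LieSubalgebra K (WithConv (H →ₗ[K] R)) where
  carrier := {δ | ∀ a b : H, δ (a * b) =
    Coalgebra.counit (R := K) a • δ b + Coalgebra.counit (R := K) b • δ a}
  add_mem' := by
    intro x y hx hy a b
    have h1 := hx a b
    have h2 := hy a b
    simp only [WithConv.ofConv_add, LinearMap.add_apply] at *
    rw [h1, h2]; simp only [smul_add]; abel
  zero_mem' := by intro a b; simp
  smul_mem' := by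
    intro r x hx a b
    have h1 := hx a b
    simp only [WithConv.ofConv_smul, LinearMap.smul_apply] at *
    rw [h1, smul_add, smul_comm r, smul_comm r]
  lie_mem' := by
    intro x y hx hy a b
    let e : WithConv (H →ₗ[K] R) := 1
    have h0 : ∀ a, e a = algebraMap K R (Coalgebra.counit (R := K) a) := fun a => rfl
    have hx' : ∀ a b, x (a * b) = e a * x b + e b * x a := by
      intro a b; rw [hx a b, h0, h0, Algebra.smul_def, Algebra.smul_def]
    have hy' : ∀ a b, y (a * b) = e a * y b + e b * y a := by
      intro a b; rw [hy a b, h0, h0, Algebra.smul_def, Algebra.smul_def]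
    have key : ∀ z w : WithConv (H →ₗ[K] R), (∀ a b, z (a * b) = e a * z b + e b * z a) →
        (∀ a b, w (a * b) = e a * w b + e b * w a) →
        (z * w) (a * b) = e a * (z * w) b + e b * (z * w) a + w a * z b + z a * w b := by
      intro z w hz hw
      have h := map_mul_of_derivations e.ofConv z.ofConv e.ofConv w.ofConv hz hw
        (Coalgebra.comul (R := K) a) (Coalgebra.comul (R := K) b)
      rw [← Bialgebra.comul_mul] at h
      simp only [← LinearMap.convMul_apply] at h
      simpa only [e, one_mul, mul_one] using h
    have hl : ∀ c : H, (⁅x, y⁆ : WithConv (H →ₗ[K] R)) c = (x * y) c - (y * x) c := fun c => rfl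
    rw [hl, hl, hl, key x y hx' hy', key y x hy' hx', Algebra.smul_def, Algebra.smul_def, ← h0,
      ← h0]
    ring

/-- The effect on `S`-points of a morphism `X × Y → Y` given by `coact : O(Y) → O(X) ⊗ O(Y)`:
the point `(g, p)` is sent to `(g ⊗ p) ∘ coact`. -/
noncomputable def actPoint {K A B S : Type u} [Field K] [CommRing A] [HopfAlgebra K A]
    [CommRing B] [HopfAlgebra K B] [CommRing S] [Algebra K S] (coact : B →ₐ[K] A ⊗[K] B)
    (g : GroupPoints K A S) (p : GroupPoints K B S) : GroupPoints K B S :=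
  WithConv.toConv
    ((Algebra.TensorProduct.lift g.ofConv p.ofConv fun _ _ => .all _ _).comp coact)

/-- An action of the affine group scheme `U` (coordinate ring `A`) on the affine group scheme `Π`
(coordinate ring `B`) by group automorphisms: a morphism `U × Π → Π` which on `S`-points satisfies
the usual laws, for all commutative `K`-algebras `S`. -/
structure GroupSchemeAction (K A B : Type u) [Field K] [CommRing A] [HopfAlgebra K A]
    [CommRing B] [HopfAlgebra K B] where
  coact : B →ₐ[K] A ⊗[K] B
  one_act : ∀ (S : Type u) [CommRing S] [Algebra K S] (p : GroupPoints K B S),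
    actPoint coact 1 p = p
  mul_act : ∀ (S : Type u) [CommRing S] [Algebra K S] (g h : GroupPoints K A S)
    (p : GroupPoints K B S), actPoint coact (g * h) p = actPoint coact g (actPoint coact h p)
  act_mul : ∀ (S : Type u) [CommRing S] [Algebra K S] (g : GroupPoints K A S)
    (p q : GroupPoints K B S),
    actPoint coact g (p * q) = actPoint coact g p * actPoint coact g q

namespace GroupSchemeAction

variable {K A B : Type u} [Field K] [CommRing A] [HopfAlgebra K A] [CommRing B] [HopfAlgebra K B]
  (α : GroupSchemeAction K A B)

theorem act_one (g : GroupPoints K A A) :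
    actPoint α.coact g (1 : GroupPoints K B A) = 1 := by
  have h := α.act_mul A g 1 1
  rw [mul_one] at h
  exact left_eq_mul.mp h

theorem counit_coact (b : B) :
    TensorProduct.lid K B ((Coalgebra.counit (R := K) (A := A)).rTensor B (α.coact b)) = b := by
  have h := congrArg (fun q : GroupPoints K B B => q b)
    (α.one_act B (WithConv.toConv (AlgHom.id K B)))
  refine Eq.trans ?_ h
  change _ = Algebra.TensorProduct.lift _ _ (fun _ _ => .all _ _) (α.coact b)
  induction α.coact b with
  | zero => simp
  | add x y hx hy => simp only [map_add, hx, hy]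
  | tmul x y => simp [Algebra.smul_def]

theorem coact_counit (b : B) :
    TensorProduct.rid K A ((Coalgebra.counit (R := K) (A := B)).lTensor A (α.coact b)) =
      algebraMap K A (Coalgebra.counit (R := K) b) := by
  have h := congrArg (fun q : GroupPoints K B A => q b)
    (α.act_one (WithConv.toConv (AlgHom.id K A)))
  refine Eq.trans ?_ h
  change _ = Algebra.TensorProduct.lift _ _ (fun _ _ => .all _ _) (α.coact b)
  induction α.coact b with
  | zero => simp
  | add x y hx hy => simp only [map_add, hx, hy]
  | tmul x y => simp [Algebra.smul_def, mul_comm]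

/-- The induced action of `Lie U` on `Lie(Π)(R)`: `g(δ) = (g ⊗ δ) ∘ coact`, the derivative at
`u = 1` in the direction `g` of `u ↦ u(δ)`. -/
noncomputable def lieAct {R : Type u} [CommRing R] [Algebra K R]
    (g : groupLie K A K) (δ : groupLie K B R) : groupLie K B R :=
  ⟨WithConv.toConv ((TensorProduct.lid K R).toLinearMap ∘ₗ
    TensorProduct.map g.1.ofConv δ.1.ofConv ∘ₗ α.coact.toLinearMap), by
    intro a b
    let ι : K →ₗ[K] R := Algebra.linearMap K R
    let εA : A →ₗ[K] R := ι ∘ₗ Coalgebra.counit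
    let εB : B →ₗ[K] R := ι ∘ₗ Coalgebra.counit
    have hg := g.2
    have hδ := δ.2
    have h := map_mul_of_derivations εA (ι ∘ₗ g.1.ofConv) εB δ.1.ofConv
      (fun x y => by
        have := hg x y
        simp only [εA, ι, LinearMap.comp_apply, this]; simp)
      (fun x y => by
        have := hδ x y
        simp only [εB, ι, LinearMap.comp_apply, this]; simp [Algebra.smul_def])
      (α.coact a) (α.coact b)
    have e1 : ∀ (t : A ⊗[K] B), LinearMap.mul' K R
        (TensorProduct.map (ι ∘ₗ g.1.ofConv) δ.1.ofConv t) =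
        TensorProduct.lid K R (TensorProduct.map g.1.ofConv δ.1.ofConv t) := by
      intro t
      induction t with
      | zero => simp
      | add x y hx hy => simp only [map_add, hx, hy]
      | tmul x y => simp [ι, Algebra.smul_def]
    have e2 : ∀ c : B, LinearMap.mul' K R (TensorProduct.map εA εB (α.coact c)) =
        algebraMap K R (Coalgebra.counit (R := K) c) := by
      intro c
      conv_rhs => rw [← α.counit_coact c]
      induction α.coact c with
      | zero => simp
      | add x y hx hy => simp only [map_add, hx, hy]
      | tmul x y => simp [εA, εB, ι]
    have e3 : ∀ c : B, LinearMap.mul' K R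
        (TensorProduct.map (ι ∘ₗ g.1.ofConv) εB (α.coact c)) = 0 := by
      intro c
      have h1 : g.1.ofConv (1 : A) = 0 := by
        have := hg 1 1
        simpa using this
      have h2 : g.1.ofConv (algebraMap K A (Coalgebra.counit (R := K) c)) = 0 := by
        rw [Algebra.algebraMap_eq_smul_one, map_smul, h1, smul_zero]
      rw [← α.coact_counit c] at h2
      have h3 := congrArg ι h2
      rw [map_zero] at h3
      refine Eq.trans ?_ h3
      induction α.coact c with
      | zero => simp
      | add x y hx hy => simp only [map_add, hx, hy]
      | tmul x y => simp [εB, ι, mul_comm]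
    rw [e1, e1, e1, e2, e2, e3, e3, mul_zero, zero_mul, add_zero, add_zero, ← map_mul] at h
    simpa [Algebra.smul_def] using h⟩

end GroupSchemeAction

/-- For a morphism `c : U_R → Π_R`, given by `c : O(Π) → R ⊗ O(U)`, an `R`-algebra `S` (with
structure map `φ`) and `g ∈ U(S)`, the point `c_g ∈ Π(S)`. -/
noncomputable def evalPoint {K A B R S : Type u} [Field K] [CommRing A] [HopfAlgebra K A]
    [CommRing B] [HopfAlgebra K B] [CommRing R] [Algebra K R] [CommRing S] [Algebra K S]
    (c : B →ₐ[K] R ⊗[K] A) (φ : R →ₐ[K] S) (g : GroupPoints K A S) : GroupPoints K B S :=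
  WithConv.toConv ((Algebra.TensorProduct.lift φ g.ofConv fun _ _ => .all _ _).comp c)

/-- `Z¹(U; Π)(R)`: morphisms of `R`-schemes `c : U_R → Π_R` such that `c_{gh} = c_g · g(c_h)` for
all points `g, h` of `U` in all `R`-algebras `S`. -/
structure GroupCocycle {K A B : Type u} [Field K] [CommRing A] [HopfAlgebra K A]
    [CommRing B] [HopfAlgebra K B] (α : GroupSchemeAction K A B)
    (R : Type u) [CommRing R] [Algebra K R] where
  toAlgHom : B →ₐ[K] R ⊗[K] A
  cocycle : ∀ (S : Type u) [CommRing S] [Algebra K S] (φ : R →ₐ[K] S) (g h : GroupPoints K A S),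
    evalPoint toAlgHom φ (g * h) =
      evalPoint toAlgHom φ g * actPoint α.coact g (evalPoint toAlgHom φ h)

/-- The differential at the identity of `c ∈ Z¹(U; Π)(R)`, evaluated at `δ ∈ Lie U`: the map
`(id ⊗ δ) ∘ c : O(Π) → R`, which is the coefficient of `ε` in `c_{1 + εδ} ∈ Π(R[ε])`. -/
noncomputable def GroupCocycle.differential {K A B : Type u} [Field K] [CommRing A]
    [HopfAlgebra K A] [CommRing B] [HopfAlgebra K B] {α : GroupSchemeAction K A B}
    {R : Type u} [CommRing R] [Algebra K R] (c : GroupCocycle α R) (δ : groupLie K A K) :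
    B →ₗ[K] R :=
  (TensorProduct.rid K R).toLinearMap ∘ₗ δ.1.ofConv.lTensor R ∘ₗ c.toAlgHom.toLinearMap

/-- `Z¹(Lie U; Lie Π)(R)`: the `K`-linear maps `c : Lie U → Lie(Π)(R)` that are continuous for the
pro-finite-dimensional topology of `Lie U` (a neighbourhood basis of `0` is given by the subspaces
of tangent vectors vanishing on a finite subset of `O(U)`) and the discrete topology of the target,
and that satisfy the cocycle condition. -/
structure LieCocycle {K A B : Type u} [Field K] [CommRing A] [HopfAlgebra K A]
    [CommRing B] [HopfAlgebra K B] (α : GroupSchemeAction K A B)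
    (R : Type u) [CommRing R] [Algebra K R] where
  toLinearMap : groupLie K A K →ₗ[K] groupLie K B R
  continuous : ∃ F : Finset A, ∀ δ : groupLie K A K, (∀ a ∈ F, δ.1 a = 0) → toLinearMap δ = 0
  cocycle : ∀ g h : groupLie K A K, toLinearMap ⁅g, h⁆ =
    ⁅toLinearMap g, toLinearMap h⁆ + α.lieAct g (toLinearMap h) - α.lieAct h (toLinearMap g)

/-!
Write `D_δ` for the derivation `(δ ⊗ id) ∘ Δ` of `R ⊗ O(U)` and `Q_δ` for the derivation
`(δ ⊗ id) ∘ coact` of `O(Π)` attached to `δ ∈ Lie U`. Differentiating `c_{gh} = c_g * g(c_h)` with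
respect to `g` at the identity shows that a group cocycle `c` with differential `θ` satisfies the
linear differential equation `D_δ ∘ c = θ(δ) * c + c ∘ Q_δ` (`IsCocycleSolution`), with the initial
condition that `c` is the identity of `Π` at the identity of `U`. The cocycle condition for `θ` is
read off from the commutators of the `D_δ`, and `θ` is continuous because `O(Π)` is finitely
generated. So the theorem amounts to existence and uniqueness for this equation, given an initial
value, together with the fact that its solutions are group cocycles.

*Uniqueness.* On the coordinate ring of a pro-unipotent group, the series
`e = log(id) = ∑ₘ (-1)ᵐ⁻¹ (id - 1)ᵐ / m` for the convolution product is locally finite, `e` is a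
tangent vector with values in `O(U)` (`eulerian`), and `id = exp e` (`exists_sum_eulerian_pow`).
Being determined on any finite set by scalar tangent vectors, `e` maps a subspace stable under all
`D_δ` that vanishes at the identity to zero, and so does `id`
(`eq_zero_of_stable_of_counit_eq_zero`). A family of functions whose derivatives are combinations
of its members is therefore determined by its value at the identity
(`eq_zero_of_derivation_mem_range`). This yields injectivity; it also shows that a linear map
solving the equation is multiplicative, and a cocycle, since in both cases two expressions satisfy
the same equation with the same initial value.

*Existence.* A Lie algebra cocycle `θ` extends `S`-linearly to `(Lie U)(S)`, and
`X ↦ (θ(X), X)` is then a Lie algebra homomorphism to the Lie algebra of `Π ⋊ U`, which acts on `Π`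
by `(p, u) • q = p * u(q)`; this gives vector fields on `Π` (`vectorField`, `vectorField_lie`). They
act locally nilpotently on `O(Π)` because `Π ⋊ U` is pro-unipotent (`exists_mem_jointFiltration`).
Hence the exponential of the vector field attached to `e`, the logarithm of the universal point of
`U`, is defined, and its value at `1 ∈ Π` is the desired cocycle `g ↦ exp(θ(log g), log g) • 1`
(`orbitPullback`). That it satisfies the equation follows from the formula for the derivative of
the exponential map, which holds for the vector fields as it does in the convolution algebra of
`O(U)` (`exists_sum_adIter`, `derivation_orbitPullback`).
-/

/-! ### Linear maps with values in a commutative algebra -/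

section LinearAlgebra

variable {K H S V W : Type u} [Field K] [AddCommGroup H] [Module K H] [CommRing S] [Algebra K S]
  [AddCommGroup V] [Module K V] [AddCommGroup W] [Module K W]

/-- Density of the scalar functionals: a linear map `X : H → S` vanishing on `D` agrees, on any
given finite subset of `H`, with an `S`-linear combination of functionals `H → K` vanishing on `D`.
Hence a property of such `X` that is `S`-linear and only depends on the values of `X` on a finite
set can be checked on functionals. -/
theorem mem_of_forall_functional {M : Type u} [AddCommGroup M] [Module S M] (D : Submodule K H)
    (f : (H →ₗ[K] S) →ₗ[S] M) (M' : Submodule S M)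
    (hf : ∃ F : Finset H, ∀ X, (∀ a ∈ F, X a = 0) → f X = 0)
    (h : ∀ φ : H →ₗ[K] K, (∀ d ∈ D, φ d = 0) → f (Algebra.linearMap K S ∘ₗ φ) ∈ M')
    (X : H →ₗ[K] S) (hX : ∀ d ∈ D, X d = 0) : f X ∈ M' := by
  classical
  obtain ⟨F, hF⟩ := hf
  let b := Module.Basis.ofVectorSpace K (H ⧸ D)
  let Xb : H ⧸ D →ₗ[K] S := D.liftQ X hX
  let I := F.biUnion fun a => (b.repr (D.mkQ a)).support
  -- Expand `X` in a basis of `H ⧸ D`, keeping only the basis vectors that occur on `F`.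
  let X' : H →ₗ[K] S := ∑ i ∈ I, Xb (b i) • (Algebra.linearMap K S ∘ₗ b.coord i ∘ₗ D.mkQ)
  have key : f X = f X' := by
    rw [← sub_eq_zero, ← map_sub]
    refine hF _ fun a ha => ?_
    rw [LinearMap.sub_apply, sub_eq_zero]
    have h1 : X a = Xb (D.mkQ a) := rfl
    rw [h1]
    conv_lhs => rw [← b.linearCombination_repr (D.mkQ a)]
    have hsub : (b.repr (D.mkQ a)).support ⊆ I :=
      Finset.subset_biUnion_of_mem (fun a => (b.repr (D.mkQ a)).support) ha
    rw [Finsupp.linearCombination_apply, map_finsuppSum, Finsupp.sum_of_support_subset _ hsub]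
    · simp only [X', LinearMap.sum_apply]
      refine Finset.sum_congr rfl fun i _ => ?_
      simp [Algebra.smul_def, mul_comm]
    · simp
  rw [key]
  simp only [X', map_sum, map_smul]
  refine M'.sum_mem fun i _ => M'.smul_mem _ (h _ fun d hd => ?_)
  simp [(Submodule.Quotient.mk_eq_zero D).2 hd]

theorem exists_finset_rTensor_eq_zero (t : H ⊗[K] V) :
    ∃ F : Finset H, ∀ X : H →ₗ[K] W, (∀ a ∈ F, X a = 0) → X.rTensor V t = 0 := by
  classical
  induction t with
  | zero => exact ⟨∅, by simp⟩
  | tmul a v => exact ⟨{a}, fun X hX => by simp [hX a (by simp)]⟩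
  | add x y hx hy =>
    obtain ⟨F, hF⟩ := hx
    obtain ⟨G, hG⟩ := hy
    exact ⟨F ∪ G, fun X hX => by
      rw [map_add, hF X fun a ha => hX a (by simp [ha]), hG X fun a ha => hX a (by simp [ha]),
        add_zero]⟩

theorem exists_finset_lTensor_eq_zero (t : V ⊗[K] H) :
    ∃ F : Finset H, ∀ X : H →ₗ[K] W, (∀ a ∈ F, X a = 0) → X.lTensor V t = 0 := by
  obtain ⟨F, hF⟩ := exists_finset_rTensor_eq_zero (W := W) (TensorProduct.comm K V H t)
  refine ⟨F, fun X hX => ?_⟩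
  have := hF X hX
  rw [← LinearMap.comm_comp_lTensor_comp_comm_eq] at this
  simpa using this

variable (S) in
/-- The contraction `X ↦ (X ⊗ id) t` with a tensor `t ∈ H ⊗ V`. -/
noncomputable def contractWith (t : H ⊗[K] V) : (H →ₗ[K] S) →ₗ[S] S ⊗[K] V where
  toFun X := X.rTensor V t
  map_add' X Y := by simp [LinearMap.rTensor_add]
  map_smul' s X := by
    induction t with
    | zero => simp
    | tmul a v => simp [TensorProduct.smul_tmul']
    | add x y hx hy => simp only [map_add, smul_add, RingHom.id_apply] at *; rw [hx, hy]

theorem rTensor_algebraMap_comp (φ : H →ₗ[K] K) (t : H ⊗[K] V) :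
    (Algebra.linearMap K S ∘ₗ φ).rTensor V t =
      (1 : S) ⊗ₜ[K] TensorProduct.lid K V (φ.rTensor V t) := by
  induction t with
  | zero => simp
  | tmul a v =>
    simp [Algebra.algebraMap_eq_smul_one, TensorProduct.smul_tmul]
  | add x y hx hy => simp only [map_add, hx, hy, TensorProduct.tmul_add]

/-- If all contractions of `t ∈ H ⊗ V` with functionals vanishing at `h₀` lie in `U ⊆ V`, then the
contractions with `S`-valued linear maps vanishing at `h₀` lie in `S ⊗ U`. -/
theorem rTensor_mem_baseChange (h₀ : H) (U : Submodule K V) (t : H ⊗[K] V)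
    (h : ∀ φ : H →ₗ[K] K, φ h₀ = 0 → TensorProduct.lid K V (φ.rTensor V t) ∈ U)
    (X : H →ₗ[K] S) (hX : X h₀ = 0) : X.rTensor V t ∈ U.baseChange S := by
  refine mem_of_forall_functional (K ∙ h₀) (contractWith S t) (U.baseChange S)
    (exists_finset_rTensor_eq_zero t) (fun φ hφ => ?_) X fun d hd => ?_
  · change (Algebra.linearMap K S ∘ₗ φ).rTensor V t ∈ _
    rw [rTensor_algebraMap_comp]
    exact Submodule.tmul_mem_baseChange_of_mem _ (h φ (hφ _ (Submodule.mem_span_singleton_self _)))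
  · obtain ⟨k, rfl⟩ := Submodule.mem_span_singleton.1 hd
    simp [hX]

/-- The sum of a sequence of linear maps, all but finitely many of which vanish at each given
vector. -/
noncomputable def locSum (f : ℕ → V →ₗ[K] W) (hf : ∀ v, ∃ n, ∀ m ≥ n, f m v = 0) : V →ₗ[K] W where
  toFun v := ∑ᶠ m, f m v
  map_add' v w := by
    have hfin : ∀ v, (Function.support fun m => f m v).Finite := fun v => by
      obtain ⟨n, hn⟩ := hf v
      exact (Set.finite_lt_nat n).subset fun m hm => by
        by_contra h
        exact hm (hn m (not_lt.1 h))
    simp only [map_add]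
    exact finsum_add_distrib (hfin v) (hfin w)
  map_smul' c v := by simp only [map_smul, smul_finsum, RingHom.id_apply]

theorem locSum_apply (f : ℕ → V →ₗ[K] W) (hf) (v : V) (n : ℕ) (hn : ∀ m ≥ n, f m v = 0) :
    locSum f hf v = ∑ m ∈ Finset.range n, f m v := by
  refine finsum_eq_sum_of_support_subset _ fun m hm => ?_
  by_contra h
  simp only [Finset.coe_range, Set.mem_Iio, not_lt] at h
  exact hm (hn m h)

end LinearAlgebra

/-! ### Unipotence and the convolution algebra -/

section Conilpotent

variable (K H : Type u) [Field K] [CommRing H] [HopfAlgebra K H]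

/-- The ascending filtration of the coordinate ring `H` attached to the regular representation:
`F₀ = 0` and `Fₙ₊₁ / Fₙ` consists of the invariants of `H / Fₙ`. -/
noncomputable def unipotentFiltration : ℕ → Submodule K H
  | 0 => ⊥
  | n + 1 => (LinearMap.range ((unipotentFiltration n).subtype.rTensor H)).comap
      (Coalgebra.comul - (TensorProduct.mk K H H).flip 1)

variable {K H}

theorem mem_unipotentFiltration_succ {n : ℕ} {a : H} :
    a ∈ unipotentFiltration K H (n + 1) ↔ Coalgebra.comul (R := K) a - a ⊗ₜ[K] (1 : H) ∈
      LinearMap.range ((unipotentFiltration K H n).subtype.rTensor H) := Iff.rfl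

theorem range_rTensor_subtype_mono {V : Type u} [AddCommGroup V] [Module K V]
    {U U' : Submodule K V} (h : U ≤ U') :
    LinearMap.range (U.subtype.rTensor H) ≤ LinearMap.range (U'.subtype.rTensor H) := by
  rw [← Submodule.subtype_comp_inclusion _ _ h, LinearMap.rTensor_comp]
  exact LinearMap.range_comp_le_range _ _

theorem unipotentFiltration_mono : Monotone (unipotentFiltration K H) := by
  refine monotone_nat_of_le_succ fun n => ?_
  induction n with
  | zero => exact bot_le
  | succ n ih => exact fun a ha => range_rTensor_subtype_mono ih ha

/-- The regular representation of a pro-unipotent group is exhausted by its filtration by iterated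
invariants: otherwise the quotient by the union would have a nonzero fixed vector. -/
theorem IsProUnipotent.exists_mem_unipotentFiltration (hH : IsProUnipotent K H) (a : H) :
    ∃ n, a ∈ unipotentFiltration K H n := by
  have hdir : Directed (· ≤ ·) (unipotentFiltration K H) := unipotentFiltration_mono.directed_le
  set U : Submodule K H := ⨆ n, unipotentFiltration K H n with hU
  have hmem : ∀ {a}, a ∈ U ↔ ∃ n, a ∈ unipotentFiltration K H n :=
    fun {a} => Submodule.mem_iSup_of_directed _ hdir
  rw [← hmem]
  by_contra ha
  -- A tensor in `U ⊗ H` already lies in some `Fₙ ⊗ H`.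
  have hrange : ∀ t ∈ LinearMap.range (U.subtype.rTensor H),
      ∃ n, t ∈ LinearMap.range ((unipotentFiltration K H n).subtype.rTensor H) := by
    rintro _ ⟨s, rfl⟩
    induction s with
    | zero => exact ⟨0, by simp⟩
    | tmul u h =>
      obtain ⟨n, hn⟩ := hmem.1 u.2
      exact ⟨n, ⟨⟨u, hn⟩ ⊗ₜ h, rfl⟩⟩
    | add x y hx hy =>
      obtain ⟨n, hn⟩ := hx
      obtain ⟨m, hm⟩ := hy
      refine ⟨max n m, ?_⟩
      rw [map_add]
      exact Submodule.add_mem _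
        (range_rTensor_subtype_mono (unipotentFiltration_mono (le_max_left n m)) hn)
        (range_rTensor_subtype_mono (unipotentFiltration_mono (le_max_right n m)) hm)
  have hker : ∀ t : H ⊗[K] H, U.mkQ.rTensor H t = 0 ↔ t ∈ LinearMap.range (U.subtype.rTensor H) :=
    fun t => rTensor_exact H (LinearMap.exact_subtype_mkQ U) U.mkQ_surjective t
  -- The representation on `H ⧸ U` induced by the regular representation.
  let ρ : H ⧸ U →ₗ[K] (H ⧸ U) ⊗[K] H := U.liftQ (U.mkQ.rTensor H ∘ₗ Coalgebra.comul) (by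
    intro a ha
    obtain ⟨n, hn⟩ := hmem.1 ha
    have h1 := mem_unipotentFiltration_succ.1 (unipotentFiltration_mono (Nat.le_succ n) hn)
    have h2 := (hker _).2 (range_rTensor_subtype_mono (le_iSup _ n) h1)
    rw [map_sub, LinearMap.rTensor_tmul, (Submodule.mkQ_apply U a),
      (Submodule.Quotient.mk_eq_zero U).2 ha, TensorProduct.zero_tmul, sub_zero] at h2
    exact h2)
  have hρ : ∀ a, ρ (U.mkQ a) = U.mkQ.rTensor H (Coalgebra.comul a) := fun a => rfl
  have hρ' : ρ ∘ₗ U.mkQ = U.mkQ.rTensor H ∘ₗ Coalgebra.comul := rfl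
  have : Nontrivial (H ⧸ U) :=
    ⟨U.mkQ a, 0, fun h => ha ((Submodule.Quotient.mk_eq_zero U).1 h)⟩
  have hrep : IsGroupRep ρ := by
    constructor
    · refine Submodule.linearMap_qext _ ?_
      ext a
      simp only [LinearMap.comp_apply, hρ]
      rw [← LinearMap.rTensor_comp_apply, hρ', ← LinearMap.comp_apply (LinearMap.lTensor _ _),
        LinearMap.lTensor_comp_rTensor, ← LinearMap.rTensor_comp_lTensor, LinearMap.comp_apply,
        ← Coalgebra.coassoc_apply, LinearMap.rTensor_comp_apply]
      generalize (LinearMap.rTensor H Coalgebra.comul) (Coalgebra.comul (R := K) a) = t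
      induction t with
      | zero => simp
      | add x y hx hy => simp only [map_add, hx, hy]
      | tmul x y =>
        induction x with
        | zero => simp
        | add x x' hx hy => simp only [TensorProduct.add_tmul, map_add, hx, hy]
        | tmul x z => simp
    · refine Submodule.linearMap_qext _ ?_
      ext a
      simp only [LinearMap.comp_apply, hρ]
      rw [← LinearMap.comp_apply (LinearMap.lTensor _ _),
        LinearMap.lTensor_comp_rTensor, ← LinearMap.rTensor_comp_lTensor, LinearMap.comp_apply,
        Coalgebra.lTensor_counit_comul]
      simp
  obtain ⟨v, hv, hv'⟩ := hH (H ⧸ U) ρ hrep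
  obtain ⟨x, rfl⟩ := U.mkQ_surjective v
  have h1 : U.mkQ.rTensor H (Coalgebra.comul x - x ⊗ₜ[K] (1 : H)) = 0 := by
    rw [map_sub, ← hρ, hv']
    simp
  obtain ⟨n, hn⟩ := hrange _ ((hker _).1 h1)
  exact hv ((Submodule.Quotient.mk_eq_zero U).2 (hmem.2 ⟨n + 1, hn⟩))

variable {S : Type u} [CommRing S] [Algebra K S]

/-- If `f` vanishes on the `n`-th step of the filtration and `x 1 = 0`, then `f * x` vanishes on
the next step. -/
theorem convMul_apply_eq_zero {n : ℕ} {f x : WithConv (H →ₗ[K] S)}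
    (hf : ∀ a ∈ unipotentFiltration K H n, f a = 0) (hx : x 1 = 0) :
    ∀ a ∈ unipotentFiltration K H (n + 1), (f * x) a = 0 := by
  intro a ha
  obtain ⟨s, hs⟩ := mem_unipotentFiltration_succ.1 ha
  rw [eq_sub_iff_add_eq] at hs
  rw [LinearMap.convMul_apply, ← hs]
  have h0 : f.ofConv ∘ₗ (unipotentFiltration K H n).subtype = 0 := LinearMap.ext fun u => hf u u.2
  rw [map_add, ← LinearMap.comp_apply (TensorProduct.map _ _), LinearMap.map_comp_rTensor, h0]
  simp [hx]

variable (K H S) in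
/-- The linear maps `H → S` vanishing at `1`, a subspace of the convolution algebra. -/
def augmentation : Submodule K (WithConv (H →ₗ[K] S)) where
  carrier := {x | x 1 = 0}
  add_mem' := by
    intro x y hx hy
    simp_all
  zero_mem' := by simp
  smul_mem' := by
    intro c x hx
    simp_all

theorem mem_augmentation {x : WithConv (H →ₗ[K] S)} : x ∈ augmentation K H S ↔ x 1 = 0 := Iff.rfl

theorem apply_eq_zero_of_mem_augmentation_pow {n : ℕ} {f : WithConv (H →ₗ[K] S)}
    (hf : f ∈ augmentation K H S ^ n) : ∀ a ∈ unipotentFiltration K H n, f a = 0 := by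
  induction n generalizing f with
  | zero =>
    intro a ha
    rw [(Submodule.mem_bot K).1 ha, map_zero]
  | succ n ih =>
    rw [pow_succ] at hf
    refine Submodule.mul_induction_on hf (fun g hg x hx => convMul_apply_eq_zero (ih hg) hx)
      fun x y hx hy a ha => ?_
    rw [WithConv.ofConv_add, LinearMap.add_apply, hx a ha, hy a ha, add_zero]

/-- The convolution algebra is complete for the powers of the maps vanishing at `1`: on each
element of `H`, all sufficiently high powers vanish. -/
theorem IsProUnipotent.exists_apply_eq_zero (hU : IsProUnipotent K H) (a : H) :
    ∃ n, ∀ m ≥ n, ∀ f ∈ augmentation K H S ^ m, f a = 0 := by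
  obtain ⟨n, hn⟩ := hU.exists_mem_unipotentFiltration a
  exact ⟨n, fun m hm f hf => apply_eq_zero_of_mem_augmentation_pow hf a
    (unipotentFiltration_mono hm hn)⟩

end Conilpotent

/-! ### The logarithm of the identity -/

section Eulerian

open Polynomial WithConv

variable {K A : Type u} [Field K] [CommRing A]

/-- A polynomial over an algebra of characteristic zero that vanishes at all natural numbers is
zero: compose it with linear functionals to reduce to polynomials over the field. -/
theorem polynomial_eq_zero_of_forall_eval_natCast [CharZero K] [Algebra K A] (q : A[X])
    (h : ∀ n : ℕ, q.eval (n : A) = 0) : q = 0 := by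
  ext i
  rw [coeff_zero]
  by_cases hi : i ∈ Finset.range (q.natDegree + 1)
  swap
  · exact coeff_eq_zero_of_natDegree_lt (by simpa using hi)
  refine (Module.forall_dual_apply_eq_zero_iff K (q.coeff i)).1 fun l => ?_
  let r : K[X] := ∑ j ∈ Finset.range (q.natDegree + 1), monomial j (l (q.coeff j))
  have hr : r = 0 := by
    refine eq_zero_of_infinite_isRoot _ (Set.infinite_of_injective_forall_mem
      (Nat.cast_injective (R := K)) fun n => ?_)
    have h1 := congrArg l (h n)
    rw [eval_eq_sum_range, map_sum, map_zero] at h1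
    rw [Set.mem_ofPred_eq, IsRoot.def, eval_finsetSum, ← h1]
    refine Finset.sum_congr rfl fun j _ => ?_
    have h2 : q.coeff j * (n : A) ^ j = ((n : K) ^ j) • q.coeff j := by
      rw [Algebra.smul_def, mul_comm]; simp
    rw [h2, map_smul, eval_monomial, smul_eq_mul, mul_comm]
  have h3 := congrArg (fun r => r.coeff i) hr
  simpa [r, finsetSum_coeff, coeff_monomial, hi] using h3

variable [HopfAlgebra K A]

variable (K) in
/-- The polynomial `binom(t, m)` in the variable `t`. -/
noncomputable def binomialPoly (m : ℕ) : K[X] := C ((m.factorial : K)⁻¹) * descPochhammer K m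

theorem id_sub_one_mem_augmentation :
    (toConv LinearMap.id - 1 : WithConv (A →ₗ[K] A)) ∈ augmentation K A A := by
  rw [mem_augmentation]
  simp

theorem IsProUnipotent.exists_id_sub_one_pow_apply_eq_zero (hU : IsProUnipotent K A) (a : A) :
    ∃ n, ∀ m ≥ n, ((toConv LinearMap.id - 1 : WithConv (A →ₗ[K] A)) ^ m).ofConv a = 0 := by
  obtain ⟨n, hn⟩ := hU.exists_apply_eq_zero (S := A) a
  refine ⟨n, fun m hm => ?_⟩
  have h0 : (toConv LinearMap.id - 1 : WithConv (A →ₗ[K] A)) ∈ augmentation K A A :=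
    id_sub_one_mem_augmentation
  exact hn m hm _ (Submodule.pow_mem_pow _ h0 m)

/-- Multiplication of a linear map `f : A → A` by a polynomial over `K`. -/
noncomputable def polySMul (β : K[X]) (f : A →ₗ[K] A) : A →ₗ[K] A[X] :=
  LinearMap.mulLeft K (β.map (algebraMap K A)) ∘ₗ (CAlgHom (R := K)).toLinearMap ∘ₗ f

theorem polySMul_apply (β : K[X]) (f : A →ₗ[K] A) (a : A) :
    polySMul β f a = β.map (algebraMap K A) * C (f a) := rfl

variable [CharZero K]

theorem binomialPoly_eval_natCast (m n : ℕ) : (binomialPoly K m).eval (n : K) = n.choose m := by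
  rw [binomialPoly, eval_mul, eval_C, descPochhammer_eval_eq_descFactorial,
    Nat.descFactorial_eq_factorial_mul_choose, Nat.cast_mul, inv_mul_cancel_left₀]
  exact_mod_cast m.factorial_ne_zero

/-- The comorphism `A → A[t]` of the map `(t, g) ↦ g ^ t`: on the coordinate ring of a pro-unipotent
group, the binomial series `g ^ t = ∑ₘ binom(t, m) (g - 1) ^ m` is a finite sum. -/
noncomputable def genericPower (hU : IsProUnipotent K A) : A →ₗ[K] A[X] :=
  locSum (fun m => polySMul (binomialPoly K m)
      ((toConv LinearMap.id - 1 : WithConv (A →ₗ[K] A)) ^ m).ofConv) fun a => by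
    obtain ⟨n, hn⟩ := hU.exists_id_sub_one_pow_apply_eq_zero a
    exact ⟨n, fun m hm => by rw [polySMul_apply, hn m hm, C_0, mul_zero]⟩

theorem eval_genericPower (hU : IsProUnipotent K A) (n : ℕ) (a : A) :
    (genericPower hU a).eval (n : A) =
      ((toConv LinearMap.id : WithConv (A →ₗ[K] A)) ^ n).ofConv a := by
  obtain ⟨N, hN⟩ := hU.exists_id_sub_one_pow_apply_eq_zero a
  rw [genericPower, locSum_apply _ _ a (max N (n + 1)) fun m hm => by
    rw [polySMul_apply, hN m (le_of_max_le_left hm), C_0, mul_zero], eval_finsetSum]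
  have hterm : ∀ m, eval (n : A) (polySMul (binomialPoly K m)
        ((toConv LinearMap.id - 1 : WithConv (A →ₗ[K] A)) ^ m).ofConv a) =
      n.choose m • ((toConv LinearMap.id - 1 : WithConv (A →ₗ[K] A)) ^ m).ofConv a := by
    intro m
    have h1 : eval (n : A) ((binomialPoly K m).map (algebraMap K A)) = (n.choose m : A) := by
      have := congrArg (algebraMap K A) (binomialPoly_eval_natCast (K := K) m n)
      rw [← eval_map_apply] at this
      simpa using this
    rw [polySMul_apply, eval_mul, h1, eval_C, nsmul_eq_mul]
  simp only [hterm]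
  conv_rhs => rw [← sub_add_cancel (toConv LinearMap.id : WithConv (A →ₗ[K] A)) 1,
    (Commute.one_right _).add_pow]
  rw [← Finset.sum_subset (Finset.range_subset_range.2 (le_max_right N (n + 1)))]
  · rw [ofConv_sum, LinearMap.sum_apply]
    refine Finset.sum_congr rfl fun m _ => ?_
    rw [one_pow, mul_one, ← nsmul_eq_mul']
    rfl
  · intro m _ hm
    rw [Nat.choose_eq_zero_of_lt (by simpa using hm), zero_smul]

/-- The map `g ↦ g ^ t` is a morphism of schemes because it is one for natural numbers `t`. -/
theorem genericPower_mul (hU : IsProUnipotent K A) (a b : A) :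
    genericPower hU (a * b) = genericPower hU a * genericPower hU b := by
  rw [← sub_eq_zero]
  refine polynomial_eq_zero_of_forall_eval_natCast (K := K) _ fun n => ?_
  have h : (toConv LinearMap.id : WithConv (A →ₗ[K] A)) ^ n =
      toConv ((toConv (AlgHom.id K A)) ^ n).ofConv.toLinearMap := by
    rw [AlgHom.toLinearMap_convPow]; rfl
  rw [eval_sub, eval_mul, eval_genericPower, eval_genericPower, eval_genericPower, h]
  exact sub_eq_zero.2 (map_mul ((toConv (AlgHom.id K A)) ^ n).ofConv a b)

/-- The logarithm of the identity for the convolution product, the coefficient of `t` in `g ^ t`;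
the first Eulerian idempotent of the Hopf algebra. -/
noncomputable def eulerian (hU : IsProUnipotent K A) : WithConv (A →ₗ[K] A) :=
  toConv ((lcoeff A 1).restrictScalars K ∘ₗ genericPower hU)

theorem coeff_genericPower_zero (hU : IsProUnipotent K A) (a : A) :
    (genericPower hU a).coeff 0 = algebraMap K A (Coalgebra.counit a) := by
  rw [coeff_zero_eq_eval_zero]
  simpa using eval_genericPower hU 0 a

/-- The logarithm is a tangent vector: compare the coefficients of `t` in the multiplicativity of
`genericPower`. -/
theorem eulerian_mul (hU : IsProUnipotent K A) (a b : A) :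
    eulerian hU (a * b) = Coalgebra.counit (R := K) a • eulerian hU b +
      Coalgebra.counit (R := K) b • eulerian hU a := by
  change (genericPower hU (a * b)).coeff 1 = _ • (genericPower hU b).coeff 1 +
    _ • (genericPower hU a).coeff 1
  rw [genericPower_mul, mul_coeff_one, coeff_genericPower_zero, coeff_genericPower_zero,
    Algebra.smul_def, Algebra.smul_def, mul_comm (coeff _ 1)]

/-- The differential equation `d/dt g ^ t = log g * g ^ t`. -/
theorem derivative_genericPower (hU : IsProUnipotent K A) :
    (derivative.restrictScalars K ∘ₗ genericPower hU : A →ₗ[K] A[X]) =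
      (toConv ((CAlgHom (R := K)).toLinearMap ∘ₗ (eulerian hU).ofConv) *
        toConv (genericPower hU)).ofConv := by
  ext1 a
  rw [← sub_eq_zero]
  refine polynomial_eq_zero_of_forall_eval_natCast (K := K) _ fun n => ?_
  -- `g ^ (t + n) = g ^ t * g ^ n`
  have h1 : taylor (n : A) (genericPower hU a) =
      (toConv (genericPower hU) * toConv ((CAlgHom (R := K)).toLinearMap ∘ₗ
        ((toConv LinearMap.id : WithConv (A →ₗ[K] A)) ^ n).ofConv)).ofConv a := by
    rw [← sub_eq_zero]
    refine polynomial_eq_zero_of_forall_eval_natCast (K := K) _ fun m => ?_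
    rw [eval_sub, taylor_eval, ← Nat.cast_add, eval_genericPower, pow_add,
      sub_eq_zero]
    let ℛ := Coalgebra.Repr.arbitrary K a
    rw [ℛ.convMul_apply, ℛ.convMul_apply, eval_finsetSum]
    refine Finset.sum_congr rfl fun i _ => ?_
    rw [eval_mul, ← eval_genericPower hU m]
    simp
  -- Compare the coefficients of `t`.
  have h2 := congrArg (fun q => coeff q 1) h1
  simp only [taylor_coeff_one] at h2
  let ℛ := Coalgebra.Repr.arbitrary K a
  rw [ℛ.convMul_apply, finsetSum_coeff] at h2
  rw [ℛ.convMul_apply, eval_sub, sub_eq_zero, eval_finsetSum]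
  refine h2.trans (Finset.sum_congr rfl fun i _ => ?_)
  simp [eval_genericPower, eulerian]

theorem coeff_genericPower (hU : IsProUnipotent K A) (k : ℕ) (a : A) :
    (genericPower hU a).coeff k = (k.factorial : K)⁻¹ • (eulerian hU ^ k).ofConv a := by
  induction k generalizing a with
  | zero => simp [coeff_genericPower_zero]
  | succ k ih =>
    have h := congrArg (fun f : A →ₗ[K] A[X] => (f a).coeff k) (derivative_genericPower hU)
    let ℛ := Coalgebra.Repr.arbitrary K a
    simp only [LinearMap.comp_apply, LinearMap.restrictScalars_apply, coeff_derivative,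
      ℛ.convMul_apply, finsetSum_coeff] at h
    have h1 : ((k : A) + 1) = algebraMap K A (k + 1) := by simp
    have h2 : ((k : K) + 1) ≠ 0 := by exact_mod_cast k.succ_ne_zero
    rw [h1, mul_comm, ← Algebra.smul_def, ← eq_inv_smul_iff₀ h2] at h
    rw [h, pow_succ', ℛ.convMul_apply, Nat.factorial_succ, Nat.cast_mul, mul_inv, mul_smul,
      Nat.cast_succ, Finset.smul_sum (r := (k.factorial : K)⁻¹)]
    congr 1
    refine Finset.sum_congr rfl fun i _ => ?_
    simp [ih]

/-- The identity is the exponential, for the convolution product, of its logarithm. -/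
theorem exists_sum_eulerian_pow (hU : IsProUnipotent K A) (a : A) :
    ∃ n, (∀ k ≥ n, (eulerian hU ^ k).ofConv a = 0) ∧ ∀ m ≥ n,
      a = ∑ k ∈ Finset.range m, (k.factorial : K)⁻¹ • (eulerian hU ^ k).ofConv a := by
  refine ⟨(genericPower hU a).natDegree + 1, fun k hk => ?_, fun m hm => ?_⟩
  · have h := coeff_genericPower hU k a
    rw [coeff_eq_zero_of_natDegree_lt hk] at h
    exact (smul_eq_zero_iff_right (inv_ne_zero (by exact_mod_cast k.factorial_ne_zero))).1 h.symm
  · have h := eval_genericPower hU 1 a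
    rw [eval_eq_sum_range' hm, Nat.cast_one] at h
    simpa [coeff_genericPower] using h.symm

end Eulerian

/-! ### Uniqueness of solutions of linear differential equations -/

section Uniqueness

open WithConv

variable {K A : Type u} [Field K] [CommRing A] [HopfAlgebra K A]

/-- The operator `v ↦ (φ ⊗ id) (c v)` given by a functional `φ : H → K` and a map
`c : V → H ⊗ V`. -/
noncomputable def contract {H V : Type u} [AddCommGroup H] [Module K H] [AddCommGroup V]
    [Module K V] (c : V →ₗ[K] H ⊗[K] V) (φ : H →ₗ[K] K) : V →ₗ[K] V :=
  (TensorProduct.lid K V).toLinearMap ∘ₗ φ.rTensor V ∘ₗ c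

variable (K A) in
/-- The subspace of `A` spanned by the elements that derivations at the identity are required to
kill; it is `K ⊕ J ^ 2` for the augmentation ideal `J`. -/
def leibnizDefect : Submodule K A :=
  Submodule.span K {x | ∃ a b : A, x = a * b - Coalgebra.counit (R := K) a • b -
    Coalgebra.counit (R := K) b • a}

theorem leibnizDefect_le_ker_iff {S : Type u} [CommRing S] [Algebra K S]
    (X : A →ₗ[K] S) :
    (∀ d ∈ leibnizDefect K A, X d = 0) ↔ toConv X ∈ groupLie K A S := by
  constructor
  · intro h a b
    have := h _ (Submodule.subset_span ⟨a, b, rfl⟩)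
    rw [map_sub, map_sub, map_smul, map_smul, sub_sub, sub_eq_zero] at this
    exact this
  · intro h d hd
    refine (Submodule.span_le (p := LinearMap.ker X)).2 ?_ hd
    rintro _ ⟨a, b, rfl⟩
    have := h a b
    rw [SetLike.mem_coe, LinearMap.mem_ker, map_sub, map_sub, map_smul, map_smul, sub_sub,
      sub_eq_zero]
    exact this

theorem eulerian_mem_groupLie [CharZero K] (hU : IsProUnipotent K A) :
    eulerian hU ∈ groupLie K A A := eulerian_mul hU

variable {V : Type u} [AddCommGroup V] [Module K V]

/-- A subspace of `V ⊗ O(U)` that is stable under the invariant vector fields and whose elements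
vanish at the identity is zero: a solution of a linear differential equation on a pro-unipotent
group is determined by its value at the identity. The reason is that `id = exp e` with `e` the
logarithm of the identity, which is a combination of tangent vectors. -/
theorem eq_zero_of_stable_of_counit_eq_zero [CharZero K] (hU : IsProUnipotent K A)
    (N : Submodule K (V ⊗[K] A))
    (hN : ∀ δ : groupLie K A K, ∀ y ∈ N,
      (contract Coalgebra.comul δ.1.ofConv).lTensor V y ∈ N)
    (h0 : ∀ y ∈ N, (Coalgebra.counit (R := K) (A := A)).lTensor V y = 0) :
    ∀ y ∈ N, y = 0 := by
  let τ : (A →ₗ[K] A) → V ⊗[K] A →ₗ[K] A ⊗[K] (V ⊗[K] A) := fun g =>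
    (TensorProduct.leftComm K V A A).toLinearMap ∘ₗ (g.lTensor A ∘ₗ Coalgebra.comul).lTensor V
  have hτ1 : ∀ (g : A →ₗ[K] A) (φ : A →ₗ[K] K) (y : V ⊗[K] A),
      TensorProduct.lid K _ (φ.rTensor _ (τ g y)) =
        g.lTensor V ((contract Coalgebra.comul φ).lTensor V y) := by
    intro g φ y
    induction y with
    | zero => simp
    | add x y hx hy => simp only [map_add, hx, hy]
    | tmul v a =>
      simp only [τ, contract, LinearMap.comp_apply, LinearMap.lTensor_tmul,
        LinearEquiv.coe_coe]
      generalize Coalgebra.comul (R := K) a = t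
      induction t with
      | zero => simp
      | add x y hx hy => simp only [map_add, TensorProduct.tmul_add, hx, hy]
      | tmul a b => simp
  let μ : A ⊗[K] (V ⊗[K] A) →ₗ[K] V ⊗[K] A :=
    (LinearMap.mul' K A).lTensor V ∘ₗ (TensorProduct.leftComm K A V A).toLinearMap
  have hτ2 : ∀ (X g : WithConv (A →ₗ[K] A)) (y : V ⊗[K] A),
      μ (X.ofConv.rTensor _ (τ g.ofConv y)) = (X * g).ofConv.lTensor V y := by
    intro X g y
    induction y with
    | zero => simp
    | add x y hx hy => simp only [map_add, hx, hy]
    | tmul v a =>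
      simp only [τ, μ, LinearMap.comp_apply, LinearMap.lTensor_tmul,
        LinearEquiv.coe_coe, LinearMap.convMul_apply]
      generalize Coalgebra.comul (R := K) a = t
      induction t with
      | zero => simp
      | add x y hx hy => simp only [map_add, TensorProduct.tmul_add, hx, hy]
      | tmul a b => simp
  -- By density, `e` may be replaced by scalar tangent vectors, under which `N` is stable.
  have key : ∀ (k : ℕ), ∀ y ∈ N, (eulerian hU ^ k).ofConv.lTensor V y = 0 := by
    intro k
    induction k with
    | zero =>
      intro y hy
      have h1 : (eulerian hU ^ 0).ofConv = Algebra.linearMap K A ∘ₗ Coalgebra.counit := by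
        rw [pow_zero]; rfl
      rw [h1, LinearMap.lTensor_comp_apply, h0 y hy, map_zero]
    | succ k ih =>
      intro y hy
      have h1 : contractWith A (τ (eulerian hU ^ k).ofConv y) (eulerian hU).ofConv ∈
          (⊥ : Submodule A (A ⊗[K] (V ⊗[K] A))) := by
        refine mem_of_forall_functional (leibnizDefect K A) _ ⊥ (exists_finset_rTensor_eq_zero _)
          (fun φ hφ => ?_) _ ((leibnizDefect_le_ker_iff _).2 (eulerian_mem_groupLie hU))
        change (Algebra.linearMap K A ∘ₗ φ).rTensor _ _ ∈ _
        have h2 := ih _ (hN ⟨toConv φ, (leibnizDefect_le_ker_iff φ).1 hφ⟩ y hy)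
        rw [rTensor_algebraMap_comp, hτ1, h2, TensorProduct.tmul_zero]
        exact Submodule.zero_mem _
      rw [Submodule.mem_bot] at h1
      rw [pow_succ', ← hτ2]
      exact (congrArg μ h1).trans (map_zero μ)
  intro y hy
  have hy' : ∃ n, y = ∑ k ∈ Finset.range n,
      (k.factorial : K)⁻¹ • (eulerian hU ^ k).ofConv.lTensor V y := by
    suffices h : ∃ n, ∀ m ≥ n, y = ∑ k ∈ Finset.range m,
        (k.factorial : K)⁻¹ • (eulerian hU ^ k).ofConv.lTensor V y from
      let ⟨n, hn⟩ := h; ⟨n, hn n le_rfl⟩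
    clear hy
    induction y with
    | zero => exact ⟨0, by simp⟩
    | add x y hx hy =>
      obtain ⟨n, hn⟩ := hx
      obtain ⟨m, hm⟩ := hy
      refine ⟨max n m, fun k hk => ?_⟩
      simp only [map_add, smul_add, Finset.sum_add_distrib]
      rw [← hn k (le_of_max_le_left hk), ← hm k (le_of_max_le_right hk)]
    | tmul v a =>
      obtain ⟨n, -, hn⟩ := exists_sum_eulerian_pow hU a
      refine ⟨n, fun m hm => ?_⟩
      conv_lhs => rw [hn m hm, TensorProduct.tmul_sum]
      simp
  obtain ⟨n, hn⟩ := hy'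
  rw [hn]
  exact Finset.sum_eq_zero fun k _ => by rw [key k y hy, smul_zero]

end Uniqueness

/-! ### Operators attached to coactions -/

section Operators

open WithConv

variable {K H V S : Type u} [Field K] [CommRing H] [HopfAlgebra K H] [AddCommGroup V] [Module K V]
  [CommRing S] [Algebra K S]

/-- The `S`-linear operator `v ↦ (X ⊗ id) (c v)` on `S ⊗ V` given by `X : H → S` and a map
`c : V → H ⊗ V`. -/
noncomputable def contractBaseChange (c : V →ₗ[K] H ⊗[K] V) :
    WithConv (H →ₗ[K] S) →ₗ[S] Module.End S (S ⊗[K] V) where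
  toFun X := LinearMap.liftBaseChange S (X.ofConv.rTensor V ∘ₗ c)
  map_add' X Y := by
    ext v
    simp [LinearMap.rTensor_add]
  map_smul' s X := by
    ext v
    have h : (s • X.ofConv).rTensor V (c v) = s • X.ofConv.rTensor V (c v) :=
      (contractWith S (c v)).map_smul s X.ofConv
    simpa using h

theorem contractBaseChange_tmul (c : V →ₗ[K] H ⊗[K] V) (X : WithConv (H →ₗ[K] S)) (s : S) (v : V) :
    contractBaseChange c X (s ⊗ₜ v) = s • X.ofConv.rTensor V (c v) := by
  simp [contractBaseChange]

theorem contractBaseChange_one_tmul (c : V →ₗ[K] H ⊗[K] V) (X : WithConv (H →ₗ[K] S)) (v : V) :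
    contractBaseChange c X ((1 : S) ⊗ₜ v) = X.ofConv.rTensor V (c v) := by
  rw [contractBaseChange_tmul, one_smul]

theorem contractBaseChange_eq_of_one_tmul {f g : Module.End S (S ⊗[K] V)}
    (h : ∀ v, f ((1 : S) ⊗ₜ v) = g ((1 : S) ⊗ₜ v)) : f = g := by
  ext v
  simpa using h v

/-- For a coaction, that is, a representation on functions, contraction reverses products. -/
theorem contractBaseChange_mul (c : V →ₗ[K] H ⊗[K] V)
    (hc : ∀ v, c.lTensor H (c v) =
      TensorProduct.assoc K H H V (Coalgebra.comul.rTensor V (c v)))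
    (X Y : WithConv (H →ₗ[K] S)) :
    contractBaseChange c (X * Y) = contractBaseChange c Y * contractBaseChange c X := by
  refine contractBaseChange_eq_of_one_tmul fun v => ?_
  let F : H ⊗[K] (H ⊗[K] V) →ₗ[K] S ⊗[K] V :=
    TensorProduct.lift (((LinearMap.lsmul S (S ⊗[K] V)).restrictScalars₁₂ K K).compl₁₂ X.ofConv
      (Y.ofConv.rTensor V))
  have hF : ∀ a w, F (a ⊗ₜ w) = X.ofConv a • Y.ofConv.rTensor V w := fun a w => rfl
  have h1 : ∀ t : H ⊗[K] V,
      contractBaseChange c Y (X.ofConv.rTensor V t) = F (c.lTensor H t) := by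
    intro t
    induction t with
    | zero => simp
    | add x y hx hy => simp only [map_add, hx, hy]
    | tmul a v => rw [LinearMap.rTensor_tmul, contractBaseChange_tmul, LinearMap.lTensor_tmul, hF]
  have h2 : ∀ t : H ⊗[K] V, F (TensorProduct.assoc K H H V (Coalgebra.comul.rTensor V t)) =
      (X * Y).ofConv.rTensor V t := by
    intro t
    induction t with
    | zero => simp
    | add x y hx hy => simp only [map_add, hx, hy]
    | tmul a v =>
      rw [LinearMap.rTensor_tmul, LinearMap.rTensor_tmul, LinearMap.convMul_apply]
      generalize Coalgebra.comul (R := K) a = t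
      induction t with
      | zero => simp
      | add x y hx hy => simp only [map_add, TensorProduct.add_tmul, hx, hy]
      | tmul a b => simp [hF, TensorProduct.smul_tmul']
  rw [contractBaseChange_one_tmul, Module.End.mul_apply, contractBaseChange_one_tmul, h1, hc, h2]

end Operators

namespace GroupSchemeAction

open WithConv

variable {K A B S : Type u} [Field K] [CommRing A] [HopfAlgebra K A] [CommRing B] [HopfAlgebra K B]
  [CommRing S] [Algebra K S] (α : GroupSchemeAction K A B)

/-- The law `(g h) • p = g • (h • p)` of an action, read off from the universal points. -/
theorem coact_coassoc (b : B) : α.coact.toLinearMap.lTensor A (α.coact b) =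
    TensorProduct.assoc K A A B (Coalgebra.comul.rTensor B (α.coact b)) := by
  let i₁ : A →ₐ[K] A ⊗[K] (A ⊗[K] B) := Algebra.TensorProduct.includeLeft
  let i₂ : A →ₐ[K] A ⊗[K] (A ⊗[K] B) :=
    Algebra.TensorProduct.includeRight.comp Algebra.TensorProduct.includeLeft
  let i₃ : B →ₐ[K] A ⊗[K] (A ⊗[K] B) :=
    Algebra.TensorProduct.includeRight.comp Algebra.TensorProduct.includeRight
  have h := congrArg (fun p => p.ofConv b) (α.mul_act _ (toConv i₁) (toConv i₂) (toConv i₃))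
  change Algebra.TensorProduct.lift (toConv i₁ * toConv i₂).ofConv i₃ (fun _ _ => .all _ _)
      (α.coact b) = Algebra.TensorProduct.lift i₁ ((Algebra.TensorProduct.lift i₂ i₃
        (fun _ _ => .all _ _)).comp α.coact) (fun _ _ => .all _ _) (α.coact b) at h
  have h1 : ∀ t : A ⊗[K] B, Algebra.TensorProduct.lift i₁ ((Algebra.TensorProduct.lift i₂ i₃
        (fun _ _ => .all _ _)).comp α.coact) (fun _ _ => .all _ _) t =
      α.coact.toLinearMap.lTensor A t := by
    intro t
    induction t with
    | zero => simp
    | add x y hx hy => simp only [map_add, hx, hy]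
    | tmul a b =>
      simp only [Algebra.TensorProduct.lift_tmul, AlgHom.comp_apply, LinearMap.lTensor_tmul,
        AlgHom.toLinearMap_apply]
      generalize α.coact b = t
      induction t with
      | zero => simp
      | add x y hx hy => simp only [map_add, TensorProduct.tmul_add, mul_add, hx, hy]
      | tmul a b => simp [i₁, i₂, i₃]
  have h2 : ∀ t : A ⊗[K] B, Algebra.TensorProduct.lift (toConv i₁ * toConv i₂).ofConv i₃
      (fun _ _ => .all _ _) t = TensorProduct.assoc K A A B (Coalgebra.comul.rTensor B t) := by
    intro t
    induction t with
    | zero => simp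
    | add x y hx hy => simp only [map_add, hx, hy]
    | tmul a b =>
      simp only [Algebra.TensorProduct.lift_tmul, AlgHom.convMul_apply, LinearMap.rTensor_tmul]
      generalize Coalgebra.comul (R := K) a = t
      induction t with
      | zero => simp
      | add x y hx hy => simp only [map_add, TensorProduct.add_tmul, add_mul, hx, hy]
      | tmul a b => simp [i₁, i₂, i₃]
  rw [← h1, ← h2, h]

/-- Multiplication of the first tensor factors, `(a ⊗ b) ⊗ (a' ⊗ b') ↦ a a' ⊗ (b ⊗ b')`. -/
noncomputable def mulFirst (K A B : Type u) [Field K] [CommRing A] [HopfAlgebra K A] [CommRing B]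
    [HopfAlgebra K B] : (A ⊗[K] B) ⊗[K] (A ⊗[K] B) →ₗ[K] A ⊗[K] (B ⊗[K] B) :=
  (LinearMap.mul' K A).rTensor (B ⊗[K] B) ∘ₗ
    (TensorProduct.tensorTensorTensorComm K A B A B).toLinearMap

theorem mulFirst_tmul (a a' : A) (b b' : B) :
    mulFirst K A B ((a ⊗ₜ b) ⊗ₜ (a' ⊗ₜ b')) = (a * a') ⊗ₜ (b ⊗ₜ b') := by
  simp [mulFirst]

/-- The law `g • (p q) = (g • p) (g • q)`, read off from the universal points. -/
theorem coact_comul (b : B) : (Coalgebra.comul (R := K)).lTensor A (α.coact b) =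
    mulFirst K A B (TensorProduct.map α.coact.toLinearMap α.coact.toLinearMap
      (Coalgebra.comul b)) := by
  let i₁ : A →ₐ[K] A ⊗[K] (B ⊗[K] B) := Algebra.TensorProduct.includeLeft
  let i₂ : B →ₐ[K] A ⊗[K] (B ⊗[K] B) :=
    Algebra.TensorProduct.includeRight.comp Algebra.TensorProduct.includeLeft
  let i₃ : B →ₐ[K] A ⊗[K] (B ⊗[K] B) :=
    Algebra.TensorProduct.includeRight.comp Algebra.TensorProduct.includeRight
  have h := congrArg (fun p => p.ofConv b) (α.act_mul _ (toConv i₁) (toConv i₂) (toConv i₃))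
  change Algebra.TensorProduct.lift i₁ (toConv i₂ * toConv i₃).ofConv (fun _ _ => .all _ _)
      (α.coact b) = _ at h
  simp only [AlgHom.convMul_apply] at h
  have h1 : ∀ t : A ⊗[K] B, Algebra.TensorProduct.lift i₁ (toConv i₂ * toConv i₃).ofConv
      (fun _ _ => .all _ _) t = (Coalgebra.comul (R := K)).lTensor A t := by
    intro t
    induction t with
    | zero => simp
    | add x y hx hy => simp only [map_add, hx, hy]
    | tmul a b =>
      simp only [Algebra.TensorProduct.lift_tmul, AlgHom.convMul_apply, LinearMap.lTensor_tmul]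
      generalize Coalgebra.comul (R := K) b = t
      induction t with
      | zero => simp
      | add x y hx hy => simp only [map_add, TensorProduct.tmul_add, mul_add, hx, hy]
      | tmul a b => simp [i₁, i₂, i₃]
  rw [← h1, h]
  generalize Coalgebra.comul (R := K) b = t
  induction t with
  | zero => simp
  | add x y hx hy => simp only [map_add, hx, hy]
  | tmul x y =>
    simp only [Algebra.TensorProduct.lift_tmul, TensorProduct.map_tmul, AlgHom.toLinearMap_apply,
      actPoint, ofConv_toConv, AlgHom.comp_apply]
    generalize α.coact x = s
    generalize α.coact y = t
    induction s with
    | zero => simp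
    | add x y hx hy => simp only [map_add, TensorProduct.add_tmul, add_mul, hx, hy]
    | tmul a b =>
      induction t with
      | zero => simp
      | add x y hx hy => simp only [map_add, TensorProduct.tmul_add, mul_add, hx, hy]
      | tmul a' b' => simp [i₁, i₂, i₃, mulFirst_tmul]

/-- The action of `X : O(U) → S` on `φ : O(Π) → S`: the map `(X ⊗ φ) ∘ coact`. -/
noncomputable def convAct (X : WithConv (A →ₗ[K] S)) (φ : WithConv (B →ₗ[K] S)) :
    WithConv (B →ₗ[K] S) :=
  toConv (LinearMap.mul' K S ∘ₗ TensorProduct.map X.ofConv φ.ofConv ∘ₗ α.coact.toLinearMap)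

theorem convAct_apply (X : WithConv (A →ₗ[K] S)) (φ : WithConv (B →ₗ[K] S)) (b : B) :
    (α.convAct X φ).ofConv b =
      LinearMap.mul' K S (TensorProduct.map X.ofConv φ.ofConv (α.coact b)) := rfl

/-- The commutator of the translation by `φ` on `Π` with the operator of `X ∈ Lie U` is the
translation by `X · φ`, because `U` acts by group automorphisms. -/
theorem contractBaseChange_comul_mul_contractBaseChange_coact (X : WithConv (A →ₗ[K] S))
    (hX : X ∈ groupLie K A S) (φ : WithConv (B →ₗ[K] S)) :
    contractBaseChange Coalgebra.comul φ * contractBaseChange α.coact.toLinearMap X =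
      contractBaseChange α.coact.toLinearMap X * contractBaseChange Coalgebra.comul φ +
      contractBaseChange Coalgebra.comul (α.convAct X φ) := by
  refine contractBaseChange_eq_of_one_tmul fun b => ?_
  let G : A ⊗[K] (B ⊗[K] B) →ₗ[K] S ⊗[K] B :=
    TensorProduct.lift (((LinearMap.lsmul S (S ⊗[K] B)).restrictScalars₁₂ K K).compl₁₂ X.ofConv
      (φ.ofConv.rTensor B))
  have hG : ∀ a w, G (a ⊗ₜ w) = X.ofConv a • φ.ofConv.rTensor B w := fun a w => rfl
  have h1 : ∀ t : A ⊗[K] B, contractBaseChange Coalgebra.comul φ (X.ofConv.rTensor B t) =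
      G ((Coalgebra.comul (R := K)).lTensor A t) := by
    intro t
    induction t with
    | zero => simp
    | add x y hx hy => simp only [map_add, hx, hy]
    | tmul a v => rw [LinearMap.rTensor_tmul, contractBaseChange_tmul, LinearMap.lTensor_tmul, hG]
  have h2 : ∀ s t : A ⊗[K] B, G (mulFirst K A B (s ⊗ₜ t)) =
      φ.ofConv (TensorProduct.lid K B ((Coalgebra.counit (R := K) (A := A)).rTensor B s)) •
        X.ofConv.rTensor B t +
      LinearMap.mul' K S (TensorProduct.map X.ofConv φ.ofConv s) ⊗ₜ
        (TensorProduct.lid K B ((Coalgebra.counit (R := K) (A := A)).rTensor B t)) := by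
    intro s t
    induction s with
    | zero => simp
    | add x y hx hy =>
      simp only [map_add, TensorProduct.add_tmul, hx, hy, add_smul]; abel
    | tmul a b =>
      induction t with
      | zero => simp
      | add x y hx hy => simp only [map_add, TensorProduct.tmul_add, hx, hy, smul_add]; abel
      | tmul a' b' =>
        have h := hX a a'
        rw [mulFirst_tmul, hG, h]
        simp only [LinearMap.rTensor_tmul, TensorProduct.smul_tmul', TensorProduct.map_tmul,
          TensorProduct.lid_tmul, LinearMap.mul'_apply, map_smul, smul_eq_mul, add_mul,
          TensorProduct.add_tmul, TensorProduct.tmul_smul, smul_mul_assoc]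
        rw [mul_comm (X.ofConv a')]
  have h3 : ∀ t : B ⊗[K] B, G (mulFirst K A B (TensorProduct.map α.coact.toLinearMap
      α.coact.toLinearMap t)) = contractBaseChange α.coact.toLinearMap X (φ.ofConv.rTensor B t) +
      (α.convAct X φ).ofConv.rTensor B t := by
    intro t
    induction t with
    | zero => simp
    | add x y hx hy => simp only [map_add, hx, hy]; abel
    | tmul x y =>
      rw [TensorProduct.map_tmul, h2]
      simp only [AlgHom.toLinearMap_apply, α.counit_coact, LinearMap.rTensor_tmul,
        contractBaseChange_tmul, convAct_apply]
  rw [LinearMap.add_apply, Module.End.mul_apply, Module.End.mul_apply, contractBaseChange_one_tmul,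
    contractBaseChange_one_tmul, contractBaseChange_one_tmul, h1, AlgHom.toLinearMap_apply,
    α.coact_comul, h3]

end GroupSchemeAction

/-! ### The filtration by iterated invariants -/

section Filtration

open WithConv

variable {K H V S : Type u} [Field K] [AddCommGroup V] [Module K V] [CommRing S] [Algebra K S]

theorem lid_rTensor_mem_of_mem_baseChange {U : Submodule K V} {t : S ⊗[K] V}
    (ht : t ∈ U.baseChange S) (φ : S →ₗ[K] K) : TensorProduct.lid K V (φ.rTensor V t) ∈ U := by
  obtain ⟨s, rfl⟩ := ht
  induction s with
  | zero => simp
  | add x y hx hy => simp only [map_add]; exact U.add_mem hx hy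
  | tmul a v => simpa using U.smul_mem _ v.2

theorem Submodule.baseChange_mono_of_le {U U' : Submodule K V} (h : U ≤ U') :
    U.baseChange S ≤ U'.baseChange S := by
  rintro _ ⟨s, rfl⟩
  induction s with
  | zero => simp
  | add x y hx hy => rw [map_add]; exact Submodule.add_mem _ hx hy
  | tmul a v => exact Submodule.tmul_mem_baseChange_of_mem a (h v.2)

theorem exists_mem_baseChange_of_mem_iSup {U : ℕ → Submodule K V} (hU : Monotone U) {t : S ⊗[K] V}
    (ht : t ∈ (⨆ n, U n).baseChange S) : ∃ n, t ∈ (U n).baseChange S := by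
  obtain ⟨s, rfl⟩ := ht
  induction s with
  | zero => exact ⟨0, by simp⟩
  | add x y hx hy =>
    obtain ⟨n, hn⟩ := hx
    obtain ⟨m, hm⟩ := hy
    refine ⟨max n m, ?_⟩
    rw [map_add]
    exact Submodule.add_mem _ (Submodule.baseChange_mono_of_le (hU (le_max_left n m)) hn)
      (Submodule.baseChange_mono_of_le (hU (le_max_right n m)) hm)
  | tmul a v =>
    obtain ⟨n, hn⟩ := (Submodule.mem_iSup_of_directed _ hU.directed_le).1 v.2
    exact ⟨n, Submodule.tmul_mem_baseChange_of_mem a hn⟩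

variable [CommRing H] [HopfAlgebra K H]

theorem contract_mul (c : V →ₗ[K] H ⊗[K] V)
    (hc : ∀ v, c.lTensor H (c v) =
      TensorProduct.assoc K H H V (Coalgebra.comul.rTensor V (c v)))
    (φ ψ : WithConv (H →ₗ[K] K)) (v : V) :
    contract c (φ * ψ).ofConv v = contract c ψ.ofConv (contract c φ.ofConv v) := by
  have h := congrArg (TensorProduct.lid K V)
    (LinearMap.congr_fun (contractBaseChange_mul c hc φ ψ) ((1 : K) ⊗ₜ v))
  rw [Module.End.mul_apply, contractBaseChange_one_tmul, contractBaseChange_one_tmul] at h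
  refine h.trans ?_
  have h1 : φ.ofConv.rTensor V (c v) = (1 : K) ⊗ₜ contract c φ.ofConv v := by
    rw [← TensorProduct.lid_symm_apply, LinearEquiv.eq_symm_apply]; rfl
  rw [h1, contractBaseChange_one_tmul]
  rfl

/-- Every vector of the comodule given by `c` is killed by all sufficiently long words in the
operators attached to functionals that vanish at `1`. -/
theorem IsProUnipotent.induction_contract (hH : IsProUnipotent K H) (c : V →ₗ[K] H ⊗[K] V)
    (hc : ∀ v, c.lTensor H (c v) =
      TensorProduct.assoc K H H V (Coalgebra.comul.rTensor V (c v)))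
    (hc' : ∀ v, TensorProduct.lid K V ((Coalgebra.counit (R := K) (A := H)).rTensor V (c v)) = v)
    {p : V → Prop} (h0 : p 0)
    (h : ∀ v, (∀ φ : H →ₗ[K] K, φ 1 = 0 → p (contract c φ v)) → p v) (v : V) : p v := by
  obtain ⟨n, hn⟩ : ∃ n, ∀ f ∈ augmentation K H K ^ n, contract c f.ofConv v = 0 := by
    have : ∀ t : H ⊗[K] V, ∃ n, ∀ m ≥ n, ∀ f ∈ augmentation K H K ^ m,
        f.ofConv.rTensor V t = 0 := by
      intro t
      induction t with
      | zero => exact ⟨0, by simp⟩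
      | add x y hx hy =>
        obtain ⟨n, hn⟩ := hx
        obtain ⟨m, hm⟩ := hy
        exact ⟨max n m, fun k hk f hf => by
          rw [map_add, hn k (le_of_max_le_left hk) f hf, hm k (le_of_max_le_right hk) f hf,
            add_zero]⟩
      | tmul a v =>
        obtain ⟨n, hn⟩ := hH.exists_apply_eq_zero (S := K) a
        exact ⟨n, fun m hm f hf => by rw [LinearMap.rTensor_tmul, hn m hm f hf,
          TensorProduct.zero_tmul]⟩
    obtain ⟨n, hn⟩ := this (c v)
    exact ⟨n, fun f hf => by simp [contract, hn n le_rfl f hf]⟩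
  induction n generalizing v with
  | zero =>
    have h1 : (1 : WithConv (H →ₗ[K] K)) ∈ augmentation K H K ^ 0 := by
      rw [pow_zero]; exact Submodule.one_le.1 le_rfl
    have h2 : v = 0 := (hc' v).symm.trans (hn 1 h1)
    rwa [h2]
  | succ n ih =>
    refine h v fun φ hφ => ih _ fun f hf => ?_
    rw [← contract_mul c hc (toConv φ) f]
    refine hn _ ?_
    rw [pow_succ']
    exact Submodule.mul_mem_mul hφ hf

end Filtration

namespace GroupSchemeAction

open WithConv

variable {K A B S : Type u} [Field K] [CommRing A] [HopfAlgebra K A] [CommRing B] [HopfAlgebra K B]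
  [CommRing S] [Algebra K S] (α : GroupSchemeAction K A B)

/-- The ascending filtration of `O(Π)` by iterated invariants under both the translations of `Π`
and the action of `U`. -/
noncomputable def jointFiltration : ℕ → Submodule K B
  | 0 => ⊥
  | n + 1 => (⨅ φ : {φ : B →ₗ[K] K // φ 1 = 0},
        (jointFiltration n).comap (contract Coalgebra.comul φ.1)) ⊓
      ⨅ ψ : {ψ : A →ₗ[K] K // ψ 1 = 0}, (jointFiltration n).comap (contract α.coact.toLinearMap ψ.1)

theorem mem_jointFiltration_succ {n : ℕ} {b : B} : b ∈ α.jointFiltration (n + 1) ↔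
    (∀ φ : B →ₗ[K] K, φ 1 = 0 → contract Coalgebra.comul φ b ∈ α.jointFiltration n) ∧
    ∀ ψ : A →ₗ[K] K, ψ 1 = 0 → contract α.coact.toLinearMap ψ b ∈ α.jointFiltration n := by
  simp [jointFiltration, Submodule.mem_iInf]

theorem jointFiltration_mono : Monotone α.jointFiltration := by
  refine monotone_nat_of_le_succ fun n => ?_
  induction n with
  | zero => exact bot_le
  | succ n ih =>
    intro b hb
    rw [mem_jointFiltration_succ] at hb ⊢
    exact ⟨fun φ hφ => ih (hb.1 φ hφ), fun ψ hψ => ih (hb.2 ψ hψ)⟩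

theorem rTensor_comul_mem {n : ℕ} {b : B} (hb : b ∈ α.jointFiltration (n + 1)) (X : B →ₗ[K] S)
    (hX : X 1 = 0) : X.rTensor B (Coalgebra.comul b) ∈ (α.jointFiltration n).baseChange S :=
  rTensor_mem_baseChange 1 _ _ (α.mem_jointFiltration_succ.1 hb).1 X hX

theorem rTensor_coact_mem {n : ℕ} {b : B} (hb : b ∈ α.jointFiltration (n + 1)) (X : A →ₗ[K] S)
    (hX : X 1 = 0) : X.rTensor B (α.coact b) ∈ (α.jointFiltration n).baseChange S :=
  rTensor_mem_baseChange 1 _ _ (α.mem_jointFiltration_succ.1 hb).2 X hX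

end GroupSchemeAction

section

variable {K H V : Type u} [Field K] [CommRing H] [HopfAlgebra K H] [AddCommGroup V] [Module K V]

/-- Finiteness of comodules: a vector that is invariant modulo the union of an ascending sequence of
subspaces is invariant modulo one of them. -/
theorem exists_forall_contract_mem {U : ℕ → Submodule K V} (hU : Monotone U)
    (c : V →ₗ[K] H ⊗[K] V) {v : V}
    (hv : ∀ φ : H →ₗ[K] K, φ 1 = 0 → contract c φ v ∈ ⨆ n, U n) :
    ∃ n, ∀ φ : H →ₗ[K] K, φ 1 = 0 → contract c φ v ∈ U n := by
  let X : H →ₗ[K] H := LinearMap.id - Algebra.linearMap K H ∘ₗ Coalgebra.counit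
  have h1 : X.rTensor V (c v) ∈ (⨆ n, U n).baseChange H :=
    rTensor_mem_baseChange 1 _ _ hv X (by simp [X])
  obtain ⟨n, hn⟩ := exists_mem_baseChange_of_mem_iSup hU h1
  refine ⟨n, fun φ hφ => ?_⟩
  have h2 : φ ∘ₗ X = φ := by
    ext a
    simp [X, Algebra.algebraMap_eq_smul_one, hφ]
  have h3 := lid_rTensor_mem_of_mem_baseChange hn φ
  rw [← LinearMap.rTensor_comp_apply, h2] at h3
  exact h3

end

namespace GroupSchemeAction

open WithConv

variable {K A B S : Type u} [Field K] [CommRing A] [HopfAlgebra K A] [CommRing B] [HopfAlgebra K B]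
  [CommRing S] [Algebra K S] (α : GroupSchemeAction K A B)

theorem mem_iSup_jointFiltration {b : B}
    (h : ∀ φ : B →ₗ[K] K, φ 1 = 0 →
      contract Coalgebra.comul φ b ∈ ⨆ n, α.jointFiltration n)
    (h' : ∀ ψ : A →ₗ[K] K, ψ 1 = 0 →
      contract α.coact.toLinearMap ψ b ∈ ⨆ n, α.jointFiltration n) :
    b ∈ ⨆ n, α.jointFiltration n := by
  obtain ⟨n, hn⟩ := exists_forall_contract_mem α.jointFiltration_mono _ h
  obtain ⟨m, hm⟩ := exists_forall_contract_mem α.jointFiltration_mono _ h'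
  refine (Submodule.mem_iSup_of_directed _ α.jointFiltration_mono.directed_le).2
    ⟨max n m + 1, α.mem_jointFiltration_succ.2 ⟨fun φ hφ => ?_, fun ψ hψ => ?_⟩⟩
  · exact α.jointFiltration_mono (le_max_left n m) (hn φ hφ)
  · exact α.jointFiltration_mono (le_max_right n m) (hm ψ hψ)

theorem contract_coact_mem_iSup {b : B} (hb : b ∈ ⨆ n, α.jointFiltration n) (ψ : A →ₗ[K] K) :
    contract α.coact.toLinearMap ψ b ∈ ⨆ n, α.jointFiltration n := by
  have h1 : contract α.coact.toLinearMap ψ b =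
      contract α.coact.toLinearMap (ψ - ψ 1 • Coalgebra.counit) b + ψ 1 • b := by
    conv_rhs => rw [← α.counit_coact b]
    simp [contract, LinearMap.rTensor_sub, LinearMap.rTensor_smul, α.counit_coact]
  obtain ⟨n, hn⟩ := (Submodule.mem_iSup_of_directed _ α.jointFiltration_mono.directed_le).1 hb
  rw [h1]
  refine Submodule.add_mem _ (Submodule.mem_iSup_of_mem n ?_) (Submodule.smul_mem _ _ hb)
  exact (α.mem_jointFiltration_succ.1 (α.jointFiltration_mono n.le_succ hn)).2 _ (by simp)

/-- The vectors of `O(Π)` that are `Π`-invariant modulo the union of the filtration are stable under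
`U`, because `U` acts by group automorphisms. -/
theorem contract_comul_contract_coact_mem {b : B}
    (hb : ∀ φ : B →ₗ[K] K, φ 1 = 0 →
      contract Coalgebra.comul φ b ∈ ⨆ n, α.jointFiltration n)
    (ψ : A →ₗ[K] K) (φ : B →ₗ[K] K) (hφ : φ 1 = 0) :
    contract Coalgebra.comul φ (contract α.coact.toLinearMap ψ b) ∈
      ⨆ n, α.jointFiltration n := by
  let Γ : A ⊗[K] (B ⊗[K] B) →ₗ[K] B := (TensorProduct.lid K B).toLinearMap ∘ₗ
    TensorProduct.map ψ ((TensorProduct.lid K B).toLinearMap ∘ₗ φ.rTensor B)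
  let Λ : B ⊗[K] B →ₗ[K] B := Γ ∘ₗ mulFirst K A B ∘ₗ
    TensorProduct.map α.coact.toLinearMap α.coact.toLinearMap
  have h1 : ∀ t : A ⊗[K] B, contract Coalgebra.comul φ (TensorProduct.lid K B (ψ.rTensor B t)) =
      Γ ((Coalgebra.comul (R := K)).lTensor A t) := by
    intro t
    induction t with
    | zero => simp
    | add x y hx hy => simp only [map_add, hx, hy]
    | tmul a b => simp [Γ, contract]
  have h2 : contract Coalgebra.comul φ (contract α.coact.toLinearMap ψ b) =
      Λ (Coalgebra.comul b) := by
    refine (h1 _).trans ?_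
    rw [AlgHom.toLinearMap_apply, coact_comul]
    rfl
  have h3 : ∀ w, Λ (1 ⊗ₜ w) = 0 := by
    intro w
    simp only [Λ, LinearMap.comp_apply, TensorProduct.map_tmul, AlgHom.toLinearMap_apply, map_one,
      Algebra.TensorProduct.one_def]
    generalize α.coact w = t
    induction t with
    | zero => simp
    | add x y hx hy => simp only [map_add, TensorProduct.tmul_add, hx, hy, add_zero]
    | tmul a b => simp [mulFirst_tmul, Γ, hφ]
  have h4 : ∀ x, ∀ w ∈ ⨆ n, α.jointFiltration n, Λ (x ⊗ₜ w) ∈ ⨆ n, α.jointFiltration n := by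
    intro x w hw
    simp only [Λ, LinearMap.comp_apply, TensorProduct.map_tmul, AlgHom.toLinearMap_apply]
    generalize α.coact x = s
    induction s with
    | zero => simp
    | add x y hx hy =>
      rw [TensorProduct.add_tmul, map_add, map_add]
      exact Submodule.add_mem _ hx hy
    | tmul a c =>
      have h5 : ∀ t : A ⊗[K] B, Γ (mulFirst K A B ((a ⊗ₜ c) ⊗ₜ t)) =
          φ c • TensorProduct.lid K B ((ψ ∘ₗ LinearMap.mulLeft K a).rTensor B t) := by
        intro t
        induction t with
        | zero => simp
        | add x y hx hy => simp only [map_add, TensorProduct.tmul_add, hx, hy, smul_add]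
        | tmul a' b => simp [mulFirst_tmul, Γ, smul_smul, mul_comm]
      rw [h5]
      exact Submodule.smul_mem _ _ (α.contract_coact_mem_iSup hw (ψ ∘ₗ LinearMap.mulLeft K a))
  -- By invariance of `b`, `Δ b - 1 ⊗ b` lies in `O(Π) ⊗ ⋃ₙ Wₙ`, and `Λ` kills `1 ⊗ b`.
  let X : B →ₗ[K] B := LinearMap.id - Algebra.linearMap K B ∘ₗ Coalgebra.counit
  have h5 : X.rTensor B (Coalgebra.comul b) ∈ (⨆ n, α.jointFiltration n).baseChange B :=
    rTensor_mem_baseChange 1 _ _ hb X (by simp [X])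
  have h6 : X.rTensor B (Coalgebra.comul b) = Coalgebra.comul (R := K) b - 1 ⊗ₜ b := by
    simp [X, LinearMap.rTensor_sub, LinearMap.rTensor_comp_apply]
  have h7 : ∀ t ∈ (⨆ n, α.jointFiltration n).baseChange B, Λ t ∈ ⨆ n, α.jointFiltration n := by
    rintro _ ⟨s, rfl⟩
    induction s with
    | zero => simp
    | add x y hx hy => rw [map_add, map_add]; exact Submodule.add_mem _ hx hy
    | tmul x w => exact h4 x w w.2
  have h8 := h7 _ h5
  rw [h6, map_sub, h3, sub_zero] at h8
  rw [h2]
  exact h8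

/-- The filtration by iterated invariants under both groups is exhaustive; this expresses that the
semidirect product of `Π` and `U` is pro-unipotent. -/
theorem exists_mem_jointFiltration (hU : IsProUnipotent K A) (hP : IsProUnipotent K B) (b : B) :
    ∃ n, b ∈ α.jointFiltration n := by
  rw [← Submodule.mem_iSup_of_directed _ α.jointFiltration_mono.directed_le]
  have hcomul : ∀ b : B, (Coalgebra.comul (R := K)).lTensor B (Coalgebra.comul b) =
      TensorProduct.assoc K B B B (Coalgebra.comul.rTensor B (Coalgebra.comul b)) :=
    fun b => (Coalgebra.coassoc_apply b).symm
  refine hP.induction_contract Coalgebra.comul hcomul (fun v => by simp)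
    (p := fun b => b ∈ ⨆ n, α.jointFiltration n) (Submodule.zero_mem _) (fun v hv => ?_) b
  refine hU.induction_contract α.coact.toLinearMap α.coact_coassoc α.counit_coact
    (p := fun b => (∀ φ : B →ₗ[K] K, φ 1 = 0 →
      contract Coalgebra.comul φ b ∈ ⨆ n, α.jointFiltration n) → b ∈ ⨆ n, α.jointFiltration n)
    (fun _ => Submodule.zero_mem _) (fun w hw hw' => ?_) v hv
  exact α.mem_iSup_jointFiltration hw' fun ψ hψ => hw ψ hψ fun φ hφ =>
    α.contract_comul_contract_coact_mem hw' ψ φ hφ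

end GroupSchemeAction

/-! ### The vector fields attached to a Lie algebra cocycle -/

section Scalars

open WithConv

variable {K H S : Type u} [Field K] [CommRing H] [HopfAlgebra K H] [CommRing S] [Algebra K S]

/-- Postcomposition of linear maps on `H` with an algebra homomorphism, a ring homomorphism for the
convolution product. -/
noncomputable def convPostcomp {R : Type u} [CommRing R] [Algebra K R] (φ : R →ₐ[K] S) :
    WithConv (H →ₗ[K] R) →+* WithConv (H →ₗ[K] S) where
  toFun x := toConv (φ.toLinearMap ∘ₗ x.ofConv)
  map_one' := by ext a; simp
  map_mul' x y := WithConv.ext (LinearMap.algHom_comp_convMul_distrib φ x y)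
  map_zero' := by ext a; simp
  map_add' x y := by ext a; simp

theorem convPostcomp_apply {R : Type u} [CommRing R] [Algebra K R] (φ : R →ₐ[K] S)
    (x : WithConv (H →ₗ[K] R)) (a : H) : (convPostcomp φ x).ofConv a = φ (x.ofConv a) := rfl

/-- A property of `X ∈ (Lie U)(S)` that is `S`-linear and depends on finitely many values of `X`
can be checked on `Lie U`. -/
theorem mem_of_forall_tangent {M : Type u} [AddCommGroup M] [Module S M]
    (f : WithConv (H →ₗ[K] S) →ₗ[S] M) (M' : Submodule S M)
    (hf : ∃ F : Finset H, ∀ X, (∀ a ∈ F, X.ofConv a = 0) → f X = 0)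
    (h : ∀ δ : groupLie K H K, f (convPostcomp (Algebra.ofId K S) δ.1) ∈ M')
    {X : WithConv (H →ₗ[K] S)} (hX : X ∈ groupLie K H S) : f X ∈ M' := by
  obtain ⟨F, hF⟩ := hf
  refine mem_of_forall_functional (leibnizDefect K H)
    (f ∘ₗ (WithConv.linearEquiv S (H →ₗ[K] S)).symm.toLinearMap) M' ⟨F, fun X hX => hF _ hX⟩
    (fun φ hφ => h ⟨toConv φ, (leibnizDefect_le_ker_iff φ).1 hφ⟩) X.ofConv
    ((leibnizDefect_le_ker_iff X.ofConv).2 hX)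

theorem exists_finset_convMul_left (Y : WithConv (H →ₗ[K] S)) (a : H) :
    ∃ F : Finset H, ∀ X : WithConv (H →ₗ[K] S), (∀ a ∈ F, X.ofConv a = 0) →
      (X * Y).ofConv a = 0 := by
  obtain ⟨F, hF⟩ := exists_finset_rTensor_eq_zero (W := S) (Coalgebra.comul (R := K) a)
  refine ⟨F, fun X hX => ?_⟩
  rw [LinearMap.convMul_apply, ← LinearMap.lTensor_comp_rTensor, LinearMap.comp_apply, hF _ hX,
    map_zero, map_zero]

theorem exists_finset_convMul_right (Y : WithConv (H →ₗ[K] S)) (a : H) :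
    ∃ F : Finset H, ∀ X : WithConv (H →ₗ[K] S), (∀ a ∈ F, X.ofConv a = 0) →
      (Y * X).ofConv a = 0 := by
  obtain ⟨F, hF⟩ := exists_finset_lTensor_eq_zero (W := S) (Coalgebra.comul (R := K) a)
  refine ⟨F, fun X hX => ?_⟩
  rw [LinearMap.convMul_apply, ← LinearMap.rTensor_comp_lTensor, LinearMap.comp_apply, hF _ hX,
    map_zero, map_zero]

theorem lie_eq_mul_sub_mul {R : Type u} [CommRing R] [Algebra K R] (x y : groupLie K H R) :
    (⁅x, y⁆ : groupLie K H R).1 = x.1 * y.1 - y.1 * x.1 := rfl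

theorem mul_sub_mul_mem_groupLie {x y : WithConv (H →ₗ[K] S)} (hx : x ∈ groupLie K H S)
    (hy : y ∈ groupLie K H S) : x * y - y * x ∈ groupLie K H S :=
  (⁅(⟨x, hx⟩ : groupLie K H S), ⟨y, hy⟩⁆ : groupLie K H S).2

theorem apply_one_of_mem_groupLie {x : WithConv (H →ₗ[K] S)} (hx : x ∈ groupLie K H S) :
    x.ofConv 1 = 0 := by
  have := hx 1 1
  simpa using this

end Scalars

namespace GroupSchemeAction

open WithConv

variable {K A B S : Type u} [Field K] [CommRing A] [HopfAlgebra K A] [CommRing B] [HopfAlgebra K B]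
  [CommRing S] [Algebra K S] (α : GroupSchemeAction K A B)

theorem convAct_add_left (X Y : WithConv (A →ₗ[K] S)) (φ : WithConv (B →ₗ[K] S)) :
    α.convAct (X + Y) φ = α.convAct X φ + α.convAct Y φ := by
  ext b
  simp [convAct_apply, TensorProduct.map_add_left]

theorem convAct_add_right (X : WithConv (A →ₗ[K] S)) (φ ψ : WithConv (B →ₗ[K] S)) :
    α.convAct X (φ + ψ) = α.convAct X φ + α.convAct X ψ := by
  ext b
  simp [convAct_apply, TensorProduct.map_add_right]

theorem convAct_smul_left (s : S) (X : WithConv (A →ₗ[K] S)) (φ : WithConv (B →ₗ[K] S)) :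
    α.convAct (s • X) φ = s • α.convAct X φ := by
  ext b
  simp only [convAct_apply, ofConv_smul, LinearMap.smul_apply]
  generalize α.coact b = t
  induction t with
  | zero => simp
  | add x y hx hy => simp only [map_add, smul_add, hx, hy]
  | tmul a b => simp [mul_assoc]

theorem convAct_smul_right (s : S) (X : WithConv (A →ₗ[K] S)) (φ : WithConv (B →ₗ[K] S)) :
    α.convAct X (s • φ) = s • α.convAct X φ := by
  ext b
  simp only [convAct_apply, ofConv_smul, LinearMap.smul_apply]
  generalize α.coact b = t
  induction t with
  | zero => simp
  | add x y hx hy => simp only [map_add, smul_add, hx, hy]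
  | tmul a b => simp [mul_left_comm]

theorem exists_finset_convAct (φ : WithConv (B →ₗ[K] S)) (b : B) :
    ∃ F : Finset A, ∀ X : WithConv (A →ₗ[K] S), (∀ a ∈ F, X.ofConv a = 0) →
      (α.convAct X φ).ofConv b = 0 := by
  obtain ⟨F, hF⟩ := exists_finset_rTensor_eq_zero (W := S) (α.coact b)
  refine ⟨F, fun X hX => ?_⟩
  rw [convAct_apply, ← LinearMap.lTensor_comp_rTensor, LinearMap.comp_apply, hF _ hX,
    map_zero, map_zero]

theorem convPostcomp_lieAct {R : Type u} [CommRing R] [Algebra K R] (φ : R →ₐ[K] S)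
    (δ : groupLie K A K) (x : groupLie K B R) :
    convPostcomp φ (α.lieAct δ x).1 =
      α.convAct (convPostcomp (Algebra.ofId K S) δ.1) (convPostcomp φ x.1) := by
  ext b
  change φ (TensorProduct.lid K R (TensorProduct.map δ.1.ofConv x.1.ofConv (α.coact b))) = _
  rw [convAct_apply]
  generalize α.coact b = t
  induction t with
  | zero => simp
  | add x y hx hy => simp only [map_add, hx, hy]
  | tmul a b => simp [convPostcomp_apply, Algebra.ofId_apply, Algebra.smul_def]

end GroupSchemeAction

namespace LieCocycle

open WithConv

variable {K A B R : Type u} [Field K] [CommRing A] [HopfAlgebra K A] [CommRing B] [HopfAlgebra K B]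
  [CommRing R] [Algebra K R] {α : GroupSchemeAction K A B} (θ : LieCocycle α R)

/-- By continuity, a Lie algebra cocycle only involves the values of tangent vectors at finitely
many functions. -/
theorem exists_eq_sum : ∃ (F : Finset A) (v : A → WithConv (B →ₗ[K] R)),
    ∀ δ : groupLie K A K, (θ.toLinearMap δ).1 = ∑ a ∈ F, δ.1.ofConv a • v a := by
  classical
  obtain ⟨F, hF⟩ := θ.continuous
  let ev : groupLie K A K →ₗ[K] (F → K) :=
    { toFun := fun δ a => δ.1.ofConv a
      map_add' := fun x y => by ext; simp
      map_smul' := fun c x => by ext; simp }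
  let f : groupLie K A K →ₗ[K] WithConv (B →ₗ[K] R) :=
    (groupLie K B R).toSubmodule.subtype ∘ₗ θ.toLinearMap
  have hker : ∀ δ, ev δ = 0 → f δ = 0 := fun δ hδ => by
    have h1 : θ.toLinearMap δ = 0 := hF δ fun a ha => congrFun hδ ⟨a, ha⟩
    simp [f, h1]
  obtain ⟨r, hr⟩ := ev.rangeRestrict.exists_rightInverse_of_surjective
    (LinearMap.range_rangeRestrict _)
  obtain ⟨g, hg⟩ := LinearMap.exists_extend (f ∘ₗ r)
  refine ⟨F, fun a => if h : a ∈ F then g (Pi.single ⟨a, h⟩ 1) else 0, fun δ => ?_⟩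
  have h1 : f δ = g (ev δ) := by
    have h2 : g (ev δ) = f (r (ev.rangeRestrict δ)) :=
      LinearMap.congr_fun hg (ev.rangeRestrict δ)
    have h3 : ev (r (ev.rangeRestrict δ)) = ev δ :=
      congrArg Subtype.val (LinearMap.congr_fun hr (ev.rangeRestrict δ))
    rw [h2, ← sub_eq_zero, ← map_sub]
    exact hker _ (by rw [map_sub, h3, sub_self])
  change f δ = _
  rw [h1, LinearMap.pi_apply_eq_sum_univ g (ev δ), ← Finset.sum_coe_sort F]
  refine Finset.sum_congr rfl fun a _ => ?_
  beta_reduce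
  rw [dif_pos a.2]
  congr 2
  ext j
  simp [Pi.single_apply, eq_comm]

variable {S : Type u} [CommRing S] [Algebra K S] (φ : R →ₐ[K] S)

/-- The `S`-linear extension of a Lie algebra cocycle to `S`-valued linear maps on `O(U)`. It
depends on choices, but its restriction to `(Lie U)(S)` does not. -/
noncomputable def extend : WithConv (A →ₗ[K] S) →ₗ[S] WithConv (B →ₗ[K] S) where
  toFun X := ∑ a ∈ θ.exists_eq_sum.choose,
    X.ofConv a • convPostcomp φ (θ.exists_eq_sum.choose_spec.choose a)
  map_add' X Y := by simp [add_smul, Finset.sum_add_distrib]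
  map_smul' s X := by simp [mul_smul, Finset.smul_sum]

theorem extend_apply (X : WithConv (A →ₗ[K] S)) : θ.extend φ X = ∑ a ∈ θ.exists_eq_sum.choose,
    X.ofConv a • convPostcomp φ (θ.exists_eq_sum.choose_spec.choose a) := rfl

theorem extend_scalar (δ : groupLie K A K) :
    θ.extend φ (convPostcomp (Algebra.ofId K S) δ.1) = convPostcomp φ (θ.toLinearMap δ).1 := by
  rw [θ.exists_eq_sum.choose_spec.choose_spec δ, map_sum, extend_apply]
  refine Finset.sum_congr rfl fun a _ => ?_
  ext b
  change algebraMap K S (δ.1.ofConv a) * φ _ = φ (δ.1.ofConv a • _)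
  rw [map_smul, Algebra.smul_def]
  rfl

theorem exists_finset_extend : ∃ F : Finset A, ∀ X : WithConv (A →ₗ[K] S),
    (∀ a ∈ F, X.ofConv a = 0) → θ.extend φ X = 0 :=
  ⟨_, fun X hX => Finset.sum_eq_zero fun a ha => by rw [hX a ha, zero_smul]⟩

/-- The extension of a cocycle maps `(Lie U)(S)` to `(Lie Π)(S)`. -/
theorem extend_mem {X : WithConv (A →ₗ[K] S)} (hX : X ∈ groupLie K A S) :
    θ.extend φ X ∈ groupLie K B S := by
  refine (leibnizDefect_le_ker_iff (θ.extend φ X).ofConv).1 fun d hd => ?_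
  let ev : WithConv (A →ₗ[K] S) →ₗ[S] S :=
    { toFun := fun X => (θ.extend φ X).ofConv d
      map_add' := fun X Y => by simp
      map_smul' := fun s X => by simp }
  obtain ⟨F, hF⟩ := θ.exists_finset_extend φ
  refine (Submodule.mem_bot S).1 (mem_of_forall_tangent ev ⊥
    ⟨F, fun X hX => by simp [ev, hF X hX]⟩ (fun δ => ?_) hX)
  change (θ.extend φ _).ofConv d ∈ _
  rw [extend_scalar, convPostcomp_apply,
    (leibnizDefect_le_ker_iff (θ.toLinearMap δ).1.ofConv).2 (θ.toLinearMap δ).2 d hd, map_zero]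
  exact Submodule.zero_mem _

/-- The failure of the extension to satisfy the cocycle condition at `X` and `Y`. -/
noncomputable def extendDefect (X Y : WithConv (A →ₗ[K] S)) : WithConv (B →ₗ[K] S) :=
  θ.extend φ (X * Y - Y * X) - (θ.extend φ X * θ.extend φ Y - θ.extend φ Y * θ.extend φ X) -
    α.convAct X (θ.extend φ Y) + α.convAct Y (θ.extend φ X)

theorem extendDefect_swap (X Y : WithConv (A →ₗ[K] S)) :
    θ.extendDefect φ X Y = - θ.extendDefect φ Y X := by
  simp only [extendDefect, map_sub]; abel

theorem extendDefect_add_left (X X' Y : WithConv (A →ₗ[K] S)) :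
    θ.extendDefect φ (X + X') Y = θ.extendDefect φ X Y + θ.extendDefect φ X' Y := by
  simp only [extendDefect, map_sub, map_add, add_mul, mul_add, α.convAct_add_left,
    α.convAct_add_right]
  abel

theorem extendDefect_smul_left (s : S) (X Y : WithConv (A →ₗ[K] S)) :
    θ.extendDefect φ (s • X) Y = s • θ.extendDefect φ X Y := by
  simp only [extendDefect, map_sub, map_smul, smul_mul_assoc, mul_smul_comm, α.convAct_smul_left,
    α.convAct_smul_right, smul_sub, smul_add]

theorem exists_finset_extendDefect (Y : WithConv (A →ₗ[K] S)) (b : B) :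
    ∃ F : Finset A, ∀ X : WithConv (A →ₗ[K] S), (∀ a ∈ F, X.ofConv a = 0) →
      (θ.extendDefect φ X Y).ofConv b = 0 := by
  classical
  obtain ⟨F₀, h₀⟩ := θ.exists_finset_extend φ
  choose F₁ h₁ using exists_finset_convMul_left (K := K) (H := A) Y
  choose F₂ h₂ using exists_finset_convMul_right (K := K) (H := A) Y
  obtain ⟨F₃, h₃⟩ := α.exists_finset_convAct (θ.extend φ Y) b
  refine ⟨F₀ ∪ F₀.biUnion F₁ ∪ F₀.biUnion F₂ ∪ F₃, fun X hX => ?_⟩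
  have e0 : θ.extend φ X = 0 := h₀ X fun a ha => hX a (by simp [ha])
  have e1 : θ.extend φ (X * Y) = 0 := h₀ _ fun a ha => h₁ a X fun a' ha' =>
    hX a' (by
      simp only [Finset.mem_union, Finset.mem_biUnion]; exact .inl (.inl (.inr ⟨a, ha, ha'⟩)))
  have e2 : θ.extend φ (Y * X) = 0 := h₀ _ fun a ha => h₂ a X fun a' ha' =>
    hX a' (by simp only [Finset.mem_union, Finset.mem_biUnion]; exact .inl (.inr ⟨a, ha, ha'⟩))
  have e3 := h₃ X fun a ha => hX a (by simp [ha])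
  have e4 : α.convAct Y (0 : WithConv (B →ₗ[K] S)) = 0 := by
    have := α.convAct_smul_right (0 : S) Y 0
    simpa using this
  simp [extendDefect, e0, e1, e2, e3, e4]

theorem extendDefect_scalar (δ δ' : groupLie K A K) :
    θ.extendDefect φ (convPostcomp (Algebra.ofId K S) δ.1)
      (convPostcomp (Algebra.ofId K S) δ'.1) = 0 := by
  have h : (θ.toLinearMap ⁅δ, δ'⁆).1 = (⁅θ.toLinearMap δ, θ.toLinearMap δ'⁆ : groupLie K B R).1 +
      (α.lieAct δ (θ.toLinearMap δ')).1 - (α.lieAct δ' (θ.toLinearMap δ)).1 :=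
    congrArg Subtype.val (θ.cocycle δ δ')
  have h1 : convPostcomp (Algebra.ofId K S) δ.1 * convPostcomp (Algebra.ofId K S) δ'.1 -
      convPostcomp (Algebra.ofId K S) δ'.1 * convPostcomp (Algebra.ofId K S) δ.1 =
      convPostcomp (Algebra.ofId K S) (⁅δ, δ'⁆ : groupLie K A K).1 := by
    rw [lie_eq_mul_sub_mul, map_sub, map_mul, map_mul]
  rw [extendDefect, h1, extend_scalar, extend_scalar, extend_scalar, h, lie_eq_mul_sub_mul]
  simp only [map_sub, map_add, map_mul, α.convPostcomp_lieAct]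
  abel

/-- The `S`-linear extension of a Lie algebra cocycle is a cocycle on `(Lie U)(S)`. -/
theorem extendDefect_eq_zero {X Y : WithConv (A →ₗ[K] S)} (hX : X ∈ groupLie K A S)
    (hY : Y ∈ groupLie K A S) : θ.extendDefect φ X Y = 0 := by
  let f (Y : WithConv (A →ₗ[K] S)) (b : B) : WithConv (A →ₗ[K] S) →ₗ[S] S :=
    { toFun := fun X => (θ.extendDefect φ X Y).ofConv b
      map_add' := fun X X' => by simp [extendDefect_add_left]
      map_smul' := fun s X => by simp [extendDefect_smul_left] }
  have h1 : ∀ (Y : WithConv (A →ₗ[K] S)), (∀ δ : groupLie K A K,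
      θ.extendDefect φ (convPostcomp (Algebra.ofId K S) δ.1) Y = 0) →
      ∀ {X : WithConv (A →ₗ[K] S)}, X ∈ groupLie K A S → θ.extendDefect φ X Y = 0 := by
    intro Y hY X hX
    ext b
    refine (Submodule.mem_bot S).1 (mem_of_forall_tangent (f Y b) ⊥
      (θ.exists_finset_extendDefect φ Y b) (fun δ => ?_) hX)
    change (θ.extendDefect φ _ Y).ofConv b ∈ _
    rw [hY]
    exact Submodule.zero_mem _
  refine h1 Y (fun δ => ?_) hX
  rw [extendDefect_swap, h1 _ (fun δ' => extendDefect_scalar θ φ δ' δ) hY, neg_zero]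

/-- The vector field on `Π_S` by which the element `(θ(X), X)` of the Lie algebra of `Π ⋊ U`
acts on `O(Π_S)`, for the action `(p, u) • q = p * u(q)` of `Π ⋊ U` on `Π`. -/
noncomputable def vectorField : WithConv (A →ₗ[K] S) →ₗ[S] Module.End S (S ⊗[K] B) :=
  contractBaseChange Coalgebra.comul ∘ₗ θ.extend φ + contractBaseChange α.coact.toLinearMap

theorem vectorField_apply (X : WithConv (A →ₗ[K] S)) : θ.vectorField φ X =
    contractBaseChange Coalgebra.comul (θ.extend φ X) +
      contractBaseChange α.coact.toLinearMap X := rfl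

theorem vectorField_one_tmul (X : WithConv (A →ₗ[K] S)) (b : B) :
    θ.vectorField φ X (1 ⊗ₜ b) = (θ.extend φ X).ofConv.rTensor B (Coalgebra.comul b) +
      X.ofConv.rTensor B (α.coact b) := by
  rw [vectorField_apply, LinearMap.add_apply, contractBaseChange_one_tmul,
    contractBaseChange_one_tmul]
  rfl

/-- The cocycle condition makes the vector fields an anti-representation of `(Lie U)(S)`. -/
theorem vectorField_lie {X Y : WithConv (A →ₗ[K] S)} (hX : X ∈ groupLie K A S)
    (hY : Y ∈ groupLie K A S) : θ.vectorField φ (X * Y - Y * X) =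
      θ.vectorField φ Y * θ.vectorField φ X - θ.vectorField φ X * θ.vectorField φ Y := by
  have h := θ.extendDefect_eq_zero φ hX hY
  have h1 : θ.extend φ (X * Y - Y * X) =
      (θ.extend φ X * θ.extend φ Y - θ.extend φ Y * θ.extend φ X) +
        α.convAct X (θ.extend φ Y) - α.convAct Y (θ.extend φ X) := by
    rw [extendDefect] at h
    rw [← sub_eq_zero, ← h]; abel
  have hcomul : ∀ b : B, (Coalgebra.comul (R := K)).lTensor B (Coalgebra.comul b) =
      TensorProduct.assoc K B B B (Coalgebra.comul.rTensor B (Coalgebra.comul b)) :=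
    fun b => (Coalgebra.coassoc_apply b).symm
  have e1 := α.contractBaseChange_comul_mul_contractBaseChange_coact X hX (θ.extend φ Y)
  have e2 := α.contractBaseChange_comul_mul_contractBaseChange_coact Y hY (θ.extend φ X)
  rw [vectorField_apply _ _ (X * Y - Y * X), h1]
  simp only [vectorField_apply, map_sub, map_add, add_mul, mul_add,
    contractBaseChange_mul _ hcomul, contractBaseChange_mul _ α.coact_coassoc, e1, e2]
  abel

theorem exists_finset_vectorField (v : S ⊗[K] B) : ∃ F : Finset A, ∀ X : WithConv (A →ₗ[K] S),
    (∀ a ∈ F, X.ofConv a = 0) → θ.vectorField φ X v = 0 := by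
  classical
  induction v with
  | zero => exact ⟨∅, by simp⟩
  | add x y hx hy =>
    obtain ⟨F, hF⟩ := hx
    obtain ⟨G, hG⟩ := hy
    exact ⟨F ∪ G, fun X hX => by
      rw [map_add, hF X fun a ha => hX a (by simp [ha]), hG X fun a ha => hX a (by simp [ha]),
        add_zero]⟩
  | tmul s b =>
    obtain ⟨F, hF⟩ := θ.exists_finset_extend φ
    obtain ⟨G, hG⟩ := exists_finset_rTensor_eq_zero (W := S) (α.coact b)
    refine ⟨F ∪ G, fun X hX => ?_⟩
    have h1 : s ⊗ₜ[K] b = s • ((1 : S) ⊗ₜ[K] b) := by simp [TensorProduct.smul_tmul']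
    rw [h1, map_smul, vectorField_one_tmul, hF X fun a ha => hX a (by simp [ha]),
      hG _ fun a ha => hX a (by simp [ha])]
    simp

theorem vectorField_mem {X : WithConv (A →ₗ[K] S)} (hX : X ∈ groupLie K A S) (n : ℕ)
    {v : S ⊗[K] B} (hv : v ∈ (α.jointFiltration (n + 1)).baseChange S) :
    θ.vectorField φ X v ∈ (α.jointFiltration n).baseChange S := by
  obtain ⟨s, rfl⟩ := hv
  induction s with
  | zero => simp
  | add x y hx hy => rw [map_add, map_add]; exact Submodule.add_mem _ hx hy
  | tmul s b =>
    have h1 : s ⊗ₜ[K] b.1 = s • ((1 : S) ⊗ₜ[K] b.1) := by simp [TensorProduct.smul_tmul']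
    rw [LinearMap.baseChange_tmul, Submodule.subtype_apply, h1, map_smul, vectorField_one_tmul]
    exact Submodule.smul_mem _ _ (Submodule.add_mem _
      (α.rTensor_comul_mem b.2 _ (apply_one_of_mem_groupLie (θ.extend_mem φ hX)))
      (α.rTensor_coact_mem b.2 _ (apply_one_of_mem_groupLie hX)))

end LieCocycle

/-! ### The derivative of the exponential -/

section RingIdentities

variable {M : Type u} [Ring M]

/-- The iterated commutators `ad(e)ᵏ(y)`. -/
def adIter (e y : M) : ℕ → M
  | 0 => y
  | k + 1 => e * adIter e y k - adIter e y k * e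

/-- The algebraic form of the formula for the derivative of the exponential: if
`f n = ∑ᵢ eⁱ y eⁿ⁻¹⁻ⁱ`, the derivative of `eⁿ` in the direction `y`, then
`f n = ∑ₖ binom(n, k + 1) ad(e)ᵏ(y) eⁿ⁻¹⁻ᵏ`. -/
theorem derivative_pow_eq_sum (e : M) (z f : ℕ → M) (hz : ∀ k, z (k + 1) = e * z k - z k * e)
    (hf₀ : f 0 = 0) (hf : ∀ n, f (n + 1) = z 0 * e ^ n + e * f n) (n : ℕ) :
    f n = ∑ k ∈ Finset.range n, n.choose (k + 1) • (z k * e ^ (n - 1 - k)) := by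
  induction n with
  | zero => simp [hf₀]
  | succ n ih =>
    have h1 : ∀ k ∈ Finset.range n, e * (n.choose (k + 1) • (z k * e ^ (n - 1 - k))) =
        n.choose (k + 1) • (z (k + 1) * e ^ (n - (k + 1))) +
          n.choose (k + 1) • (z k * e ^ (n - k)) := by
      intro k hk
      have hk' : n - k = (n - 1 - k) + 1 := by have := Finset.mem_range.1 hk; omega
      have hk'' : n - (k + 1) = n - 1 - k := by omega
      rw [hz, hk', hk'', mul_smul_comm, ← smul_add, pow_succ', sub_mul]
      congr 1
      noncomm_ring
    rw [hf, ih, Finset.mul_sum, Finset.sum_congr rfl h1, Finset.sum_add_distrib]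
    have h2 : ∑ k ∈ Finset.range n, n.choose (k + 1) • (z k * e ^ (n - k)) =
        ∑ k ∈ Finset.range (n + 1), n.choose (k + 1) • (z k * e ^ (n - k)) := by
      rw [Finset.sum_range_succ, Nat.choose_succ_self, zero_smul, add_zero]
    have h3 : z 0 * e ^ n + ∑ k ∈ Finset.range n,
        n.choose (k + 1) • (z (k + 1) * e ^ (n - (k + 1))) =
        ∑ k ∈ Finset.range (n + 1), n.choose k • (z k * e ^ (n - k)) := by
      rw [Finset.sum_range_succ' _ n]; simp [add_comm]
    rw [← add_assoc, h3, h2, ← Finset.sum_add_distrib]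
    refine Finset.sum_congr rfl fun k _ => ?_
    rw [Nat.choose_succ_succ, add_smul, Nat.add_sub_cancel]

theorem derivative_pow_eq_sum_right (e : M) (z f : ℕ → M)
    (hz : ∀ k, z (k + 1) = z k * e - e * z k) (hf₀ : f 0 = 0)
    (hf : ∀ n, f (n + 1) = e ^ n * z 0 + f n * e) (n : ℕ) :
    f n = ∑ k ∈ Finset.range n, n.choose (k + 1) • (e ^ (n - 1 - k) * z k) := by
  have h := derivative_pow_eq_sum (MulOpposite.op e) (fun k => MulOpposite.op (z k))
    (fun k => MulOpposite.op (f k)) (fun k => by simp [hz]) (by simp [hf₀])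
    (fun n => by simp [hf]) n
  apply MulOpposite.op_injective
  simpa [-nsmul_eq_mul] using h

/-- The commutator of `y` with `eⁿ` in terms of the iterated commutators of `y` with `e`. -/
theorem mul_pow_sub_pow_mul_eq_sum (e y : M) (z : ℕ → M) (hz : ∀ k, z (k + 1) = z k * e - e * z k)
    (h₀ : y * e - e * y = z 0) (n : ℕ) : y * e ^ n - e ^ n * y =
      ∑ k ∈ Finset.range n, n.choose (k + 1) • (e ^ (n - 1 - k) * z k) := by
  refine derivative_pow_eq_sum_right e z (fun n => y * e ^ n - e ^ n * y) hz (by simp)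
    (fun n => ?_) n
  rw [← h₀, pow_succ, mul_sub, sub_mul]
  simp only [mul_assoc]
  abel

theorem inv_factorial_smul_choose {K : Type u} [Field K] [CharZero K] {V : Type u} [AddCommGroup V]
    [Module K V] {n k : ℕ} (hk : k < n) (v : V) :
    (n.factorial : K)⁻¹ • (n.choose (k + 1) • v) =
      ((k + 1).factorial : K)⁻¹ • ((n - 1 - k).factorial : K)⁻¹ • v := by
  have h := Nat.choose_mul_factorial_mul_factorial (Nat.succ_le_of_lt hk)
  have h' : n - (k + 1) = n - 1 - k := by omega
  rw [Nat.succ_eq_add_one, h'] at h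
  have h1 : (n.choose (k + 1) : K) * (k + 1).factorial * (n - 1 - k).factorial = n.factorial := by
    exact_mod_cast h
  rw [← Nat.cast_smul_eq_nsmul K, smul_smul, smul_smul, ← h1]
  congr 1
  have h2 : (n.choose (k + 1) : K) ≠ 0 := by
    exact_mod_cast (Nat.choose_pos (Nat.succ_le_of_lt hk)).ne'
  have h3 : ((k + 1).factorial : K) ≠ 0 := by exact_mod_cast (k + 1).factorial_ne_zero
  have h4 : ((n - 1 - k).factorial : K) ≠ 0 := by exact_mod_cast (n - 1 - k).factorial_ne_zero
  field_simp

theorem sum_range_sum_range_eq {V : Type u} [AddCommMonoid V] (g : ℕ → ℕ → V) (m : ℕ)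
    (hg : ∀ k j, m ≤ k + j → g k j = 0) :
    ∑ n ∈ Finset.range (m + 1), ∑ k ∈ Finset.range n, g k (n - 1 - k) =
      ∑ k ∈ Finset.range m, ∑ j ∈ Finset.range m, g k j := by
  rw [Finset.sum_range_succ']
  simp only [Nat.add_sub_cancel, Finset.range_zero, Finset.sum_empty, add_zero]
  rw [Finset.sum_range_diag_flip]
  refine Finset.sum_congr rfl fun k _ =>
    Finset.sum_subset (Finset.range_subset_range.2 (Nat.sub_le m k)) fun j _ hj => hg k j ?_
  have := Finset.mem_range.not.1 hj
  omega

end RingIdentities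

section InvariantDerivation

open WithConv

variable {K H V : Type u} [Field K] [CommRing H] [HopfAlgebra K H] [CommRing V] [Algebra K V]

/-- The Leibniz rule for the contraction of `H ⊗ V` with a tangent vector of `H`. -/
theorem rTensor_mul_of_mem_groupLie {S : Type u} [CommRing S] [Algebra K S]
    {X : WithConv (H →ₗ[K] S)} (hX : X ∈ groupLie K H S) (s t : H ⊗[K] V) :
    X.ofConv.rTensor V (s * t) =
      (1 ⊗ₜ TensorProduct.lid K V ((Coalgebra.counit (R := K) (A := H)).rTensor V s)) *
        X.ofConv.rTensor V t +
      X.ofConv.rTensor V s *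
        (1 ⊗ₜ TensorProduct.lid K V ((Coalgebra.counit (R := K) (A := H)).rTensor V t)) := by
  induction s with
  | zero => simp
  | add x y hx hy => simp only [map_add, add_mul, TensorProduct.tmul_add, hx, hy]; abel
  | tmul a b =>
    induction t with
    | zero => simp
    | add x y hx hy => simp only [map_add, mul_add, TensorProduct.tmul_add, hx, hy]; abel
    | tmul a' b' =>
      have := hX a a'
      simp only [Algebra.TensorProduct.tmul_mul_tmul, LinearMap.rTensor_tmul, one_mul, mul_one,
        TensorProduct.lid_tmul, this, TensorProduct.add_tmul, TensorProduct.smul_tmul,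
        smul_mul_assoc, mul_smul_comm]

theorem lid_rTensor_mul_of_mem_groupLie (δ : groupLie K H K) (s t : H ⊗[K] V) :
    TensorProduct.lid K V (δ.1.ofConv.rTensor V (s * t)) =
      TensorProduct.lid K V ((Coalgebra.counit (R := K) (A := H)).rTensor V s) *
        TensorProduct.lid K V (δ.1.ofConv.rTensor V t) +
      TensorProduct.lid K V (δ.1.ofConv.rTensor V s) *
        TensorProduct.lid K V ((Coalgebra.counit (R := K) (A := H)).rTensor V t) := by
  have h := congrArg (Algebra.TensorProduct.lid K V) (rTensor_mul_of_mem_groupLie δ.2 s t)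
  refine h.trans ?_
  rw [map_add, map_mul, map_mul, Algebra.TensorProduct.lid_tmul, Algebra.TensorProduct.lid_tmul,
    one_smul, one_smul]
  rfl

/-- A tangent vector at the identity of a group acting on an affine scheme induces a derivation of
the coordinate ring. -/
theorem contract_mul_of_mem_groupLie (c : V →ₐ[K] H ⊗[K] V)
    (hc : ∀ v, TensorProduct.lid K V ((Coalgebra.counit (R := K) (A := H)).rTensor V (c v)) = v)
    (δ : groupLie K H K) (a b : V) : contract c.toLinearMap δ.1.ofConv (a * b) =
      a * contract c.toLinearMap δ.1.ofConv b + contract c.toLinearMap δ.1.ofConv a * b := by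
  have h := lid_rTensor_mul_of_mem_groupLie δ (c a) (c b)
  rw [hc, hc, ← map_mul] at h
  exact h

theorem contract_algebraMap_of_mem_groupLie (c : V →ₐ[K] H ⊗[K] V)
    (hc : ∀ v, TensorProduct.lid K V ((Coalgebra.counit (R := K) (A := H)).rTensor V (c v)) = v)
    (δ : groupLie K H K) : contract c.toLinearMap δ.1.ofConv 1 = 0 := by
  have := contract_mul_of_mem_groupLie c hc δ 1 1
  simpa using this

/-- The derivation `a ↦ (δ ⊗ id) (Δ a)` of `O(U)`, the derivative of left translations in the
direction `δ`. -/
noncomputable abbrev invariantDerivation (δ : groupLie K H K) : H →ₗ[K] H :=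
  contract Coalgebra.comul δ.1.ofConv

theorem invariantDerivation_mul (δ : groupLie K H K) (a b : H) : invariantDerivation δ (a * b) =
    a * invariantDerivation δ b + invariantDerivation δ a * b :=
  contract_mul_of_mem_groupLie (Bialgebra.comulAlgHom K H) (fun v => by simp) δ a b

theorem invariantDerivation_one (δ : groupLie K H K) : invariantDerivation δ (1 : H) = 0 :=
  contract_algebraMap_of_mem_groupLie (Bialgebra.comulAlgHom K H) (fun v => by simp) δ

/-- The coefficientwise invariant derivation of `R ⊗ O(G)`. -/
noncomputable abbrev invariantDerivationBaseChange (R : Type u) [CommRing R] [Algebra K R]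
    (δ : groupLie K H K) : R ⊗[K] H →ₗ[K] R ⊗[K] H := (invariantDerivation δ).lTensor R

variable {R : Type u} [CommRing R] [Algebra K R]

theorem invariantDerivationBaseChange_mul (δ : groupLie K H K) (x y : R ⊗[K] H) :
    invariantDerivationBaseChange R δ (x * y) = x * invariantDerivationBaseChange R δ y +
      invariantDerivationBaseChange R δ x * y := by
  induction x with
  | zero => simp
  | add x x' hx hy => simp only [map_add, add_mul, hx, hy]; abel
  | tmul r a =>
    induction y with
    | zero => simp
    | add x y hx hy => simp only [map_add, mul_add, hx, hy]; abel
    | tmul r' a' => simp [invariantDerivation_mul, TensorProduct.tmul_add]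

theorem invariantDerivationBaseChange_includeLeft (δ : groupLie K H K) (r : R) :
    invariantDerivationBaseChange R δ
      ((Algebra.TensorProduct.includeLeft : R →ₐ[K] R ⊗[K] H) r) = 0 := by
  simp [invariantDerivation_one]

theorem comp_mem_groupLie {S S' : Type u} [CommRing S] [Algebra K S] [CommRing S'] [Algebra K S']
    {X : WithConv (H →ₗ[K] S)} (hX : X ∈ groupLie K H S) (f : S →ₗ[K] S') :
    toConv (f ∘ₗ X.ofConv) ∈ groupLie K H S' := by
  intro a b
  have h := hX a b
  change f (X.ofConv (a * b)) = _ • f (X.ofConv b) + _ • f (X.ofConv a)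
  rw [h, map_add, map_smul, map_smul]

/-- The Leibniz rule for the convolution product. -/
theorem comp_convMul_of_derivation {C S : Type u} [AddCommGroup C] [Module K C] [Coalgebra K C]
    [CommRing S] [Algebra K S] (D : S →ₗ[K] S)
    (hD : ∀ a b, D (a * b) = a * D b + D a * b) (X Y : WithConv (C →ₗ[K] S)) :
    toConv (D ∘ₗ (X * Y).ofConv) =
      X * toConv (D ∘ₗ Y.ofConv) + toConv (D ∘ₗ X.ofConv) * Y := by
  ext c
  let ℛ := Coalgebra.Repr.arbitrary K c
  simp only [ofConv_add, LinearMap.add_apply, LinearMap.comp_apply, ℛ.convMul_apply, map_sum, hD,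
    Finset.sum_add_distrib]

end InvariantDerivation

section DerivativeOfExponential

open WithConv

variable {K A : Type u} [Field K] [CommRing A] [HopfAlgebra K A]

theorem exists_convMul_locSum_apply {C S : Type u} [AddCommGroup C] [Module K C] [Coalgebra K C]
    [CommRing S] [Algebra K S] (f g : ℕ → C →ₗ[K] S) (hf : ∀ v, ∃ n, ∀ m ≥ n, f m v = 0)
    (hg : ∀ v, ∃ n, ∀ m ≥ n, g m v = 0) (c : C) : ∃ n, ∀ m ≥ n,
      (toConv (locSum f hf) * toConv (locSum g hg)).ofConv c =
        ∑ k ∈ Finset.range m, ∑ j ∈ Finset.range m, (toConv (f k) * toConv (g j)).ofConv c := by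
  simp only [LinearMap.convMul_apply]
  generalize Coalgebra.comul (R := K) c = t
  induction t with
  | zero => exact ⟨0, by simp⟩
  | add x y hx hy =>
    obtain ⟨n, hn⟩ := hx
    obtain ⟨m, hm⟩ := hy
    refine ⟨max n m, fun k hk => ?_⟩
    simp only [map_add, Finset.sum_add_distrib, hn k (le_of_max_le_left hk),
      hm k (le_of_max_le_right hk)]
  | tmul a b =>
    obtain ⟨n, hn⟩ := hf a
    obtain ⟨m, hm⟩ := hg b
    refine ⟨max n m, fun k hk => ?_⟩
    simp only [TensorProduct.map_tmul, LinearMap.mul'_apply]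
    rw [locSum_apply f hf a k fun i hi => hn i (by omega),
      locSum_apply g hg b k fun i hi => hm i (by omega), Finset.sum_mul_sum]

/-- The derivative of the logarithm of the identity in the direction `δ`. -/
noncomputable def eulerianDeriv (hU : IsProUnipotent K A) (δ : groupLie K A K) :
    WithConv (A →ₗ[K] A) := toConv (invariantDerivation δ ∘ₗ (eulerian hU).ofConv)

theorem comp_eulerian_pow (hU : IsProUnipotent K A) (δ : groupLie K A K) (n : ℕ) :
    toConv (invariantDerivation δ ∘ₗ (eulerian hU ^ n).ofConv) =
      ∑ k ∈ Finset.range n, n.choose (k + 1) •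
        (adIter (eulerian hU) (eulerianDeriv hU δ) k * eulerian hU ^ (n - 1 - k)) := by
  refine derivative_pow_eq_sum (eulerian hU) _
    (fun n => toConv (invariantDerivation δ ∘ₗ (eulerian hU ^ n).ofConv)) (fun k => rfl) ?_
    (fun n => ?_) n
  · ext a
    simp only [pow_zero, LinearMap.comp_apply]
    rw [LinearMap.convOne_apply, Algebra.algebraMap_eq_smul_one, map_smul, invariantDerivation_one,
      smul_zero]
    rfl
  · rw [pow_succ', comp_convMul_of_derivation _ (invariantDerivation_mul δ), add_comm]
    rfl

variable [CharZero K]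

theorem eulerianDeriv_mem (hU : IsProUnipotent K A) (δ : groupLie K A K) :
    eulerianDeriv hU δ ∈ groupLie K A A := comp_mem_groupLie (eulerian_mem_groupLie hU) _

theorem adIter_mem (hU : IsProUnipotent K A) (δ : groupLie K A K) (k : ℕ) :
    adIter (eulerian hU) (eulerianDeriv hU δ) k ∈ groupLie K A A := by
  induction k with
  | zero => exact eulerianDeriv_mem hU δ
  | succ k ih => exact mul_sub_mul_mem_groupLie (eulerian_mem_groupLie hU) ih

theorem adIter_mem_augmentation_pow (hU : IsProUnipotent K A) (δ : groupLie K A K) (k : ℕ) :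
    adIter (eulerian hU) (eulerianDeriv hU δ) k ∈ augmentation K A A ^ (k + 1) := by
  have he : eulerian hU ∈ augmentation K A A :=
    apply_one_of_mem_groupLie (eulerian_mem_groupLie hU)
  induction k with
  | zero =>
    rw [zero_add, pow_one]
    exact apply_one_of_mem_groupLie (eulerianDeriv_mem hU δ)
  | succ k ih =>
    refine Submodule.sub_mem _ ?_ ?_
    · rw [pow_succ']; exact Submodule.mul_mem_mul he ih
    · rw [pow_succ]; exact Submodule.mul_mem_mul ih he

theorem exists_adIter_apply_eq_zero (hU : IsProUnipotent K A) (δ : groupLie K A K) (a : A) :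
    ∃ n, ∀ m ≥ n,
      ((m + 1).factorial : K)⁻¹ • (adIter (eulerian hU) (eulerianDeriv hU δ) m).ofConv a = 0 := by
  obtain ⟨n, hn⟩ := hU.exists_apply_eq_zero (S := A) a
  exact ⟨n, fun m hm => by
    rw [hn (m + 1) (by omega) _ (adIter_mem_augmentation_pow hU δ m), smul_zero]⟩

/-- The formula for the derivative of the exponential, applied to `id = exp e`:
with `D` the derivative in the direction `δ`, one has `∑ₖ ad(e)ᵏ(D e) / (k + 1)! = δ`. -/
theorem exists_sum_adIter (hU : IsProUnipotent K A) (δ : groupLie K A K) (a : A) :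
    ∃ n, ∀ m ≥ n, ∑ k ∈ Finset.range m,
      ((k + 1).factorial : K)⁻¹ • (adIter (eulerian hU) (eulerianDeriv hU δ) k).ofConv a =
        algebraMap K A (δ.1.ofConv a) := by
  let z := adIter (eulerian hU) (eulerianDeriv hU δ)
  let f : ℕ → A →ₗ[K] A := fun k => ((k + 1).factorial : K)⁻¹ • (z k).ofConv
  let g : ℕ → A →ₗ[K] A := fun k => (k.factorial : K)⁻¹ • (eulerian hU ^ k).ofConv
  have hf : ∀ a, ∃ n, ∀ m ≥ n, f m a = 0 := exists_adIter_apply_eq_zero hU δ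
  have hg : ∀ a, ∃ n, ∀ m ≥ n, g m a = 0 := fun a => by
    obtain ⟨n, hn, -⟩ := exists_sum_eulerian_pow hU a
    exact ⟨n, fun m hm => by simp [g, hn m hm]⟩
  have hid : locSum g hg = LinearMap.id := by
    ext a
    obtain ⟨n, hn, hn'⟩ := exists_sum_eulerian_pow hU a
    rw [locSum_apply g hg a n fun m hm => by simp [g, hn m hm]]
    exact (hn' n le_rfl).symm
  -- Differentiate `id = exp e`: on the one hand `D(id) = δ * id`, on the other hand the formula for
  -- the derivative of powers gives `D(exp e) = (∑ₖ ad(e)ᵏ(D e) / (k + 1)!) * exp e`.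
  have hZ : toConv (locSum f hf) * toConv LinearMap.id =
      convPostcomp (Algebra.ofId K A) δ.1 * toConv LinearMap.id := by
    ext a
    obtain ⟨n₁, h₁⟩ := exists_convMul_locSum_apply f g hf hg a
    obtain ⟨n₂, h₂⟩ := hU.exists_apply_eq_zero (S := A) a
    obtain ⟨n₃, -, h₃⟩ := exists_sum_eulerian_pow hU a
    let m := max n₁ (max n₂ n₃)
    have e1 : (convPostcomp (Algebra.ofId K A) δ.1 * toConv LinearMap.id).ofConv a =
        invariantDerivation δ a := by
      rw [LinearMap.convMul_apply]
      simp only [contract, LinearMap.comp_apply]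
      generalize Coalgebra.comul (R := K) a = t
      induction t with
      | zero => simp
      | add x y hx hy => simp only [map_add, hx, hy]
      | tmul a b => simp [convPostcomp_apply, Algebra.ofId_apply, Algebra.smul_def]
    rw [e1, ← hid, h₁ m (le_max_left _ _)]
    conv_rhs => rw [h₃ (m + 1) (by omega), map_sum]
    have e2 : ∀ n, invariantDerivation δ ((n.factorial : K)⁻¹ • (eulerian hU ^ n).ofConv a) =
        ∑ k ∈ Finset.range n, (toConv (f k) * toConv (g (n - 1 - k))).ofConv a := by
      intro n
      have h := congrArg (fun x : WithConv (A →ₗ[K] A) => x.ofConv a) (comp_eulerian_pow hU δ n)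
      change invariantDerivation δ ((eulerian hU ^ n).ofConv a) = _ at h
      rw [map_smul, h, ofConv_sum, LinearMap.sum_apply, Finset.smul_sum]
      refine Finset.sum_congr rfl fun k hk => ?_
      change (n.factorial : K)⁻¹ • (n.choose (k + 1) •
        (z k * eulerian hU ^ (n - 1 - k)).ofConv a) = _
      rw [inv_factorial_smul_choose (Finset.mem_range.1 hk)]
      simp only [f, g, toConv_smul, toConv_ofConv, smul_mul_assoc, mul_smul_comm, ofConv_smul,
        LinearMap.smul_apply]
      rw [smul_comm]
    rw [Finset.sum_congr rfl fun n _ => e2 n]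
    refine (sum_range_sum_range_eq (fun k j => (toConv (f k) * toConv (g j)).ofConv a) m
      fun k j hkj => ?_).symm
    have h4 : z k * eulerian hU ^ j ∈ augmentation K A A ^ (k + 1 + j) := by
      rw [pow_add]
      exact Submodule.mul_mem_mul (adIter_mem_augmentation_pow hU δ k) (Submodule.pow_mem_pow _
        (apply_one_of_mem_groupLie (eulerian_mem_groupLie hU)) j)
    have h5 := h₂ (k + 1 + j) (by omega) _ h4
    simp only [f, g, toConv_smul, toConv_ofConv, smul_mul_assoc, mul_smul_comm, ofConv_smul,
        LinearMap.smul_apply, h5, smul_zero]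
  -- The identity is invertible for the convolution product.
  have hZ' : toConv (locSum f hf) = convPostcomp (Algebra.ofId K A) δ.1 := by
    have h := congrArg (· * toConv (HopfAlgebra.antipode K (A := A))) hZ
    simpa only [mul_assoc, LinearMap.id_mul_antipode, mul_one] using h
  obtain ⟨n, hn⟩ := hf a
  refine ⟨n, fun m hm => ?_⟩
  have h := congrArg (fun x : WithConv (A →ₗ[K] A) => x.ofConv a) hZ'
  change locSum f hf a = algebraMap K A (δ.1.ofConv a) at h
  rw [← h, locSum_apply f hf a m fun i hi => hn i (hm.trans hi)]
  rfl

end DerivativeOfExponential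

/-! ### The orbit map -/

namespace LieCocycle

open WithConv

section Derivation

variable {K A B R : Type u} [Field K] [CommRing A] [HopfAlgebra K A] [CommRing B] [HopfAlgebra K B]
  [CommRing R] [Algebra K R] {α : GroupSchemeAction K A B} (θ : LieCocycle α R)
  {S : Type u} [CommRing S] [Algebra K S] (φ : R →ₐ[K] S)

theorem rTensor_smul_of_derivation {V : Type u} [AddCommGroup V] [Module K V] (D : S →ₗ[K] S)
    (hD : ∀ a b, D (a * b) = a * D b + D a * b) (s : S) (v : S ⊗[K] V) :
    D.rTensor V (s • v) = s • D.rTensor V v + D s • v := by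
  induction v with
  | zero => simp
  | add x y hx hy => simp only [map_add, smul_add, hx, hy]; abel
  | tmul a b => simp [TensorProduct.smul_tmul', hD, TensorProduct.add_tmul]

theorem extend_comp_derivation (D : S →ₗ[K] S) (hD : ∀ a b, D (a * b) = a * D b + D a * b)
    (hDφ : ∀ r, D (φ r) = 0) (X : WithConv (A →ₗ[K] S)) :
    θ.extend φ (toConv (D ∘ₗ X.ofConv)) = toConv (D ∘ₗ (θ.extend φ X).ofConv) := by
  ext b
  simp only [extend_apply, ofConv_sum, LinearMap.comp_apply, LinearMap.sum_apply, ofConv_smul,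
    LinearMap.smul_apply, convPostcomp_apply, smul_eq_mul, map_sum, hD, hDφ, mul_zero, zero_add]

/-- Differentiating the coefficients of the vector field of `X` differentiates `X`. -/
theorem rTensor_vectorField (D : S →ₗ[K] S) (hD : ∀ a b, D (a * b) = a * D b + D a * b)
    (hDφ : ∀ r, D (φ r) = 0) (X : WithConv (A →ₗ[K] S)) (v : S ⊗[K] B) :
    D.rTensor B (θ.vectorField φ X v) =
      θ.vectorField φ (toConv (D ∘ₗ X.ofConv)) v + θ.vectorField φ X (D.rTensor B v) := by
  induction v with
  | zero => simp
  | add x y hx hy => simp only [map_add, hx, hy]; abel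
  | tmul s b =>
    have h1 : ∀ s : S, s ⊗ₜ[K] b = s • ((1 : S) ⊗ₜ[K] b) := fun s => by
      simp [TensorProduct.smul_tmul']
    rw [LinearMap.rTensor_tmul, h1 s, h1 (D s), LinearMap.map_smul (θ.vectorField φ X),
      LinearMap.map_smul (θ.vectorField φ X), LinearMap.map_smul (θ.vectorField φ (toConv _)),
      rTensor_smul_of_derivation D hD, vectorField_one_tmul, vectorField_one_tmul, map_add,
      θ.extend_comp_derivation φ D hD hDφ, LinearMap.rTensor_comp_apply,
      LinearMap.rTensor_comp_apply]

variable (K B S) in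
/-- Evaluation of a function on `Π_S` at the identity of `Π`. -/
noncomputable def evalOne : S ⊗[K] B →ₗ[S] S :=
  (TensorProduct.AlgebraTensorModule.rid K S S).toLinearMap ∘ₗ
    (Coalgebra.counit (R := K) (A := B)).baseChange S

theorem evalOne_tmul (s : S) (b : B) :
    evalOne K B S (s ⊗ₜ b) = Coalgebra.counit (R := K) b • s := by
  simp [evalOne]

theorem evalOne_rTensor (D : S →ₗ[K] S) (v : S ⊗[K] B) :
    evalOne K B S (D.rTensor B v) = D (evalOne K B S v) := by
  induction v with
  | zero => simp
  | add x y hx hy => simp only [map_add, hx, hy]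
  | tmul s b => simp [evalOne_tmul]

theorem evalOne_vectorField_tmul {X : WithConv (A →ₗ[K] S)} (hX : X ∈ groupLie K A S) (s : S)
    (b : B) : evalOne K B S (θ.vectorField φ X (s ⊗ₜ b)) = s * (θ.extend φ X).ofConv b := by
  have h1 : s ⊗ₜ[K] b = s • ((1 : S) ⊗ₜ[K] b) := by simp [TensorProduct.smul_tmul']
  have h2 : ∀ (Y : WithConv (B →ₗ[K] S)) (t : B ⊗[K] B), evalOne K B S (Y.ofConv.rTensor B t) =
      Y.ofConv (TensorProduct.rid K B ((Coalgebra.counit (R := K) (A := B)).lTensor B t)) := by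
    intro Y t
    induction t with
    | zero => simp
    | add x y hx hy => simp only [map_add, hx, hy]
    | tmul a b => simp [evalOne_tmul]
  have h3 : ∀ t : A ⊗[K] B, evalOne K B S (X.ofConv.rTensor B t) =
      X.ofConv (TensorProduct.rid K A ((Coalgebra.counit (R := K) (A := B)).lTensor A t)) := by
    intro t
    induction t with
    | zero => simp
    | add x y hx hy => simp only [map_add, hx, hy]
    | tmul a b => simp [evalOne_tmul]
  rw [h1, map_smul, map_smul, vectorField_one_tmul, map_add, h2, h3, α.coact_counit,
    Coalgebra.lTensor_counit_comul, Algebra.algebraMap_eq_smul_one, map_smul,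
    apply_one_of_mem_groupLie hX]
  simp

theorem eq_zero_of_mem_jointFiltration_zero {S : Type u} [CommRing S] [Algebra K S]
    {v : S ⊗[K] B} (hv : v ∈ (α.jointFiltration 0).baseChange S) : v = 0 := by
  have h : α.jointFiltration 0 = ⊥ := rfl
  rw [h, Submodule.baseChange_bot] at hv
  exact hv

theorem exists_mem_jointFiltration_baseChange (hU : IsProUnipotent K A) (hP : IsProUnipotent K B)
    {S : Type u} [CommRing S] [Algebra K S]
    (v : S ⊗[K] B) : ∃ n, v ∈ (α.jointFiltration n).baseChange S := by
  refine exists_mem_baseChange_of_mem_iSup α.jointFiltration_mono ?_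
  have h : ⨆ n, α.jointFiltration n = ⊤ := by
    rw [eq_top_iff]
    intro b _
    exact (Submodule.mem_iSup_of_directed _ α.jointFiltration_mono.directed_le).2
      (α.exists_mem_jointFiltration hU hP b)
  rw [h, Submodule.baseChange_top]
  trivial

end Derivation

section Solution

variable {K A B R : Type u} [Field K] [CommRing A] [HopfAlgebra K A] [CommRing B]
  [HopfAlgebra K B] [CommRing R] [Algebra K R] {α : GroupSchemeAction K A B}
  (θ : LieCocycle α R) (hU : IsProUnipotent K A)

/-- The vector field on `Π` over `R ⊗ O(U)` attached to the logarithm of the universal point of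
`U`. -/
noncomputable def logField : Module.End (R ⊗[K] A) ((R ⊗[K] A) ⊗[K] B) :=
  θ.vectorField Algebra.TensorProduct.includeLeft
    (convPostcomp Algebra.TensorProduct.includeRight (eulerian hU))

/-- The terms of the exponential series of `logField`, evaluated at the identity of `Π`. -/
noncomputable def expTerm (m : ℕ) : (R ⊗[K] A) ⊗[K] B →ₗ[K] R ⊗[K] A :=
  (m.factorial : K)⁻¹ • (evalOne K B (R ⊗[K] A) ∘ₗ θ.logField hU ^ m).restrictScalars K

theorem expTerm_apply (m : ℕ) (v : (R ⊗[K] A) ⊗[K] B) : θ.expTerm hU m v =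
    (m.factorial : K)⁻¹ • evalOne K B (R ⊗[K] A) ((θ.logField hU ^ m) v) := rfl

variable [CharZero K]

/-- The logarithm of the universal point vanishes at the identity, where `g ^ t = 1` for all `t`. -/
theorem counit_eulerian (a : A) : Coalgebra.counit (R := K) ((eulerian hU).ofConv a) = 0 := by
  open Polynomial in
  let f : A →+* A := (algebraMap K A).comp (Bialgebra.counitAlgHom K A).toRingHom
  have hf : ∀ a, f a = algebraMap K A (Coalgebra.counit a) := fun a => rfl
  have hpow : ∀ n : ℕ, ∀ a, Coalgebra.counit (R := K)
      (((toConv LinearMap.id : WithConv (A →ₗ[K] A)) ^ n).ofConv a) = Coalgebra.counit a := by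
    intro n a
    have h : convPostcomp (Bialgebra.counitAlgHom K A)
        (toConv LinearMap.id : WithConv (A →ₗ[K] A)) = 1 := by ext a; rfl
    have h' := map_pow (convPostcomp (Bialgebra.counitAlgHom K A))
        (toConv LinearMap.id : WithConv (A →ₗ[K] A)) n
    rw [h, one_pow] at h'
    exact congrArg (fun x : WithConv (A →ₗ[K] K) => x.ofConv a) h'
  have h : (genericPower hU a).map f - C (algebraMap K A (Coalgebra.counit a)) = 0 := by
    refine polynomial_eq_zero_of_forall_eval_natCast (K := K) _ fun n => ?_
    have h1 : eval (n : A) ((genericPower hU a).map f) = f (eval (n : A) (genericPower hU a)) := by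
      rw [← eval_map_apply, map_natCast]
    rw [eval_sub, eval_C, h1, eval_genericPower, hf, hpow, sub_self]
  have h1 := congrArg (fun q => q.coeff 1) h
  simp only [coeff_sub, coeff_map, coeff_C_succ, sub_zero, coeff_zero, hf] at h1
  have h2 := congrArg (Coalgebra.counit (R := K)) h1
  change Coalgebra.counit ((genericPower hU a).coeff 1) = 0
  simpa using h2

theorem log_mem : convPostcomp (Algebra.TensorProduct.includeRight : A →ₐ[K] R ⊗[K] A)
    (eulerian hU) ∈ groupLie K A (R ⊗[K] A) :=
  comp_mem_groupLie (eulerian_mem_groupLie hU) _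

theorem logField_pow_apply_mem (n m : ℕ) {v : (R ⊗[K] A) ⊗[K] B}
    (hv : v ∈ (α.jointFiltration (n + m)).baseChange (R ⊗[K] A)) :
    (θ.logField hU ^ m) v ∈ (α.jointFiltration n).baseChange (R ⊗[K] A) := by
  induction m generalizing v with
  | zero => simpa using hv
  | succ m ih =>
    rw [pow_succ, Module.End.mul_apply]
    exact ih (θ.vectorField_mem _ (log_mem hU) _ hv)

variable (hP : IsProUnipotent K B)

theorem logField_pow_apply_eq_zero {n m : ℕ} (hnm : n ≤ m) {v : (R ⊗[K] A) ⊗[K] B}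
    (hv : v ∈ (α.jointFiltration n).baseChange (R ⊗[K] A)) : (θ.logField hU ^ m) v = 0 := by
  refine eq_zero_of_mem_jointFiltration_zero (θ.logField_pow_apply_mem hU 0 m ?_)
  rw [zero_add]
  exact Submodule.baseChange_mono_of_le (α.jointFiltration_mono hnm) hv

theorem exists_expTerm_eq_zero (hP : IsProUnipotent K B) (v : (R ⊗[K] A) ⊗[K] B) :
    ∃ n, ∀ m ≥ n, θ.expTerm hU m v = 0 := by
  obtain ⟨n, hn⟩ := exists_mem_jointFiltration_baseChange (α := α) hU hP v
  exact ⟨n, fun m hm => by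
    rw [expTerm_apply, θ.logField_pow_apply_eq_zero hU hm hn, map_zero, smul_zero]⟩

/-- Pullback of functions on `Π` along the orbit map `g ↦ exp(θ(log g) + log g) • 1` of the
universal point `g` of `U`. -/
noncomputable def orbitPullback : (R ⊗[K] A) ⊗[K] B →ₗ[K] R ⊗[K] A :=
  locSum (θ.expTerm hU) (θ.exists_expTerm_eq_zero hU hP)

theorem exists_orbitPullback_eq_sum (v : (R ⊗[K] A) ⊗[K] B) :
    ∃ n, ∀ m ≥ n, θ.orbitPullback hU hP v = ∑ k ∈ Finset.range m, θ.expTerm hU k v := by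
  obtain ⟨n, hn⟩ := θ.exists_expTerm_eq_zero hU hP v
  exact ⟨n, fun m hm => locSum_apply _ _ v m fun k hk => hn k (hm.trans hk)⟩

theorem orbitPullback_smul (s : R ⊗[K] A) (v : (R ⊗[K] A) ⊗[K] B) :
    θ.orbitPullback hU hP (s • v) = s * θ.orbitPullback hU hP v := by
  obtain ⟨n, hn⟩ := θ.exists_orbitPullback_eq_sum hU hP v
  obtain ⟨m, hm⟩ := θ.exists_orbitPullback_eq_sum hU hP (s • v)
  rw [hn _ (le_max_left n m), hm _ (le_max_right n m), Finset.mul_sum]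
  refine Finset.sum_congr rfl fun k _ => ?_
  rw [expTerm_apply, expTerm_apply, map_smul, map_smul, smul_eq_mul, mul_smul_comm]

/-- The derivative in the direction `δ` of the powers of `logField`, applied to a function with
constant coefficients. -/
theorem rTensor_logField_pow (δ : groupLie K A K) (n : ℕ) (b : B) :
    (invariantDerivationBaseChange R δ).rTensor B ((θ.logField hU ^ n) (1 ⊗ₜ b)) =
      ∑ k ∈ Finset.range n, n.choose (k + 1) • (θ.logField hU ^ (n - 1 - k))
        (θ.vectorField Algebra.TensorProduct.includeLeft
          (convPostcomp Algebra.TensorProduct.includeRight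
            (adIter (eulerian hU) (eulerianDeriv hU δ) k)) (1 ⊗ₜ b)) := by
  let D := invariantDerivationBaseChange R δ
  let incl : R →ₐ[K] R ⊗[K] A := Algebra.TensorProduct.includeLeft
  let incr : A →ₐ[K] R ⊗[K] A := Algebra.TensorProduct.includeRight
  let res : Module.End (R ⊗[K] A) ((R ⊗[K] A) ⊗[K] B) → Module.End K ((R ⊗[K] A) ⊗[K] B) :=
    fun f => f.restrictScalars K
  let N := res (θ.logField hU)
  let z : ℕ → Module.End K ((R ⊗[K] A) ⊗[K] B) := fun k =>
    res (θ.vectorField incl (convPostcomp incr (adIter (eulerian hU) (eulerianDeriv hU δ) k)))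
  let E : Module.End K ((R ⊗[K] A) ⊗[K] B) := D.rTensor B
  have hN : ∀ n v, (N ^ n) v = (θ.logField hU ^ n) v := by
    intro n
    induction n with
    | zero => intro v; rfl
    | succ n ih => intro v; rw [pow_succ, pow_succ, Module.End.mul_apply, ih]; rfl
  have hz : ∀ k, z (k + 1) = z k * N - N * z k := by
    intro k
    refine LinearMap.ext fun v => ?_
    have h := θ.vectorField_lie incl (log_mem (R := R) hU)
      (comp_mem_groupLie (adIter_mem hU δ k) incr.toLinearMap)
    have h1 : convPostcomp incr (adIter (eulerian hU) (eulerianDeriv hU δ) (k + 1)) =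
        convPostcomp incr (eulerian hU) *
          convPostcomp incr (adIter (eulerian hU) (eulerianDeriv hU δ) k) -
        convPostcomp incr (adIter (eulerian hU) (eulerianDeriv hU δ) k) *
          convPostcomp incr (eulerian hU) := by
      rw [adIter, map_sub, map_mul, map_mul]
    change θ.vectorField incl (convPostcomp incr _) v = _
    rw [h1]
    exact LinearMap.congr_fun h v
  have hE : E * N - N * E = z 0 := by
    refine LinearMap.ext fun v => ?_
    have h := θ.rTensor_vectorField incl D (invariantDerivationBaseChange_mul δ)
      (invariantDerivationBaseChange_includeLeft δ) (convPostcomp incr (eulerian hU)) v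
    have h1 : toConv (D ∘ₗ (convPostcomp incr (eulerian hU)).ofConv) =
        convPostcomp incr (eulerianDeriv hU δ) := by
      ext a
      simp [D, incr, convPostcomp_apply, eulerianDeriv]
    rw [h1] at h
    change D.rTensor B (θ.vectorField incl (convPostcomp incr (eulerian hU)) v) -
      θ.vectorField incl (convPostcomp incr (eulerian hU)) (D.rTensor B v) =
      θ.vectorField incl (convPostcomp incr (eulerianDeriv hU δ)) v
    rw [h, add_sub_cancel_right]
  have key := mul_pow_sub_pow_mul_eq_sum N E z hz hE n
  have h := LinearMap.congr_fun key ((1 : R ⊗[K] A) ⊗ₜ[K] b)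
  have h0 : E ((1 : R ⊗[K] A) ⊗ₜ[K] b) = 0 := by
    have : D 1 = 0 := by
      have := invariantDerivationBaseChange_mul δ (1 : R ⊗[K] A) 1
      simpa using this
    simp [E, this]
  rw [LinearMap.sub_apply, Module.End.mul_apply, Module.End.mul_apply, h0, map_zero, sub_zero,
    hN, LinearMap.sum_apply] at h
  refine h.trans (Finset.sum_congr rfl fun k _ => ?_)
  change n.choose (k + 1) • ((N ^ (n - 1 - k)) (z k ((1 : R ⊗[K] A) ⊗ₜ[K] b))) = _
  rw [hN]
  rfl

theorem vectorField_mem_of_adIter (δ : groupLie K A K) (k n : ℕ) {v : (R ⊗[K] A) ⊗[K] B}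
    (hv : v ∈ (α.jointFiltration (n + (k + 1))).baseChange (R ⊗[K] A)) :
    θ.vectorField Algebra.TensorProduct.includeLeft
      (convPostcomp Algebra.TensorProduct.includeRight
        (adIter (eulerian hU) (eulerianDeriv hU δ) k)) v ∈
      (α.jointFiltration n).baseChange (R ⊗[K] A) := by
  induction k generalizing n v with
  | zero =>
    exact θ.vectorField_mem _ (comp_mem_groupLie (eulerianDeriv_mem hU δ) _) n hv
  | succ k ih =>
    have h := θ.vectorField_lie (Algebra.TensorProduct.includeLeft : R →ₐ[K] R ⊗[K] A)
      (log_mem (R := R) hU) (comp_mem_groupLie (adIter_mem hU δ k)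
        (Algebra.TensorProduct.includeRight : A →ₐ[K] R ⊗[K] A).toLinearMap)
    rw [adIter, map_sub, map_mul, map_mul]
    refine (LinearMap.congr_fun h v).symm ▸ ?_
    refine Submodule.sub_mem _ ?_ ?_
    · exact ih n (θ.vectorField_mem _ (log_mem hU) _ hv)
    · refine θ.vectorField_mem _ (log_mem hU) n (ih (n + 1) ?_)
      rwa [add_right_comm]

/-- The differential equation satisfied by the orbit map. -/
theorem derivation_orbitPullback (δ : groupLie K A K) (b : B) :
    invariantDerivationBaseChange R δ (θ.orbitPullback hU hP (1 ⊗ₜ b)) =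
      θ.orbitPullback hU hP (θ.vectorField Algebra.TensorProduct.includeLeft
        (convPostcomp (Algebra.ofId K (R ⊗[K] A)) δ.1) (1 ⊗ₜ b)) := by
  let incl : R →ₐ[K] R ⊗[K] A := Algebra.TensorProduct.includeLeft
  let incr : A →ₐ[K] R ⊗[K] A := Algebra.TensorProduct.includeRight
  let Z : ℕ → WithConv (A →ₗ[K] R ⊗[K] A) := fun k =>
    convPostcomp incr (adIter (eulerian hU) (eulerianDeriv hU δ) k)
  let w := θ.vectorField incl (convPostcomp (Algebra.ofId K (R ⊗[K] A)) δ.1) (1 ⊗ₜ b)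
  -- The vector field of `δ` is the sum of those of `ad(e)ᵏ(D e) / (k + 1)!`.
  have hw : ∃ n, ∀ m ≥ n, w = ∑ k ∈ Finset.range m,
      ((k + 1).factorial : K)⁻¹ • θ.vectorField incl (Z k) (1 ⊗ₜ b) := by
    obtain ⟨F, hF⟩ := θ.exists_finset_vectorField incl ((1 : R ⊗[K] A) ⊗ₜ[K] b)
    choose n hn using exists_sum_adIter hU δ
    refine ⟨F.sup n, fun m hm => ?_⟩
    have h := hF (convPostcomp (Algebra.ofId K (R ⊗[K] A)) δ.1 -
      ∑ k ∈ Finset.range m, ((k + 1).factorial : K)⁻¹ • Z k) fun a ha => by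
        have h1 := congrArg incr (hn a m ((Finset.le_sup ha).trans hm))
        rw [map_sum, AlgHom.commutes] at h1
        rw [ofConv_sub, LinearMap.sub_apply, sub_eq_zero, ofConv_sum, LinearMap.sum_apply]
        refine h1.symm.trans (Finset.sum_congr rfl fun k _ => ?_)
        rw [map_smul]
        rfl
    rw [map_sub, LinearMap.sub_apply, sub_eq_zero, map_sum, LinearMap.sum_apply] at h
    refine h.trans (Finset.sum_congr rfl fun k _ => ?_)
    have h2 : (((k + 1).factorial : K)⁻¹) • Z k =
        algebraMap K (R ⊗[K] A) (((k + 1).factorial : K)⁻¹) • Z k := by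
      ext a
      exact (algebraMap_smul (R ⊗[K] A) (((k + 1).factorial : K)⁻¹) ((Z k).ofConv a)).symm
    rw [h2, map_smul, LinearMap.smul_apply, algebraMap_smul]
  obtain ⟨n₁, h₁⟩ := θ.exists_orbitPullback_eq_sum hU hP ((1 : R ⊗[K] A) ⊗ₜ[K] b)
  obtain ⟨n₂, h₂⟩ := θ.exists_orbitPullback_eq_sum hU hP w
  obtain ⟨n₃, h₃⟩ := hw
  obtain ⟨n₄, h₄⟩ := exists_mem_jointFiltration_baseChange (α := α) hU hP
    ((1 : R ⊗[K] A) ⊗ₜ[K] b)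
  let m := max (max n₁ n₂) (max n₃ n₄)
  change _ = θ.orbitPullback hU hP w
  rw [h₁ (m + 1) (by omega), h₂ m (by omega), map_sum]
  have e1 : ∀ n, invariantDerivationBaseChange R δ (θ.expTerm hU n (1 ⊗ₜ b)) =
      ∑ k ∈ Finset.range n, ((k + 1).factorial : K)⁻¹ •
        θ.expTerm hU (n - 1 - k) (θ.vectorField incl (Z k) (1 ⊗ₜ b)) := by
    intro n
    rw [expTerm_apply, map_smul, ← evalOne_rTensor, rTensor_logField_pow, map_sum, Finset.smul_sum]
    refine Finset.sum_congr rfl fun k hk => ?_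
    rw [map_nsmul, inv_factorial_smul_choose (Finset.mem_range.1 hk)]
    rfl
  rw [Finset.sum_congr rfl fun n _ => e1 n, sum_range_sum_range_eq (fun k j =>
    ((k + 1).factorial : K)⁻¹ • θ.expTerm hU j (θ.vectorField incl (Z k) (1 ⊗ₜ b))) m
    fun k j hkj => ?_]
  · rw [Finset.sum_comm]
    refine Finset.sum_congr rfl fun j _ => ?_
    conv_rhs => rw [h₃ m (by omega), map_sum]
    refine Finset.sum_congr rfl fun k _ => ?_
    rw [map_smul]
  · have h5 := Submodule.baseChange_mono_of_le (S := R ⊗[K] A)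
      (α.jointFiltration_mono (show n₄ ≤ j + (k + 1) by omega)) h₄
    rw [expTerm_apply, θ.logField_pow_apply_eq_zero hU le_rfl
      (θ.vectorField_mem_of_adIter hU δ k j h5), map_zero, smul_zero, smul_zero]

/-- The value of the orbit map at the identity of `U` is the identity of `Π`. -/
theorem counit_orbitPullback (b : B) :
    (Coalgebra.counit (R := K) (A := A)).lTensor R (θ.orbitPullback hU hP (1 ⊗ₜ b)) =
      Coalgebra.counit (R := K) b • (1 : R ⊗[K] K) := by
  let η : R ⊗[K] A →ₐ[K] R ⊗[K] K :=
    Algebra.TensorProduct.map (AlgHom.id K R) (Bialgebra.counitAlgHom K A)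
  have hη : ∀ x, (Coalgebra.counit (R := K) (A := A)).lTensor R x = η x := by
    intro x
    induction x with
    | zero => simp
    | add x y hx hy => simp only [map_add, hx, hy]
    | tmul r a => simp [η]
  -- `θ(log g)` vanishes at `g = 1`, so only the constant term of the exponential contributes.
  have h0 : ∀ b, η ((θ.extend Algebra.TensorProduct.includeLeft
      (convPostcomp Algebra.TensorProduct.includeRight (eulerian hU))).ofConv b) = 0 := by
    intro b
    rw [extend_apply, ofConv_sum, LinearMap.sum_apply, map_sum]
    refine Finset.sum_eq_zero fun a _ => ?_
    rw [ofConv_smul, LinearMap.smul_apply, smul_eq_mul, map_mul, convPostcomp_apply]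
    simp [η, counit_eulerian]
  have h1 : ∀ v, η (evalOne K B (R ⊗[K] A) (θ.logField hU v)) = 0 := by
    intro v
    induction v with
    | zero => simp
    | add x y hx hy => simp only [map_add, hx, hy, add_zero]
    | tmul s b =>
      rw [logField, θ.evalOne_vectorField_tmul _ (log_mem hU), map_mul, h0, mul_zero]
  obtain ⟨n, hn⟩ := θ.exists_orbitPullback_eq_sum hU hP ((1 : R ⊗[K] A) ⊗ₜ[K] b)
  rw [hη, hn (n + 1) (Nat.le_succ n), Finset.sum_range_succ', map_add, map_sum,
    Finset.sum_eq_zero, zero_add]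
  · simp [expTerm_apply, evalOne_tmul]
  · intro k _
    rw [expTerm_apply, map_smul, pow_succ', Module.End.mul_apply, h1, smul_zero]

end Solution

end LieCocycle

/-! ### The differential equation of a cocycle -/

section Equation

open WithConv

variable {K A B R : Type u} [Field K] [CommRing A] [HopfAlgebra K A] [CommRing B]
  [HopfAlgebra K B] [CommRing R] [Algebra K R]

/-- The derivation `b ↦ (δ ⊗ id) (coact b)` of `O(Π)` by which `δ ∈ Lie U` acts. -/
noncomputable abbrev GroupSchemeAction.infinitesimalAct (α : GroupSchemeAction K A B)
    (δ : groupLie K A K) : B →ₗ[K] B := contract α.coact.toLinearMap δ.1.ofConv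

theorem GroupSchemeAction.infinitesimalAct_mul (α : GroupSchemeAction K A B) (δ : groupLie K A K)
    (a b : B) : α.infinitesimalAct δ (a * b) =
      a * α.infinitesimalAct δ b + α.infinitesimalAct δ a * b :=
  contract_mul_of_mem_groupLie α.coact α.counit_coact δ a b

theorem GroupSchemeAction.infinitesimalAct_one (α : GroupSchemeAction K A B)
    (δ : groupLie K A K) : α.infinitesimalAct δ 1 = 0 :=
  contract_algebraMap_of_mem_groupLie α.coact α.counit_coact δ

theorem GroupSchemeAction.counit_infinitesimalAct (α : GroupSchemeAction K A B)
    (δ : groupLie K A K) (b : B) : Coalgebra.counit (R := K) (α.infinitesimalAct δ b) = 0 := by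
  have h : ∀ t : A ⊗[K] B,
      Coalgebra.counit (R := K) (TensorProduct.lid K B (δ.1.ofConv.rTensor B t)) =
        δ.1.ofConv (TensorProduct.rid K A ((Coalgebra.counit (R := K) (A := B)).lTensor A t)) := by
    intro t
    induction t with
    | zero => simp
    | add x y hx hy => simp only [map_add, hx, hy]
    | tmul a b => simp [mul_comm]
  refine (h _).trans ?_
  change δ.1.ofConv (TensorProduct.rid K A
    ((Coalgebra.counit (R := K) (A := B)).lTensor A (α.coact b))) = 0
  rw [α.coact_counit, Algebra.algebraMap_eq_smul_one, map_smul, apply_one_of_mem_groupLie δ.2,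
    smul_zero]

/-- The differential equation satisfied by a cocycle `c : U_R → Π_R` with differential `t`: it is
the derivative of `c_{gh} = c_g * g(c_h)` with respect to `g` at the identity. It is stated for
linear maps `O(Π) → R ⊗ O(U)`. -/
def IsCocycleSolution (α : GroupSchemeAction K A B)
    (t : groupLie K A K → WithConv (B →ₗ[K] R)) (c : WithConv (B →ₗ[K] R ⊗[K] A)) : Prop :=
  ∀ δ, toConv (invariantDerivationBaseChange R δ ∘ₗ c.ofConv) =
    convPostcomp Algebra.TensorProduct.includeLeft (t δ) * c +
      toConv (c.ofConv ∘ₗ α.infinitesimalAct δ)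

variable (K A R) in
/-- Evaluation of functions on `U_R` at the identity. -/
noncomputable def evalIdentity : R ⊗[K] A →ₐ[K] R :=
  Algebra.TensorProduct.lift (AlgHom.id K R)
    ((Algebra.ofId K R).comp (Bialgebra.counitAlgHom K A)) fun _ _ => .all _ _

theorem evalIdentity_tmul (r : R) (a : A) :
    evalIdentity K A R (r ⊗ₜ a) = Coalgebra.counit (R := K) a • r := by
  simp [evalIdentity, Algebra.ofId_apply, Algebra.smul_def, mul_comm]

theorem evalIdentity_apply (x : R ⊗[K] A) : evalIdentity K A R x =
    TensorProduct.rid K R ((Coalgebra.counit (R := K) (A := A)).lTensor R x) := by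
  induction x with
  | zero => simp
  | add x y hx hy => simp only [map_add, hx, hy]
  | tmul r a => simp [evalIdentity_tmul]

theorem evalIdentity_smul (r : R) (x : R ⊗[K] A) :
    evalIdentity K A R (r • x) = r * evalIdentity K A R x := by
  induction x with
  | zero => simp
  | add x y hx hy => simp only [map_add, smul_add, mul_add, hx, hy]
  | tmul s a => simp [evalIdentity_tmul, TensorProduct.smul_tmul']

theorem invariantDerivationBaseChange_smul (δ : groupLie K A K) (r : R) (x : R ⊗[K] A) :
    invariantDerivationBaseChange R δ (r • x) = r • invariantDerivationBaseChange R δ x := by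
  induction x with
  | zero => simp
  | add x y hx hy => simp only [map_add, smul_add, hx, hy]
  | tmul s a => simp [TensorProduct.smul_tmul']

theorem evalIdentity_invariantDerivationBaseChange (δ : groupLie K A K) (x : R ⊗[K] A) :
    evalIdentity K A R (invariantDerivationBaseChange R δ x) =
      TensorProduct.rid K R (δ.1.ofConv.lTensor R x) := by
  have h : ∀ t : A ⊗[K] A,
      Coalgebra.counit (R := K) (TensorProduct.lid K A (δ.1.ofConv.rTensor A t)) =
        δ.1.ofConv (TensorProduct.rid K A ((Coalgebra.counit (R := K) (A := A)).lTensor A t)) := by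
    intro t
    induction t with
    | zero => simp
    | add x y hx hy => simp only [map_add, hx, hy]
    | tmul a b => simp [mul_comm]
  induction x with
  | zero => simp
  | add x y hx hy => simp only [map_add, hx, hy]
  | tmul r a =>
    rw [LinearMap.lTensor_tmul, evalIdentity_tmul, LinearMap.lTensor_tmul, TensorProduct.rid_tmul]
    refine congrArg (· • r) ((h _).trans ?_)
    rw [Coalgebra.lTensor_counit_comul]
    simp

theorem liftBaseChange_rTensor_comul (x : WithConv (B →ₗ[K] R)) (c : WithConv (B →ₗ[K] R ⊗[K] A))
    (b : B) : c.ofConv.liftBaseChange R (x.ofConv.rTensor B (Coalgebra.comul b)) =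
      (convPostcomp Algebra.TensorProduct.includeLeft x * c).ofConv b := by
  rw [LinearMap.convMul_apply]
  generalize Coalgebra.comul (R := K) b = t
  induction t with
  | zero => simp
  | add x y hx hy => simp only [map_add, hx, hy]
  | tmul a b =>
    simp [convPostcomp_apply, Algebra.smul_def]

variable {α : GroupSchemeAction K A B} {t : groupLie K A K → WithConv (B →ₗ[K] R)}

theorem IsCocycleSolution.apply {c : WithConv (B →ₗ[K] R ⊗[K] A)} (hc : IsCocycleSolution α t c)
    (δ : groupLie K A K) (b : B) : invariantDerivationBaseChange R δ (c.ofConv b) =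
      c.ofConv.liftBaseChange R ((t δ).ofConv.rTensor B (Coalgebra.comul b)) +
        c.ofConv (α.infinitesimalAct δ b) := by
  rw [liftBaseChange_rTensor_comul]
  exact congrArg (fun x => x.ofConv b) (hc δ)

variable [CharZero K]

/-- Linear maps `d : M → R ⊗ O(U)` that vanish at the identity and whose derivatives are
`R`-linear combinations of values of `d` are zero. -/
theorem eq_zero_of_derivation_mem_range (hU : IsProUnipotent K A) {M : Type u} [AddCommGroup M]
    [Module K M] (d : M →ₗ[K] R ⊗[K] A)
    (hd : ∀ δ m, invariantDerivationBaseChange R δ (d m) ∈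
      LinearMap.range (d.liftBaseChange R))
    (h0 : ∀ m, evalIdentity K A R (d m) = 0) : d = 0 := by
  have h := eq_zero_of_stable_of_counit_eq_zero (V := R) hU
    ((LinearMap.range (d.liftBaseChange R)).restrictScalars K) ?_ ?_
  · ext m
    exact h _ ⟨1 ⊗ₜ m, LinearMap.liftBaseChange_one_tmul _ _ _⟩
  · rintro δ _ ⟨x, rfl⟩
    change invariantDerivationBaseChange R δ _ ∈ LinearMap.range (d.liftBaseChange R)
    induction x with
    | zero => simp
    | add x y hx hy => rw [map_add, map_add]; exact Submodule.add_mem _ hx hy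
    | tmul r m =>
      rw [LinearMap.liftBaseChange_tmul, invariantDerivationBaseChange_smul]
      exact Submodule.smul_mem _ _ (hd δ m)
  · rintro _ ⟨x, rfl⟩
    apply (TensorProduct.rid K R).injective
    rw [← evalIdentity_apply, map_zero]
    induction x with
    | zero => simp
    | add x y hx hy => rw [map_add, map_add, hx, hy, add_zero]
    | tmul r m => rw [LinearMap.liftBaseChange_tmul, evalIdentity_smul, h0, mul_zero]

/-- A solution is determined by its value at the identity. -/
theorem IsCocycleSolution.eq_of_evalIdentity_eq {c c' : WithConv (B →ₗ[K] R ⊗[K] A)}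
    (hU : IsProUnipotent K A)
    (hc : IsCocycleSolution α t c) (hc' : IsCocycleSolution α t c')
    (h : ∀ b, evalIdentity K A R (c.ofConv b) = evalIdentity K A R (c'.ofConv b)) : c = c' := by
  have h1 : ∀ δ, toConv (invariantDerivationBaseChange R δ ∘ₗ (c - c').ofConv) =
      convPostcomp Algebra.TensorProduct.includeLeft (t δ) * (c - c') +
        toConv ((c - c').ofConv ∘ₗ α.infinitesimalAct δ) := by
    intro δ
    rw [ofConv_sub, LinearMap.comp_sub, LinearMap.sub_comp, toConv_sub, toConv_sub, hc δ, hc' δ,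
      mul_sub]
    abel
  have h2 : (c - c').ofConv = 0 := eq_zero_of_derivation_mem_range hU _ (fun δ b => by
    have := congrArg (fun x => x.ofConv b) (h1 δ)
    change invariantDerivationBaseChange R δ ((c - c').ofConv b) =
      (convPostcomp _ _ * (c - c')).ofConv b + (c - c').ofConv (α.infinitesimalAct δ b) at this
    rw [this, ← liftBaseChange_rTensor_comul]
    exact Submodule.add_mem _ ⟨_, rfl⟩
      ⟨1 ⊗ₜ α.infinitesimalAct δ b, LinearMap.liftBaseChange_one_tmul _ _ _⟩) fun b => by
    rw [ofConv_sub, LinearMap.sub_apply, map_sub, h, sub_self]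
  exact sub_eq_zero.1 (WithConv.ext h2)

theorem IsCocycleSolution.apply_one (hU : IsProUnipotent K A) (ht : ∀ δ, t δ ∈ groupLie K B R)
    {c : WithConv (B →ₗ[K] R ⊗[K] A)}
    (hc : IsCocycleSolution α t c) (h1 : evalIdentity K A R (c.ofConv 1) = 1) :
    c.ofConv 1 = 1 := by
  have h := eq_zero_of_derivation_mem_range (R := R) hU
    (LinearMap.toSpanSingleton K (R ⊗[K] A) (c.ofConv 1 - 1)) (fun δ k => ?_) fun k => ?_
  · have := LinearMap.congr_fun h 1
    simpa [sub_eq_zero] using this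
  · have h2 : invariantDerivationBaseChange R δ (1 : R ⊗[K] A) = 0 := by
      have := invariantDerivationBaseChange_mul δ (1 : R ⊗[K] A) 1
      simpa using this
    have h3 : (t δ).ofConv.rTensor B (Coalgebra.comul (1 : B)) = 0 := by
      rw [Bialgebra.comul_one, Algebra.TensorProduct.one_def, LinearMap.rTensor_tmul,
        apply_one_of_mem_groupLie (ht δ), TensorProduct.zero_tmul]
    rw [LinearMap.toSpanSingleton_apply, map_smul, map_sub, h2, hc.apply, h3,
      α.infinitesimalAct_one]
    simp
  · rw [LinearMap.toSpanSingleton_apply, map_smul, map_sub, h1, map_one, sub_self, smul_zero]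

/-- A solution that is multiplicative at the identity is multiplicative: the derivatives of
`c(b b') - c(b) c(b')` are linear combinations of such expressions. -/
theorem IsCocycleSolution.apply_mul (hU : IsProUnipotent K A) (ht : ∀ δ, t δ ∈ groupLie K B R)
    {c : WithConv (B →ₗ[K] R ⊗[K] A)} (hc : IsCocycleSolution α t c)
    (h1 : ∀ b b', evalIdentity K A R (c.ofConv (b * b')) =
      evalIdentity K A R (c.ofConv b) * evalIdentity K A R (c.ofConv b')) (b b' : B) :
    c.ofConv (b * b') = c.ofConv b * c.ofConv b' := by
  let d : B ⊗[K] B →ₗ[K] R ⊗[K] A := c.ofConv ∘ₗ LinearMap.mul' K B -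
    LinearMap.mul' K (R ⊗[K] A) ∘ₗ TensorProduct.map c.ofConv c.ofConv
  have hd : ∀ b b', d (b ⊗ₜ b') = c.ofConv (b * b') - c.ofConv b * c.ofConv b' := by
    intro b b'; simp [d]
  let L := c.ofConv.liftBaseChange R
  let N := LinearMap.range (d.liftBaseChange R)
  have hdN : ∀ b b', c.ofConv (b * b') - c.ofConv b * c.ofConv b' ∈ N := fun b b' =>
    ⟨1 ⊗ₜ (b ⊗ₜ b'), by rw [LinearMap.liftBaseChange_one_tmul, hd]⟩
  have hL : ∀ b (y : R ⊗[K] B), L (((1 : R) ⊗ₜ b) * y) - c.ofConv b * L y ∈ N := by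
    intro b y
    induction y with
    | zero => simp
    | add x y hx hy =>
      rw [mul_add, map_add, map_add, mul_add, add_sub_add_comm]
      exact Submodule.add_mem _ hx hy
    | tmul r b' =>
      rw [Algebra.TensorProduct.tmul_mul_tmul, one_mul, LinearMap.liftBaseChange_tmul,
        LinearMap.liftBaseChange_tmul, mul_smul_comm, ← smul_sub]
      exact Submodule.smul_mem _ _ (hdN b b')
  have h := eq_zero_of_derivation_mem_range (R := R) hU d (fun δ m => ?_) fun m => ?_
  · have := LinearMap.congr_fun h (b ⊗ₜ b')
    rw [hd] at this
    exact sub_eq_zero.1 this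
  · induction m with
    | zero => simp
    | add x y hx hy => rw [map_add, map_add]; exact Submodule.add_mem _ hx hy
    | tmul b b' =>
      rw [hd, map_sub, invariantDerivationBaseChange_mul, hc.apply, hc.apply, hc.apply,
        Bialgebra.comul_mul, rTensor_mul_of_mem_groupLie (ht δ), Coalgebra.rTensor_counit_comul,
        Coalgebra.rTensor_counit_comul, TensorProduct.lid_tmul, TensorProduct.lid_tmul, one_smul,
        one_smul, α.infinitesimalAct_mul]
      have e1 := hL b ((t δ).ofConv.rTensor B (Coalgebra.comul b'))
      have e2 := hL b' ((t δ).ofConv.rTensor B (Coalgebra.comul b))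
      rw [mul_comm] at e2
      have e3 := hdN b (α.infinitesimalAct δ b')
      have e4 := hdN (α.infinitesimalAct δ b) b'
      convert N.add_mem (N.add_mem e1 e2) (N.add_mem e3 e4) using 1
      simp only [L, map_add]
      ring
  · induction m with
    | zero => simp
    | add x y hx hy => rw [map_add, map_add, hx, hy, add_zero]
    | tmul b b' => rw [hd, map_sub, h1, map_mul, sub_self]

end Equation

/-! ### Points and substitution in the differential equation -/

section Points

open WithConv

variable {K H S S' : Type u} [Field K] [CommRing H] [HopfAlgebra K H] [CommRing S] [Algebra K S]
  [CommRing S'] [Algebra K S']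

/-- The group homomorphism `G(S) → G(S')` induced by `f : S → S'`. -/
noncomputable def GroupPoints.map (f : S →ₐ[K] S') : GroupPoints K H S →* GroupPoints K H S' where
  toFun p := toConv (f.comp p.ofConv)
  map_one' := by ext a; simp
  map_mul' p q := WithConv.ext (AlgHom.comp_convMul_distrib f p q)

/-- Every point is the image of the universal point, which has an inverse. -/
theorem GroupPoints.isUnit (p : GroupPoints K H S) : IsUnit p :=
  (Group.isUnit (toConv (AlgHom.id K H) : GroupPoints K H H)).map (GroupPoints.map p.ofConv)

variable {A B R : Type u} [CommRing A] [HopfAlgebra K A] [CommRing B]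
  [HopfAlgebra K B] [CommRing R] [Algebra K R]

theorem GroupPoints.map_evalPoint (f : S →ₐ[K] S') (c : B →ₐ[K] R ⊗[K] A) (φ : R →ₐ[K] S)
    (g : GroupPoints K A S) : GroupPoints.map f (evalPoint c φ g) =
      evalPoint c (f.comp φ) (GroupPoints.map f g) := by
  refine WithConv.ext (AlgHom.ext fun b => ?_)
  change f (Algebra.TensorProduct.lift φ g.ofConv (fun _ _ => .all _ _) (c b)) =
    Algebra.TensorProduct.lift (f.comp φ) (f.comp g.ofConv) (fun _ _ => .all _ _) (c b)
  induction c b with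
  | zero => simp
  | add x y hx hy => simp only [map_add, hx, hy]
  | tmul r a => simp

theorem GroupPoints.map_actPoint (f : S →ₐ[K] S') (α : B →ₐ[K] A ⊗[K] B)
    (g : GroupPoints K A S) (p : GroupPoints K B S) : GroupPoints.map f (actPoint α g p) =
      actPoint α (GroupPoints.map f g) (GroupPoints.map f p) := by
  refine WithConv.ext (AlgHom.ext fun b => ?_)
  change f (Algebra.TensorProduct.lift g.ofConv p.ofConv (fun _ _ => .all _ _) (α b)) =
    Algebra.TensorProduct.lift (f.comp g.ofConv) (f.comp p.ofConv) (fun _ _ => .all _ _) (α b)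
  induction α b with
  | zero => simp
  | add x y hx hy => simp only [map_add, hx, hy]
  | tmul r a => simp

/-- The linear map underlying an `S`-valued point. -/
abbrev GroupPoints.toLin (p : GroupPoints K H S) : WithConv (H →ₗ[K] S) :=
  toConv p.ofConv.toLinearMap

theorem comp_contract_comul (δ : WithConv (H →ₗ[K] K)) (f : WithConv (H →ₗ[K] S)) :
    toConv (f.ofConv ∘ₗ contract Coalgebra.comul δ.ofConv) =
      convPostcomp (Algebra.ofId K S) δ * f := by
  ext a
  rw [LinearMap.convMul_apply]
  change f.ofConv (TensorProduct.lid K H (δ.ofConv.rTensor H (Coalgebra.comul a))) = _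
  generalize Coalgebra.comul (R := K) a = t
  induction t with
  | zero => simp
  | add x y hx hy => simp only [map_add, hx, hy]
  | tmul a b => simp [convPostcomp_apply, Algebra.ofId_apply, ← Algebra.smul_def]

theorem convPostcomp_ofId_includeRight (δ : groupLie K A K) :
    toConv (invariantDerivationBaseChange S δ ∘ₗ
      (Algebra.TensorProduct.includeRight : A →ₐ[K] S ⊗[K] A).toLinearMap) =
      convPostcomp (Algebra.ofId K (S ⊗[K] A)) δ.1 *
        toConv (Algebra.TensorProduct.includeRight : A →ₐ[K] S ⊗[K] A).toLinearMap := by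
  rw [← comp_contract_comul]
  ext a
  simp

variable (K A S) in
/-- The universal point of `U_S`, with values in `S ⊗ O(U)`. -/
noncomputable def universalPoint :
    GroupPoints K A (S ⊗[K] A) := toConv Algebra.TensorProduct.includeRight

/-- Multiplying the universal point on the right with a constant point yields a point `γ` with
the same logarithmic derivative `dγ * γ⁻¹`. -/
theorem derivation_universalPoint_mul (δ : groupLie K A K) (h : GroupPoints K A S) :
    toConv (invariantDerivationBaseChange S δ ∘ₗ (universalPoint K S A *
      GroupPoints.map Algebra.TensorProduct.includeLeft h).ofConv.toLinearMap) =
      toConv ((universalPoint K S A *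
        GroupPoints.map Algebra.TensorProduct.includeLeft h).ofConv.toLinearMap ∘ₗ
        invariantDerivation δ) := by
  have h1 : GroupPoints.toLin (universalPoint K S A *
      GroupPoints.map Algebra.TensorProduct.includeLeft h) =
      GroupPoints.toLin (universalPoint K S A) *
        GroupPoints.toLin (GroupPoints.map Algebra.TensorProduct.includeLeft h) :=
    AlgHom.toLinearMap_convMul _ _
  have h2 : toConv (invariantDerivationBaseChange S δ ∘ₗ (GroupPoints.map (H := A)
      (Algebra.TensorProduct.includeLeft : S →ₐ[K] S ⊗[K] A) h).ofConv.toLinearMap) = 0 := by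
    ext a
    exact invariantDerivationBaseChange_includeLeft δ (h.ofConv a)
  refine Eq.trans ?_ (comp_contract_comul δ.1 (GroupPoints.toLin _)).symm
  change toConv (_ ∘ₗ (GroupPoints.toLin _).ofConv) = _
  rw [h1, comp_convMul_of_derivation _ (invariantDerivationBaseChange_mul δ), h2, mul_zero,
    zero_add, ← mul_assoc]
  congr 1
  exact convPostcomp_ofId_includeRight δ

variable {α : GroupSchemeAction K A B} {t : groupLie K A K → WithConv (B →ₗ[K] R)}

/-- The differential equation is preserved by substituting for the universal point of `U` any point
`γ` with the same logarithmic derivative `dγ * γ⁻¹`. -/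
theorem IsCocycleSolution.toLin_evalPoint {c : B →ₐ[K] R ⊗[K] A}
    (hc : IsCocycleSolution α t (toConv c.toLinearMap)) (φ : R →ₐ[K] S)
    (γ : GroupPoints K A (S ⊗[K] A))
    (hγ : ∀ δ : groupLie K A K,
      toConv (invariantDerivationBaseChange S δ ∘ₗ γ.ofConv.toLinearMap) =
        toConv (γ.ofConv.toLinearMap ∘ₗ invariantDerivation δ)) :
    IsCocycleSolution α (fun δ => convPostcomp φ (t δ)) (GroupPoints.toLin
      (evalPoint c (Algebra.TensorProduct.includeLeft.comp φ) γ)) := by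
  intro δ
  let G : R ⊗[K] A →ₐ[K] S ⊗[K] A :=
    Algebra.TensorProduct.lift (Algebra.TensorProduct.includeLeft.comp φ) γ.ofConv
      fun _ _ => .all _ _
  have hG : ∀ x, invariantDerivationBaseChange S δ (G x) =
      G (invariantDerivationBaseChange R δ x) := by
    intro x
    induction x with
    | zero => simp
    | add x y hx hy => simp only [map_add, hx, hy]
    | tmul r a =>
      have h := LinearMap.congr_fun (congrArg ofConv (hγ δ)) a
      change invariantDerivationBaseChange S δ (γ.ofConv a) =
        γ.ofConv (invariantDerivation δ a) at h
      simp only [G, Algebra.TensorProduct.lift_tmul, LinearMap.lTensor_tmul, AlgHom.comp_apply]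
      rw [invariantDerivationBaseChange_mul, h, invariantDerivationBaseChange_includeLeft, zero_mul,
        add_zero]
  have h1 : ∀ x : WithConv (B →ₗ[K] R),
      convPostcomp G (convPostcomp Algebra.TensorProduct.includeLeft x) =
        convPostcomp Algebra.TensorProduct.includeLeft (convPostcomp φ x) := by
    intro x
    ext b
    simp [convPostcomp_apply, G]
  have h2 := congrArg (convPostcomp G) (hc δ)
  rw [map_add, map_mul, h1] at h2
  refine Eq.trans ?_ h2
  ext b
  exact hG (c b)

/-- The derivative of `g ↦ g • p` for a constant point `p`. -/
theorem derivation_actPoint_universalPoint (δ : groupLie K A K) (p : GroupPoints K B S) :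
    toConv (invariantDerivationBaseChange S δ ∘ₗ (actPoint α.coact (universalPoint K S A)
      (GroupPoints.map Algebra.TensorProduct.includeLeft p)).ofConv.toLinearMap) =
    toConv ((actPoint α.coact (universalPoint K S A)
      (GroupPoints.map Algebra.TensorProduct.includeLeft p)).ofConv.toLinearMap ∘ₗ
        α.infinitesimalAct δ) := by
  ext b
  let κ : A ⊗[K] B →ₐ[K] S ⊗[K] A := Algebra.TensorProduct.lift
    Algebra.TensorProduct.includeRight (Algebra.TensorProduct.includeLeft.comp p.ofConv)
      fun _ _ => .all _ _
  have h1 : ∀ t : A ⊗[K] B, invariantDerivationBaseChange S δ (κ t) =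
      κ (TensorProduct.lid K _ (δ.1.ofConv.rTensor _ (TensorProduct.assoc K A A B
        (Coalgebra.comul.rTensor B t)))) := by
    intro t
    induction t with
    | zero => simp
    | add x y hx hy => simp only [map_add, hx, hy]
    | tmul a b =>
      simp only [κ, Algebra.TensorProduct.lift_tmul, LinearMap.rTensor_tmul, AlgHom.comp_apply,
        Algebra.TensorProduct.includeLeft_apply, Algebra.TensorProduct.includeRight_apply,
        Algebra.TensorProduct.tmul_mul_tmul, one_mul, mul_one, LinearMap.lTensor_tmul, contract,
        LinearMap.comp_apply]
      generalize Coalgebra.comul (R := K) a = t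
      induction t with
      | zero => simp
      | add x y hx hy => simp only [map_add, TensorProduct.tmul_add, TensorProduct.add_tmul, hx, hy]
      | tmul a a' => simp [Algebra.TensorProduct.lift_tmul]
  have h2 : ∀ t : A ⊗[K] B, TensorProduct.lid K _ (δ.1.ofConv.rTensor _
      (α.coact.toLinearMap.lTensor A t)) =
      α.coact (TensorProduct.lid K B (δ.1.ofConv.rTensor B t)) := by
    intro t
    induction t with
    | zero => simp
    | add x y hx hy => simp only [map_add, hx, hy]
    | tmul a b => simp
  change invariantDerivationBaseChange S δ (κ (α.coact b)) =
    κ (α.coact (TensorProduct.lid K B (δ.1.ofConv.rTensor B (α.coact b))))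
  rw [h1, ← α.coact_coassoc, h2]

/-- Infinitesimal automorphisms are coderivations. -/
theorem GroupSchemeAction.convMul_comp_infinitesimalAct (δ : groupLie K A K)
    (x y : WithConv (B →ₗ[K] S)) : toConv ((x * y).ofConv ∘ₗ α.infinitesimalAct δ) =
      toConv (x.ofConv ∘ₗ α.infinitesimalAct δ) * y +
        x * toConv (y.ofConv ∘ₗ α.infinitesimalAct δ) := by
  ext b
  let X : WithConv (A →ₗ[K] S) := convPostcomp (Algebra.ofId K S) δ.1
  have hX : X ∈ groupLie K A S := comp_mem_groupLie δ.2 (Algebra.ofId K S).toLinearMap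
  -- Apply `s ⊗ b ↦ s * y b` to the commutator formula for the translation by `x`.
  let L : S ⊗[K] B →ₗ[S] S := y.ofConv.liftBaseChange S
  have h1 : ∀ v : A ⊗[K] B, X.ofConv.rTensor B v =
      (1 : S) ⊗ₜ TensorProduct.lid K B (δ.1.ofConv.rTensor B v) :=
    fun v => rTensor_algebraMap_comp δ.1.ofConv v
  have h2 : ∀ (z : WithConv (B →ₗ[K] S)) (t : B ⊗[K] B), L (z.ofConv.rTensor B t) =
      LinearMap.mul' K S (TensorProduct.map z.ofConv y.ofConv t) := by
    intro z t
    induction t with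
    | zero => simp
    | add x y hx hy => simp only [map_add, hx, hy]
    | tmul a b => simp [L]
  have h3 : ∀ t : B ⊗[K] B, L (contractBaseChange α.coact.toLinearMap X (x.ofConv.rTensor B t)) =
      LinearMap.mul' K S (TensorProduct.map x.ofConv (y.ofConv ∘ₗ α.infinitesimalAct δ) t) := by
    intro t
    induction t with
    | zero => simp
    | add x y hx hy => simp only [map_add, hx, hy]
    | tmul a b =>
      rw [LinearMap.rTensor_tmul, contractBaseChange_tmul, map_smul, h1]
      simp [L, contract]
  have h4 : α.convAct X x = toConv (x.ofConv ∘ₗ α.infinitesimalAct δ) := by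
    ext b
    rw [α.convAct_apply]
    change _ = x.ofConv (TensorProduct.lid K B (δ.1.ofConv.rTensor B (α.coact b)))
    generalize α.coact b = t
    induction t with
    | zero => simp
    | add x y hx hy => simp only [map_add, hx, hy]
    | tmul a b => simp [X, convPostcomp_apply, Algebra.ofId_apply, ← Algebra.smul_def]
  have h := LinearMap.congr_fun
    (α.contractBaseChange_comul_mul_contractBaseChange_coact X hX x) ((1 : S) ⊗ₜ b)
  rw [LinearMap.add_apply, Module.End.mul_apply, Module.End.mul_apply, contractBaseChange_one_tmul,
    contractBaseChange_one_tmul, contractBaseChange_one_tmul, AlgHom.toLinearMap_apply, h1,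
    contractBaseChange_one_tmul, h4] at h
  have h5 := congrArg L h
  rw [map_add, h2, h2, h3] at h5
  rw [ofConv_add, LinearMap.add_apply, add_comm]
  exact h5

end Points

/-! ### From solutions to cocycles -/

section FromSolution

open WithConv

variable {K A B R : Type u} [Field K] [CharZero K] [CommRing A] [HopfAlgebra K A] [CommRing B]
  [HopfAlgebra K B] [CommRing R] [Algebra K R] {α : GroupSchemeAction K A B}
  {t : groupLie K A K → WithConv (B →ₗ[K] R)}

/-- A morphism `U_R → Π_R` that solves the differential equation and sends `1` to `1` is a
cocycle: for fixed `h`, both `c_{gh}` and `c_g * g(c_h)` are solutions with the value `c_h` at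
`g = 1`. -/
theorem IsCocycleSolution.evalPoint_mul (hU : IsProUnipotent K A) {c : B →ₐ[K] R ⊗[K] A}
    (hc : IsCocycleSolution α t (toConv c.toLinearMap))
    (h1 : ∀ b, evalIdentity K A R (c b) = algebraMap K R (Coalgebra.counit b))
    {S : Type u} [CommRing S] [Algebra K S] (φ : R →ₐ[K] S) (g h : GroupPoints K A S) :
    evalPoint c φ (g * h) = evalPoint c φ g * actPoint α.coact g (evalPoint c φ h) := by
  let incl : S →ₐ[K] S ⊗[K] A := Algebra.TensorProduct.includeLeft
  let u := universalPoint K S A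
  have hu : GroupPoints.map (evalIdentity K A S) u = 1 := by
    ext a
    change evalIdentity K A S (1 ⊗ₜ a) = algebraMap K S (Coalgebra.counit a)
    rw [evalIdentity_tmul, Algebra.algebraMap_eq_smul_one]
  have hincl : (evalIdentity K A S).comp incl = AlgHom.id K S := by
    ext s
    change evalIdentity K A S (s ⊗ₜ 1) = s
    rw [evalIdentity_tmul, Bialgebra.counit_one, one_smul]
  have hmap : ∀ {H : Type u} [CommRing H] [HopfAlgebra K H] (p : GroupPoints K H S),
      GroupPoints.map (evalIdentity K A S) (GroupPoints.map incl p) = p := by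
    intro H _ _ p
    change toConv (((evalIdentity K A S).comp incl).comp p.ofConv) = p
    rw [hincl]
    rfl
  have hφ : (evalIdentity K A S).comp (incl.comp φ) = φ := by
    rw [← AlgHom.comp_assoc, hincl, AlgHom.id_comp]
  have hone : evalPoint c φ (1 : GroupPoints K A S) = 1 := by
    ext b
    have h2 : ∀ x : R ⊗[K] A, Algebra.TensorProduct.lift φ (1 : GroupPoints K A S).ofConv
        (fun _ _ => .all _ _) x = φ (evalIdentity K A R x) := by
      intro x
      induction x with
      | zero => simp
      | add x y hx hy => simp only [map_add, hx, hy]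
      | tmul r a =>
        rw [Algebra.TensorProduct.lift_tmul, evalIdentity_tmul, map_smul, Algebra.smul_def,
          mul_comm]
        rfl
    refine (h2 (c b)).trans ?_
    rw [h1, AlgHom.commutes]
    rfl
  -- The identity for the universal point and the constant point `h`.
  have key : evalPoint c (incl.comp φ) (u * GroupPoints.map incl h) =
      evalPoint c (incl.comp φ) u *
        actPoint α.coact u (GroupPoints.map incl (evalPoint c φ h)) := by
    have e1 := hc.toLin_evalPoint φ (u * GroupPoints.map incl h)
      fun δ => derivation_universalPoint_mul δ h
    have e2 : IsCocycleSolution α (fun δ => convPostcomp φ (t δ))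
        (GroupPoints.toLin (evalPoint c (incl.comp φ) u)) :=
      hc.toLin_evalPoint φ u fun δ => by
        ext a
        simp [u, universalPoint]
    have e3 : IsCocycleSolution α (fun δ => convPostcomp φ (t δ))
        (GroupPoints.toLin (evalPoint c (incl.comp φ) u *
          actPoint α.coact u (GroupPoints.map incl (evalPoint c φ h)))) := by
      intro δ
      have h3 : GroupPoints.toLin (evalPoint c (incl.comp φ) u *
          actPoint α.coact u (GroupPoints.map incl (evalPoint c φ h))) =
          GroupPoints.toLin (evalPoint c (incl.comp φ) u) * GroupPoints.toLin
            (actPoint α.coact u (GroupPoints.map incl (evalPoint c φ h))) :=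
        AlgHom.toLinearMap_convMul _ _
      rw [h3, comp_convMul_of_derivation _ (invariantDerivationBaseChange_mul δ), e2 δ,
        GroupSchemeAction.convMul_comp_infinitesimalAct,
        derivation_actPoint_universalPoint δ (evalPoint c φ h), add_mul, mul_assoc]
      abel
    have e4 := e1.eq_of_evalIdentity_eq hU e3 fun b => by
      have h4 : GroupPoints.map (evalIdentity K A S)
          (evalPoint c (incl.comp φ) (u * GroupPoints.map incl h)) =
          GroupPoints.map (evalIdentity K A S) (evalPoint c (incl.comp φ) u *
            actPoint α.coact u (GroupPoints.map incl (evalPoint c φ h))) := by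
        rw [map_mul, GroupPoints.map_evalPoint, GroupPoints.map_evalPoint,
          GroupPoints.map_actPoint, map_mul, hu, hmap, hmap, hφ, one_mul, hone, one_mul, α.one_act]
      exact AlgHom.congr_fun (congrArg ofConv h4) b
    refine WithConv.ext (AlgHom.ext fun b => ?_)
    exact LinearMap.congr_fun (congrArg ofConv e4) b
  -- Substitute `g` for the universal point.
  let f : S ⊗[K] A →ₐ[K] S :=
    Algebra.TensorProduct.lift (AlgHom.id K S) g.ofConv fun _ _ => .all _ _
  have hf : f.comp incl = AlgHom.id K S := by
    ext s
    simp [f, incl]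
  have hfu : GroupPoints.map f u = g := by
    ext a
    change f (1 ⊗ₜ a) = g.ofConv a
    simp [f]
  have hfmap : ∀ {H : Type u} [CommRing H] [HopfAlgebra K H] (p : GroupPoints K H S),
      GroupPoints.map f (GroupPoints.map incl p) = p := by
    intro H _ _ p
    change toConv ((f.comp incl).comp p.ofConv) = p
    rw [hf]
    rfl
  have h5 := congrArg (GroupPoints.map f) key
  rwa [map_mul, GroupPoints.map_evalPoint, GroupPoints.map_evalPoint, GroupPoints.map_actPoint,
    map_mul, hfu, hfmap, hfmap, ← AlgHom.comp_assoc, hf, AlgHom.id_comp] at h5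

end FromSolution

namespace LieCocycle

open WithConv

variable {K A B R : Type u} [Field K] [CharZero K] [CommRing A] [HopfAlgebra K A] [CommRing B]
  [HopfAlgebra K B] [CommRing R] [Algebra K R] {α : GroupSchemeAction K A B}
  (θ : LieCocycle α R) (hU : IsProUnipotent K A) (hP : IsProUnipotent K B)

/-- The restriction of `orbitPullback` to functions on `Π` defined over `K`. -/
noncomputable def orbitMap : WithConv (B →ₗ[K] R ⊗[K] A) :=
  toConv (θ.orbitPullback hU hP ∘ₗ (TensorProduct.mk K (R ⊗[K] A) B 1))

theorem isCocycleSolution_orbitMap :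
    IsCocycleSolution α (fun δ => (θ.toLinearMap δ).1) (θ.orbitMap hU hP) := by
  intro δ
  ext b
  have h1 : ∀ (x : WithConv (B →ₗ[K] R ⊗[K] A)) (v : B ⊗[K] B),
      θ.orbitPullback hU hP (x.ofConv.rTensor B v) =
        LinearMap.mul' K _ (TensorProduct.map x.ofConv (θ.orbitMap hU hP).ofConv v) := by
    intro x v
    induction v with
    | zero => simp
    | add x y hx hy => simp only [map_add, hx, hy]
    | tmul a b =>
      have h2 : x.ofConv a ⊗ₜ[K] b = x.ofConv a • ((1 : R ⊗[K] A) ⊗ₜ[K] b) := by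
        simp [TensorProduct.smul_tmul']
      rw [LinearMap.rTensor_tmul, h2, orbitPullback_smul]
      rfl
  refine (θ.derivation_orbitPullback hU hP δ b).trans ?_
  rw [vectorField_one_tmul, map_add, h1, extend_scalar, ofConv_add, LinearMap.add_apply]
  congr 1
  exact congrArg (θ.orbitPullback hU hP) (rTensor_algebraMap_comp δ.1.ofConv (α.coact b))

theorem evalIdentity_orbitMap (b : B) : evalIdentity K A R ((θ.orbitMap hU hP).ofConv b) =
    algebraMap K R (Coalgebra.counit b) := by
  rw [evalIdentity_apply]
  refine (congrArg _ (θ.counit_orbitPullback hU hP b)).trans ?_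
  rw [map_smul, Algebra.TensorProduct.one_def, TensorProduct.rid_tmul, one_smul,
    Algebra.algebraMap_eq_smul_one]

/-- The group cocycle with a given differential. -/
noncomputable def toGroupCocycle : GroupCocycle α R where
  toAlgHom := AlgHom.ofLinearMap (θ.orbitMap hU hP).ofConv
    ((θ.isCocycleSolution_orbitMap hU hP).apply_one hU (fun δ => (θ.toLinearMap δ).2)
      (by simp [evalIdentity_orbitMap]))
    ((θ.isCocycleSolution_orbitMap hU hP).apply_mul hU (fun δ => (θ.toLinearMap δ).2)
      (by simp [evalIdentity_orbitMap]))
  cocycle S _ _ φ g h :=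
    IsCocycleSolution.evalPoint_mul hU (θ.isCocycleSolution_orbitMap hU hP)
      (θ.evalIdentity_orbitMap hU hP) φ g h

end LieCocycle

/-! ### The differential of a group cocycle -/

namespace GroupCocycle

open WithConv

variable {K A B R : Type u} [Field K] [CommRing A] [HopfAlgebra K A] [CommRing B]
  [HopfAlgebra K B] [CommRing R] [Algebra K R] {α : GroupSchemeAction K A B}
  (c : GroupCocycle α R)

theorem evalIdentity_toAlgHom (b : B) : evalIdentity K A R (c.toAlgHom b) =
    algebraMap K R (Coalgebra.counit b) := by
  have h := c.cocycle R (AlgHom.id K R) 1 1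
  rw [mul_one, α.one_act] at h
  refine Eq.trans ?_ (congrArg (fun p : GroupPoints K B R => p.ofConv b)
    ((GroupPoints.isUnit _).mul_eq_left.mp h.symm))
  rfl

theorem evalIdentity_invariantDerivationBaseChange_toAlgHom (δ : groupLie K A K) (b : B) :
    evalIdentity K A R (invariantDerivationBaseChange R δ (c.toAlgHom b)) = c.differential δ b :=
  _root_.evalIdentity_invariantDerivationBaseChange δ _

theorem differential_mem (δ : groupLie K A K) : toConv (c.differential δ) ∈ groupLie K B R := by
  intro a b
  change c.differential δ (a * b) = _ • c.differential δ b + _ • c.differential δ a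
  simp only [← evalIdentity_invariantDerivationBaseChange_toAlgHom, map_mul,
    invariantDerivationBaseChange_mul, map_add, evalIdentity_toAlgHom, Algebra.smul_def]
  ring

/-- The differential of a cocycle, as a linear map on `Lie U`. -/
noncomputable def differentialLinearMap : groupLie K A K →ₗ[K] groupLie K B R where
  toFun δ := ⟨toConv (c.differential δ), c.differential_mem δ⟩
  map_add' δ δ' := by
    ext b
    simp [differential, LinearMap.lTensor_add]
  map_smul' k δ := by
    ext b
    simp [differential, LinearMap.lTensor_smul]

/-- A cocycle satisfies the differential equation. -/
theorem isCocycleSolution : IsCocycleSolution α (fun δ => toConv (c.differential δ))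
    (toConv c.toAlgHom.toLinearMap) := by
  intro δ
  -- Differentiate the cocycle identity for the two universal points of `U` with values in
  -- `O(U) ⊗ (R ⊗ O(U))` with respect to the first one.
  let φ : R →ₐ[K] A ⊗[K] (R ⊗[K] A) :=
    Algebra.TensorProduct.includeRight.comp Algebra.TensorProduct.includeLeft
  let g : GroupPoints K A (A ⊗[K] (R ⊗[K] A)) :=
    toConv Algebra.TensorProduct.includeLeft
  let h : GroupPoints K A (A ⊗[K] (R ⊗[K] A)) :=
    toConv (Algebra.TensorProduct.includeRight.comp Algebra.TensorProduct.includeRight)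
  let f : A ⊗[K] (R ⊗[K] A) →ₗ[K] R ⊗[K] A :=
    (TensorProduct.lid K (R ⊗[K] A)).toLinearMap ∘ₗ δ.1.ofConv.rTensor (R ⊗[K] A)
  let e : A ⊗[K] (R ⊗[K] A) →ₗ[K] R ⊗[K] A := (TensorProduct.lid K (R ⊗[K] A)).toLinearMap ∘ₗ
    (Coalgebra.counit (R := K) (A := A)).rTensor (R ⊗[K] A)
  have hgt : ∀ a, g.ofConv a = a ⊗ₜ 1 := fun _ => rfl
  have hht : ∀ a, h.ofConv a = 1 ⊗ₜ (1 ⊗ₜ a) := fun _ => rfl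
  have hφt : ∀ r, φ r = 1 ⊗ₜ (r ⊗ₜ 1) := fun _ => rfl
  have hfmul : ∀ x y, f (x * y) = e x * f y + f x * e y := lid_rTensor_mul_of_mem_groupLie δ
  have hft : ∀ a x, f (a ⊗ₜ x) = δ.1.ofConv a • x := fun _ _ => rfl
  have het : ∀ a x, e (a ⊗ₜ x) = Coalgebra.counit (R := K) a • x := fun _ _ => rfl
  let P := evalPoint c.toAlgHom φ g
  let Q := actPoint α.coact g (evalPoint c.toAlgHom φ h)
  have hh : ∀ b, (evalPoint c.toAlgHom φ h).ofConv b = 1 ⊗ₜ c.toAlgHom b := by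
    intro b
    change Algebra.TensorProduct.lift φ h.ofConv (fun _ _ => .all _ _) (c.toAlgHom b) = _
    induction c.toAlgHom b with
    | zero => simp
    | add x y hx hy => simp only [map_add, TensorProduct.tmul_add, hx, hy]
    | tmul r a => simp [hφt, hht]
  have hQ : ∀ b, Q.ofConv b = c.toAlgHom.toLinearMap.lTensor A (α.coact b) := by
    intro b
    change Algebra.TensorProduct.lift g.ofConv (evalPoint c.toAlgHom φ h).ofConv
      (fun _ _ => .all _ _) (α.coact b) = _
    induction α.coact b with
    | zero => simp
    | add x y hx hy => simp only [map_add, hx, hy]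
    | tmul a b => simp [hh, hgt]
  have eP : ∀ b, e (P.ofConv b) = algebraMap K _ (Coalgebra.counit b) := by
    intro b
    have h1 : ∀ x : R ⊗[K] A, e (Algebra.TensorProduct.lift φ g.ofConv (fun _ _ => .all _ _) x) =
        evalIdentity K A R x ⊗ₜ[K] (1 : A) := by
      intro x
      induction x with
      | zero => simp
      | add x y hx hy => simp only [map_add, TensorProduct.add_tmul, hx, hy]
      | tmul r a => simp [hφt, hgt, het, evalIdentity_tmul, TensorProduct.smul_tmul']
    refine (h1 _).trans ?_
    refine (congrArg (· ⊗ₜ[K] (1 : A)) (c.evalIdentity_toAlgHom b)).trans ?_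
    rfl
  have fP : ∀ b, f (P.ofConv b) = c.differential δ b ⊗ₜ 1 := by
    intro b
    have h1 : ∀ x : R ⊗[K] A, f (Algebra.TensorProduct.lift φ g.ofConv (fun _ _ => .all _ _) x) =
        TensorProduct.rid K R (δ.1.ofConv.lTensor R x) ⊗ₜ[K] (1 : A) := by
      intro x
      induction x with
      | zero => simp
      | add x y hx hy => simp only [map_add, TensorProduct.add_tmul, hx, hy]
      | tmul r a => simp [hφt, hgt, hft, TensorProduct.smul_tmul']
    exact h1 _
  have eQ : ∀ b, e (Q.ofConv b) = c.toAlgHom b := by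
    intro b
    have h1 : ∀ x : A ⊗[K] B, e (c.toAlgHom.toLinearMap.lTensor A x) = c.toAlgHom
        (TensorProduct.lid K B ((Coalgebra.counit (R := K) (A := A)).rTensor B x)) := by
      intro x
      induction x with
      | zero => simp
      | add x y hx hy => simp only [map_add, hx, hy]
      | tmul a b => simp [het]
    rw [hQ, h1, α.counit_coact]
  have fQ : ∀ b, f (Q.ofConv b) = c.toAlgHom (α.infinitesimalAct δ b) := by
    intro b
    have h1 : ∀ x : A ⊗[K] B, f (c.toAlgHom.toLinearMap.lTensor A x) = c.toAlgHom
        (TensorProduct.lid K B (δ.1.ofConv.rTensor B x)) := by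
      intro x
      induction x with
      | zero => simp
      | add x y hx hy => simp only [map_add, hx, hy]
      | tmul a b => simp [hft]
    rw [hQ, h1]
    rfl
  have fgh : ∀ b, f ((evalPoint c.toAlgHom φ (g * h)).ofConv b) =
      invariantDerivationBaseChange R δ (c.toAlgHom b) := by
    intro b
    change f (Algebra.TensorProduct.lift φ (g * h).ofConv (fun _ _ => .all _ _) (c.toAlgHom b)) = _
    induction c.toAlgHom b with
    | zero => simp
    | add x y hx hy => simp only [map_add, hx, hy]
    | tmul r a =>
      rw [Algebra.TensorProduct.lift_tmul, LinearMap.lTensor_tmul]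
      change f (φ r * (g * h) a) = r ⊗ₜ TensorProduct.lid K A (δ.1.ofConv.rTensor A _)
      rw [AlgHom.convMul_apply]
      generalize Coalgebra.comul (R := K) a = t
      induction t with
      | zero => simp
      | add x y hx hy => simp only [map_add, mul_add, TensorProduct.tmul_add, hx, hy]
      | tmul a a' => simp [hφt, hgt, hht, hft]
  have hPQ : ∀ v : B ⊗[K] B, f (LinearMap.mul' K (A ⊗[K] (R ⊗[K] A))
      (TensorProduct.map P.ofConv.toLinearMap Q.ofConv.toLinearMap v)) =
      c.toAlgHom (α.infinitesimalAct δ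
        (TensorProduct.lid K B ((Coalgebra.counit (R := K) (A := B)).rTensor B v))) +
      LinearMap.mul' K _ (TensorProduct.map (convPostcomp Algebra.TensorProduct.includeLeft
        (toConv (c.differential δ))).ofConv c.toAlgHom.toLinearMap v) := by
    intro v
    induction v with
    | zero => simp
    | add x y hx hy => simp only [map_add, hx, hy]; abel
    | tmul b b' =>
      simp only [TensorProduct.map_tmul, LinearMap.mul'_apply, AlgHom.toLinearMap_apply, hfmul, eP,
        fP, eQ, fQ, convPostcomp_apply, LinearMap.rTensor_tmul, TensorProduct.lid_tmul, map_smul,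
        ← Algebra.smul_def, Algebra.TensorProduct.includeLeft_apply]
  ext b
  have key : f ((evalPoint c.toAlgHom φ (g * h)).ofConv b) = f ((P * Q).ofConv b) :=
    congrArg (fun p : GroupPoints K B (A ⊗[K] (R ⊗[K] A)) => f (p.ofConv b))
      (c.cocycle _ φ g h)
  have h2 : (P * Q).ofConv b = LinearMap.mul' K (A ⊗[K] (R ⊗[K] A))
      (TensorProduct.map P.ofConv.toLinearMap Q.ofConv.toLinearMap (Coalgebra.comul b)) :=
    LinearMap.congr_fun (congrArg ofConv (AlgHom.toLinearMap_convMul P Q)) b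
  rw [fgh, h2, hPQ, Coalgebra.rTensor_counit_comul, TensorProduct.lid_tmul, one_smul, add_comm]
    at key
  exact key

/-- The differential is continuous because a tangent vector on `Π` is determined by its values at
finitely many generators of `O(Π)`. -/
theorem exists_finset_differential [Algebra.FiniteType K B] : ∃ F : Finset A,
    ∀ δ : groupLie K A K, (∀ a ∈ F, δ.1 a = 0) → c.differentialLinearMap δ = 0 := by
  classical
  obtain ⟨s, hs⟩ := (inferInstance : Algebra.FiniteType K B).out
  choose F hF using fun b : B => exists_finset_lTensor_eq_zero (W := K) (c.toAlgHom b)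
  refine ⟨s.biUnion F, fun δ hδ => Subtype.ext (WithConv.ext (LinearMap.ext fun b => ?_))⟩
  have hmem := c.differential_mem δ
  change c.differential δ b = 0
  have hb : b ∈ Algebra.adjoin K (s : Set B) := hs ▸ Algebra.mem_top
  induction hb using Algebra.adjoin_induction with
  | mem b hb =>
    change TensorProduct.rid K R (δ.1.ofConv.lTensor R (c.toAlgHom b)) = 0
    rw [hF b _ fun a ha => hδ a (Finset.mem_biUnion.2 ⟨b, hb, ha⟩), map_zero]
  | algebraMap k =>
    rw [Algebra.algebraMap_eq_smul_one, map_smul]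
    exact (congrArg (k • ·) (apply_one_of_mem_groupLie hmem)).trans (smul_zero k)
  | add x y _ _ hx hy => rw [map_add, hx, hy, add_zero]
  | mul x y _ _ hx hy =>
    refine (hmem x y).trans ?_
    change _ • c.differential δ y + _ • c.differential δ x = 0
    rw [hx, hy, smul_zero, smul_zero, add_zero]

/-- The second derivative of a cocycle at the identity. -/
theorem evalIdentity_derivation_derivation (δ δ' : groupLie K A K) (b : B) :
    evalIdentity K A R (invariantDerivationBaseChange R δ
      (invariantDerivationBaseChange R δ' (c.toAlgHom b))) =
      (toConv (c.differential δ') * toConv (c.differential δ)).ofConv b +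
        c.differential δ (α.infinitesimalAct δ' b) := by
  let D := invariantDerivationBaseChange (K := K) (H := A) R δ
  let x := convPostcomp (Algebra.TensorProduct.includeLeft : R →ₐ[K] R ⊗[K] A)
    (toConv (c.differential δ'))
  have h1 : toConv (D ∘ₗ x.ofConv) = 0 := by
    ext b
    exact invariantDerivationBaseChange_includeLeft δ _
  have h2 : convPostcomp (evalIdentity K A R) x = toConv (c.differential δ') := by
    ext b
    change evalIdentity K A R (c.differential δ' b ⊗ₜ 1) = c.differential δ' b
    rw [evalIdentity_tmul, Bialgebra.counit_one, one_smul]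
  have h3 : convPostcomp (evalIdentity K A R) (toConv (D ∘ₗ c.toAlgHom.toLinearMap)) =
      toConv (c.differential δ) := by
    ext b
    exact c.evalIdentity_invariantDerivationBaseChange_toAlgHom δ b
  have h4 := comp_convMul_of_derivation D (invariantDerivationBaseChange_mul δ) x
    (toConv c.toAlgHom.toLinearMap)
  rw [h1, zero_mul, add_zero] at h4
  have h5 := congrArg (fun y => (convPostcomp (evalIdentity K A R) y).ofConv b) h4
  rw [map_mul, h2] at h5
  change _ = (_ * convPostcomp (evalIdentity K A R)
    (toConv (D ∘ₗ c.toAlgHom.toLinearMap))).ofConv b at h5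
  rw [h3] at h5
  have h6 := LinearMap.congr_fun (congrArg ofConv (c.isCocycleSolution δ')) b
  change invariantDerivationBaseChange R δ' (c.toAlgHom b) =
    (x * toConv c.toAlgHom.toLinearMap).ofConv b + c.toAlgHom (α.infinitesimalAct δ' b) at h6
  rw [h6, map_add, map_add, evalIdentity_invariantDerivationBaseChange_toAlgHom, ← h5]
  rfl

theorem invariantDerivationBaseChange_lie (δ δ' : groupLie K A K) (x : R ⊗[K] A) :
    invariantDerivationBaseChange R ⁅δ, δ'⁆ x =
      invariantDerivationBaseChange R δ' (invariantDerivationBaseChange R δ x) -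
        invariantDerivationBaseChange R δ (invariantDerivationBaseChange R δ' x) := by
  have h : ∀ a : A, invariantDerivation ⁅δ, δ'⁆ a =
      invariantDerivation δ' (invariantDerivation δ a) -
        invariantDerivation δ (invariantDerivation δ' a) := by
    intro a
    have hc : ∀ a : A, (Coalgebra.comul (R := K)).lTensor A (Coalgebra.comul a) =
        TensorProduct.assoc K A A A (Coalgebra.comul.rTensor A (Coalgebra.comul a)) :=
      fun a => (Coalgebra.coassoc_apply a).symm
    rw [← contract_mul _ hc, ← contract_mul _ hc, invariantDerivation, lie_eq_mul_sub_mul]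
    simp only [contract, ofConv_sub, LinearMap.rTensor_sub, LinearMap.comp_apply,
      LinearMap.sub_apply, map_sub]
  induction x with
  | zero => simp
  | add x y hx hy => simp only [map_add, hx, hy]; abel
  | tmul r a => simp only [LinearMap.lTensor_tmul, h, TensorProduct.tmul_sub]

/-- The cocycle condition for the differential, from the commutator of second derivatives. -/
theorem differentialLinearMap_lie (δ δ' : groupLie K A K) :
    c.differentialLinearMap ⁅δ, δ'⁆ =
      ⁅c.differentialLinearMap δ, c.differentialLinearMap δ'⁆ +
        α.lieAct δ (c.differentialLinearMap δ') - α.lieAct δ' (c.differentialLinearMap δ) := by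
  refine Subtype.ext (WithConv.ext (LinearMap.ext fun b => ?_))
  have h1 : ∀ δ δ', (α.lieAct δ (c.differentialLinearMap δ')).1.ofConv b =
      c.differential δ' (α.infinitesimalAct δ b) := by
    intro δ δ'
    change TensorProduct.lid K R (TensorProduct.map δ.1.ofConv (c.differential δ') (α.coact b)) =
      c.differential δ' (TensorProduct.lid K B (δ.1.ofConv.rTensor B (α.coact b)))
    induction α.coact b with
    | zero => simp
    | add x y hx hy => simp only [map_add, hx, hy]
    | tmul a b => simp
  change c.differential ⁅δ, δ'⁆ b =
    ((toConv (c.differential δ) * toConv (c.differential δ')).ofConv b -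
      (toConv (c.differential δ') * toConv (c.differential δ)).ofConv b) +
        (α.lieAct δ (c.differentialLinearMap δ')).1.ofConv b -
          (α.lieAct δ' (c.differentialLinearMap δ)).1.ofConv b
  rw [h1, h1, ← evalIdentity_invariantDerivationBaseChange_toAlgHom,
    invariantDerivationBaseChange_lie, map_sub, evalIdentity_derivation_derivation,
    evalIdentity_derivation_derivation]
  abel

/-- The differential of a group cocycle, a Lie algebra cocycle. -/
noncomputable def toLieCocycle [Algebra.FiniteType K B] : LieCocycle α R where
  toLinearMap := c.differentialLinearMap
  continuous := c.exists_finset_differential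
  cocycle := c.differentialLinearMap_lie

/-- A cocycle is determined by its differential. -/
theorem ext_of_differential [CharZero K] (hU : IsProUnipotent K A) {c c' : GroupCocycle α R}
    (h : ∀ δ, c.differential δ = c'.differential δ) : c = c' := by
  have h1 := c.isCocycleSolution
  simp only [h] at h1
  have h2 := h1.eq_of_evalIdentity_eq hU c'.isCocycleSolution fun b =>
    (c.evalIdentity_toAlgHom b).trans (c'.evalIdentity_toAlgHom b).symm
  have h3 : c.toAlgHom = c'.toAlgHom :=
    AlgHom.ext fun b => LinearMap.congr_fun (congrArg ofConv h2) b
  cases c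
  cases c'
  cases h3
  rfl

end GroupCocycle

theorem LieCocycle.differential_toGroupCocycle {K A B R : Type u} [Field K] [CharZero K]
    [CommRing A] [HopfAlgebra K A] [CommRing B] [HopfAlgebra K B] [CommRing R] [Algebra K R]
    {α : GroupSchemeAction K A B} (θ : LieCocycle α R) (hU : IsProUnipotent K A)
    (hP : IsProUnipotent K B) (δ : groupLie K A K) :
    (θ.toGroupCocycle hU hP).differential δ = (θ.toLinearMap δ).1.ofConv := by
  ext b
  let c := θ.toGroupCocycle hU hP
  let x := convPostcomp (Algebra.TensorProduct.includeLeft : R →ₐ[K] R ⊗[K] A)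
    (θ.toLinearMap δ).1
  have h1 : convPostcomp (evalIdentity K A R) x = (θ.toLinearMap δ).1 := by
    ext b
    change evalIdentity K A R ((θ.toLinearMap δ).1.ofConv b ⊗ₜ 1) = _
    rw [evalIdentity_tmul, Bialgebra.counit_one, one_smul]
  have h2 : convPostcomp (evalIdentity K A R) (θ.orbitMap hU hP) = 1 := by
    ext b
    exact θ.evalIdentity_orbitMap hU hP b
  have h3 : convPostcomp (evalIdentity K A R) (x * θ.orbitMap hU hP) = (θ.toLinearMap δ).1 := by
    rw [map_mul, h1, h2, mul_one]
  have h4 := LinearMap.congr_fun (congrArg WithConv.ofConv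
    (θ.isCocycleSolution_orbitMap hU hP δ)) b
  change invariantDerivationBaseChange R δ (c.toAlgHom b) =
    (x * θ.orbitMap hU hP).ofConv b + c.toAlgHom (α.infinitesimalAct δ b) at h4
  rw [← c.evalIdentity_invariantDerivationBaseChange_toAlgHom, h4, map_add,
    c.evalIdentity_toAlgHom, α.counit_infinitesimalAct, map_zero, add_zero]
  exact LinearMap.congr_fun (congrArg WithConv.ofConv h3) b

theorem LieCocycle.ext_toLinearMap {K A B R : Type u} [Field K] [CommRing A] [HopfAlgebra K A]
    [CommRing B] [HopfAlgebra K B] [CommRing R] [Algebra K R] {α : GroupSchemeAction K A B}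
    {θ θ' : LieCocycle α R} (h : θ.toLinearMap = θ'.toLinearMap) : θ = θ' := by
  cases θ
  cases θ'
  cases h
  rfl

theorem mainTheorem6 {K A B : Type u} [Field K] [CharZero K]
    [CommRing A] [HopfAlgebra K A] [CommRing B] [HopfAlgebra K B]
    (hU : IsProUnipotent K A) (hP : IsUnipotentGroup K B) (α : GroupSchemeAction K A B)
    (R : Type u) [CommRing R] [Algebra K R] :
    ∃ Φ : GroupCocycle α R ≃ LieCocycle α R,
      ∀ (c : GroupCocycle α R) (δ : groupLie K A K),
        ((Φ c).toLinearMap δ).1.ofConv = c.differential δ := by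
  have := hP.1
  refine ⟨Equiv.ofBijective (fun c : GroupCocycle α R => c.toLieCocycle)
    ⟨fun c c' h => ?_, fun θ => ?_⟩, fun c δ => ?_⟩
  · refine GroupCocycle.ext_of_differential hU fun δ => ?_
    exact congrArg (fun θ : LieCocycle α R => (θ.toLinearMap δ).1.ofConv) h
  · exact ⟨θ.toGroupCocycle hU hP.2, LieCocycle.ext_toLinearMap (LinearMap.ext fun δ =>
      Subtype.ext (WithConv.ext (θ.differential_toGroupCocycle hU hP.2 δ)))⟩
  · rfl
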